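/- Let $X_m(k)$ ($m\ge 0$, $k\ge 1$) be i.i.d. random variables with $P(X_m(k)=1)=P(X_m(k)=-1)=\tfrac12$, and put $S_m(n)=\sum_{k=1}^n X_m(k)$, $S_m(0)=0$. Let $T_m(0)=0$ and $T_m(k+1)=\min\{n>T_m(k): |S_m(n)-S_m(T_m(k))|=2\}$. The twisted walks $\tilde S_m(n)=\sum_{k=1}^n\tilde X_m(k)$ are defined by $\tilde X_0=X_0$ and, for $m\ge1$ and $T_m(k)<n\le T_m(k+1)$, by $\tilde X_m(n)=X_m(n)$ if $S_m(T_m(k+1))-S_m(T_m(k))=2\tilde X_{m-1}(k+1)$, and $\tilde X_m(n)=-X_m(n)$ otherwise. Let $\tilde B_m(t)=2^{-m}\tilde S_m(t2^{2m})$ ($t\ge0$), where $\tilde S_m$ is interpolated linearly between the integers. At the grid points $t_k=k2^{-2m}$, $x_j=j2^{-m}$ ($k\in\mathbb N_0$, $j\in\mathbb Z$) let $\mathcal L_m(t_k,x_j)=2^{-m}\,\#\{i: 0\le i<k,\ \tilde S_m(i)=j\}$, and extend $\mathcal L_m$ to $[0,\infty)\times\mathbb R$ by affine interpolation on each of the two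 triangles into which the diagonal from $(t_k,x_j)$ to $(t_{k+1},x_{j+1})$ divides the cell $[t_k,t_{k+1}]\times[x_j,x_{j+1}]$. Write $K_*=\max\{1,K\}$ and $\log_*K=\max\{1,\log K\}$. Almost surely, $\tilde B_m$ converges uniformly on bounded intervals to a Brownian motion $W$, and on every strip $[0,K]\times\mathbb R$ the functions $\mathcal L_m(t,x)$ converge uniformly as $m\to\infty$. The limit $\mathcal L(t,x)$ is almost surely jointly continuous in $(t,x)$ and is the local time of $W$: almost surely, for all $t\ge0$ and $x\in\mathbb R$, with $\lambda$ the Lebesgue measure, $$\mathcal L(t,x)=\lim_{\varepsilon\searrow0}\frac1{2\varepsilon}\,\lambda\{s\in[0,t]: W(s)\in(x-\varepsilon,x+\varepsilon)\}.$$ For every $C>1$ there is a number $N(C)$, depending only on $C$, such that for all $K>0$ and all integers $m\ge1$ with $K2^{2m}\ge N(C)$, $$P\Big(\sup_{(t,x)\in[0,K]\times\mathbb R}|\mathcal L(t,x)-\mathcal L_m(t,x)|\ge 79\,C K_*^{1/4}(\log_*K)^{3/4}m^{3/4}2^{-m/2}\Big)\le\frac{15}{1-4^{1-C}}\,(K2^{2m})^{1-C}.$$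 Consequently, for every fixed $K>0$, almost surely $$\limsup_{m\to\infty} m^{-3/4}2^{m/2}\sup_{[0,K]\times\mathbb R}|\mathcal L-\mathcal L_m|<80\,K_*^{1/4}(\log_*K)^{3/4},$$ and, for every fixed integer $m\ge1$, almost surely $$\limsup_{K\to\infty} K^{-1/4}(\log K)^{-3/4}\sup_{[0,K]\times\mathbb R}|\mathcal L-\mathcal L_m|<159\,m^{3/4}2^{-m/2}.$$ -/

import Mathlib

open MeasureTheory ProbabilityTheory Filter Topology Set
open scoped NNReal ENNReal

noncomputable section

namespace TwistShrink

/-- Partial sums `S(n) = ξ(1) + ⋯ + ξ(n)`, `S(0) = 0`; the value `ξ 0` is never used. -/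
def partialSum (ξ : ℕ → ℤ) (n : ℕ) : ℤ := ∑ k ∈ Finset.Icc 1 n, ξ k

/-- `T(0) = 0`, `T(k+1) = min {n : n > T(k), |S(n) - S(T(k))| = 2}`. -/
def stopTime (S : ℕ → ℤ) : ℕ → ℕ
  | 0 => 0
  | k + 1 => sInf {n : ℕ | stopTime S k < n ∧ |S n - S (stopTime S k)| = 2}

/-- The index `k` of the bridge `T(k) < n ≤ T(k+1)` that contains `n ≥ 1`. -/
def bridgeIndex (T : ℕ → ℕ) (n : ℕ) : ℕ := sInf {k : ℕ | n ≤ T (k + 1)}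

/-- Twisting the steps `ξ` along the coarser steps `η`: the bridge number `k` of the walk with
steps `ξ` is kept if its increment equals `2 η(k+1)`, and is flipped otherwise. -/
def twist (ξ η : ℕ → ℤ) (n : ℕ) : ℤ :=
  let S := partialSum ξ
  let T := stopTime S
  let k := bridgeIndex T n
  if S (T (k + 1)) - S (T k) = 2 * η (k + 1) then ξ n else - ξ n

/-- The steps of the twisted walks, made from the matrix of steps `X m k` (`m ≥ 0`, `k ≥ 1`). -/
def twistedStep (X : ℕ → ℕ → ℤ) : ℕ → ℕ → ℤ
  | 0 => X 0
  | m + 1 => twist (X (m + 1)) (twistedStep X m)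

/-- The `m`-th twisted random walk. -/
def twistedWalk (X : ℕ → ℕ → ℤ) (m : ℕ) : ℕ → ℤ := partialSum (twistedStep X m)

/-- Linear interpolation in `t ≥ 0` of a function on the nonnegative integers. -/
def linInterp (f : ℕ → ℝ) (t : ℝ) : ℝ :=
  f ⌊t⌋₊ + (t - ⌊t⌋₊) * (f (⌊t⌋₊ + 1) - f ⌊t⌋₊)

/-- The `m`-th approximating walk `2^{-m} S̃_m(t 2^{2m})`. -/
def approxWalk (X : ℕ → ℕ → ℤ) (m : ℕ) (t : ℝ≥0) : ℝ :=
  linInterp (fun n => (twistedWalk X m n : ℝ)) ((t : ℝ) * 2 ^ (2 * m)) / 2 ^ m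

/-- Local time of an integer walk: the number of `j` with `0 ≤ j < k` and `S j = x`. -/
def walkLocalTime (S : ℕ → ℤ) (k : ℕ) (x : ℤ) : ℕ :=
  ((Finset.range k).filter (fun j => S j = x)).card

/-- Rescaled local time at the grid point `(t_k, x_j) = (k 2^{-2m}, j 2^{-m})`. -/
def gridLocalTime (X : ℕ → ℕ → ℤ) (m k : ℕ) (j : ℤ) : ℝ :=
  (walkLocalTime (twistedWalk X m) k j : ℝ) / 2 ^ m

/-- The rescaled local time of the `m`-th approximating walk, interpolated linearly on the two
triangles of each cell `[t_k, t_{k+1}] × [x_j, x_{j+1}]`. Here `u = (t - t_k)/(t_{k+1} - t_k)` and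
`v = (x - x_j)/(x_{j+1} - x_j)`, so that `x ≥ x_j + 2^m (t - t_k)` reads `u ≤ v`. -/
def approxLocalTime (X : ℕ → ℕ → ℤ) (m : ℕ) (t : ℝ≥0) (x : ℝ) : ℝ :=
  let k : ℕ := ⌊(t : ℝ) * 2 ^ (2 * m)⌋₊
  let j : ℤ := ⌊x * 2 ^ m⌋
  let u : ℝ := (t : ℝ) * 2 ^ (2 * m) - k
  let v : ℝ := x * 2 ^ m - j
  let g := gridLocalTime X m
  if u ≤ v then
    g k j + u * (g (k + 1) (j + 1) - g k (j + 1)) + v * (g k (j + 1) - g k j)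
  else
    g k j + u * (g (k + 1) j - g k j) + v * (g (k + 1) (j + 1) - g (k + 1) j)

/-- `log_* x = max {1, log x}`. -/
def logStar (x : ℝ) : ℝ := max 1 (Real.log x)

/-- `sup |f(t,x) - g(t,x)|` over the strip `[0, K] × ℝ`, in `[0, ∞]`. -/
def stripDist (K : ℝ) (f g : ℝ≥0 → ℝ → ℝ) : ℝ≥0∞ :=
  ⨆ (t : ℝ≥0) (_ : (t : ℝ) ≤ K) (x : ℝ), ENNReal.ofReal |f t x - g t x|

/-- `l` is the local time of the path `w` in the sense of Lévy: `l t x` is the limit as `ε ↓ 0` of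
`(2ε)⁻¹ λ {s ∈ [0, t] : w s ∈ (x - ε, x + ε)}`. -/
def IsLevyLocalTime (w : ℝ≥0 → ℝ) (l : ℝ≥0 → ℝ → ℝ) : Prop :=
  ∀ (t : ℝ≥0) (x : ℝ),
    Tendsto (fun ε : ℝ => 1 / (2 * ε) *
        volume.real {s : ℝ | s ∈ Icc 0 (t : ℝ) ∧ w s.toNNReal ∈ Ioo (x - ε) (x + ε)})
      (𝓝[>] 0) (𝓝 (l t x))

end TwistShrink

end

/-! Cut a walk with signs as steps into pairs of steps. An unmatched pair returns to its start, a
matched pair moves by ±2, so each bridge between two stopping times ends with its first matched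
pair. Twisting multiplies every bridge by one sign. Hence the twisted walk of level m+1, observed
after p pairs, is twice the walk of level m at the number of matched pairs among them (`Refines`).
The sign of a bridge is determined by the earlier coins of the same level and by a sequence
independent of them. So every twisted walk is again a fair walk (`fairSigns_signedStep`); no
independence between different levels is needed afterwards.

All randomness enters through one estimate. For a sum M of fair signs with predictable coefficients
in {-1, 0, 1} and quadratic variation V, the exponential supermartingale gives M² ≤ 2ΛV outside
probability of order e^{-Λ}, up to polynomial factors (`prob_not_controlled_le`). Five families of
such sums, with all starts and ends up to a horizon H, are `Good` outside probability
10(H+1)³e^{-Λ}. The horizon is about 2n, where n = K4^m, and Λ = 3C log n, so the failure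
probabilities sum geometrically over the levels.

On the good event everything is deterministic (`level_estimate`). Among 2k pairs the number of
matched ones differs from k by at most q = √(nΛ). Over a time window of length q the walk and, by
Tanaka's formula, its local times change by O(√(qΛ)), which is n^{1/4}(log n)^{3/4} up to constants.
At an even site the local time of the fine walk is twice that of the coarse walk minus a sum of
products over pairs; its quadratic variation is a local time, hence O(q). The local time at an odd
site is compared with those of its neighbours by counting crossings. After rescaling, consecutive
levels differ by terms of a geometric series of ratio 3/4, which gives uniform convergence and the
rate.

The limit of the walks is Brownian because the characteristic functions of the increments are powers
of cosines (`isPreBrownianReal_of_tendsto`). The limit of the local times is Lévy's because the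
occupation time of a small interval is a sum of discrete local times over its sites
(`occupation_estimate`). Both almost sure rates follow by Borel–Cantelli with C = 21/20, the one for
K → ∞ along dyadic K. -/

namespace TwistShrink

/-! ### Pathwise structure of the twisting: matched pairs and bridges -/

/-- All steps `x 1, x 2, …` are `±1`. -/
def IsSign (x : ℕ → ℤ) : Prop := ∀ k, 1 ≤ k → x k = 1 ∨ x k = -1

/-- The `i`-th pair of steps `x (2 i + 1), x (2 i + 2)` moves the walk by `±2`. -/
def Matched (x : ℕ → ℤ) (i : ℕ) : Prop := x (2 * i + 1) = x (2 * i + 2)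

instance (x : ℕ → ℤ) : DecidablePred (Matched x) :=
  fun i => inferInstanceAs (Decidable (x (2 * i + 1) = x (2 * i + 2)))

/-- The number of matched pairs among the first `n`. -/
def matchCount (x : ℕ → ℤ) (n : ℕ) : ℕ := Nat.count (Matched x) n

open Classical in
/-- The sign of the increment over the bridge number `k`. -/
noncomputable def bridgeSign (x : ℕ → ℤ) (k : ℕ) : ℤ :=
  if ∃ i, Matched x i ∧ matchCount x i = k ∧ x (2 * i + 1) = 1 then 1 else -1

/-- The sign with which the twisting multiplies the bridge number `k - 1`. -/
noncomputable def flipSign (x y : ℕ → ℤ) (k : ℕ) : ℤ :=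
  if y k = 1 then bridgeSign x (k - 1) else -bridgeSign x (k - 1)

/-- The walk steps `x` with the bridge number `k` multiplied by `s (k + 1)`. -/
def mergeSign (x s : ℕ → ℤ) (n : ℕ) : ℤ := x n * s (matchCount x ((n - 1) / 2) + 1)

@[simp] lemma partialSum_zero (x : ℕ → ℤ) : partialSum x 0 = 0 := by simp [partialSum]

lemma partialSum_succ (x : ℕ → ℤ) (n : ℕ) :
    partialSum x (n + 1) = partialSum x n + x (n + 1) := by
  simp [partialSum, Finset.sum_Icc_succ_top]

lemma matchCount_succ (x : ℕ → ℤ) (n : ℕ) :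
    matchCount x (n + 1) = matchCount x n + if Matched x n then 1 else 0 := Nat.count_succ _ _

lemma matchCount_mono (x : ℕ → ℤ) : Monotone (matchCount x) := Nat.count_monotone _

lemma bridgeSign_sign (x : ℕ → ℤ) (k : ℕ) : bridgeSign x k = 1 ∨ bridgeSign x k = -1 := by
  unfold bridgeSign; split_ifs <;> simp

lemma flipSign_sign (x y : ℕ → ℤ) (k : ℕ) : flipSign x y k = 1 ∨ flipSign x y k = -1 := by
  unfold flipSign; rcases bridgeSign_sign x (k - 1) with h | h <;> split_ifs <;> simp [h]

lemma IsSign.not_matched {x : ℕ → ℤ} (hx : IsSign x) {i : ℕ} (h : ¬ Matched x i) :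
    x (2 * i + 2) = - x (2 * i + 1) := by
  unfold Matched at h
  have h1 := hx (2 * i + 1) (by omega)
  have h2 := hx (2 * i + 2) (by omega)
  omega

lemma IsSign.partialSum_even_succ {x : ℕ → ℤ} (hx : IsSign x) (i : ℕ) :
    partialSum x (2 * (i + 1)) = partialSum x (2 * i) +
      if Matched x i then 2 * x (2 * i + 1) else 0 := by
  have h : 2 * (i + 1) = 2 * i + 1 + 1 := by ring
  rw [h, partialSum_succ, partialSum_succ]
  split_ifs with hm
  · unfold Matched at hm; rw [show 2 * i + 1 + 1 = 2 * i + 2 by ring, ← hm]; ring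
  · rw [show 2 * i + 1 + 1 = 2 * i + 2 by ring, hx.not_matched hm]; ring

lemma IsSign.partialSum_eq_of_matchCount_eq {x : ℕ → ℤ} (hx : IsSign x) {a i : ℕ} (hai : a ≤ i)
    (h : matchCount x i = matchCount x a) : partialSum x (2 * i) = partialSum x (2 * a) := by
  induction i, hai using Nat.le_induction with
  | base => rfl
  | succ i hi ih =>
    have h1 := matchCount_succ x i
    have h2 := matchCount_mono x hi
    have h3 : ¬ Matched x i := by
      intro hm; rw [if_pos hm] at h1; omega
    rw [hx.partialSum_even_succ, if_neg h3, add_zero]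
    rw [if_neg h3] at h1
    exact ih (by omega)

/-- Unmatched pairs bring the walk back to its start, and at odd times it is at distance one. So
distance two is first reached at the end of the first matched pair. -/
lemma IsSign.sInf_exit {x : ℕ → ℤ} (hx : IsSign x) {a b : ℕ} (hab : a ≤ b) (hb : Matched x b)
    (h : matchCount x b = matchCount x a) :
    sInf {n : ℕ | 2 * a < n ∧ |partialSum x n - partialSum x (2 * a)| = 2} = 2 * b + 2 := by
  have hS : ∀ i, a ≤ i → i ≤ b → partialSum x (2 * i) = partialSum x (2 * a) := fun i h1 h2 =>
    hx.partialSum_eq_of_matchCount_eq h1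
      (le_antisymm (h ▸ matchCount_mono x h2) (matchCount_mono x h1))
  apply IsLeast.csInf_eq
  constructor
  · refine ⟨by omega, ?_⟩
    rw [show 2 * b + 2 = 2 * (b + 1) by ring, hx.partialSum_even_succ, if_pos hb, hS b hab le_rfl]
    rcases hx (2 * b + 1) (by omega) with h1 | h1 <;> rw [h1] <;> simp
  · rintro n ⟨h1, h2⟩
    by_contra! hn
    obtain ⟨i, rfl | rfl⟩ : ∃ i, n = 2 * i ∨ n = 2 * i + 1 := ⟨n / 2, by omega⟩
    · rw [hS i (by omega) (by omega)] at h2; simp at h2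
    · rw [partialSum_succ, hS i (by omega) (by omega)] at h2
      rcases hx (2 * i + 1) (by omega) with h3 | h3 <;> rw [h3] at h2 <;> simp at h2

/-- The half of the `k`-th stopping time. -/
noncomputable def halfStop (x : ℕ → ℤ) : ℕ → ℕ
  | 0 => 0
  | k + 1 => Nat.nth (Matched x) k + 1

lemma matchCount_halfStop {x : ℕ → ℤ} (hi : (Set.ofPred (Matched x)).Infinite) (k : ℕ) :
    matchCount x (halfStop x k) = k := by
  cases k with
  | zero => simp [halfStop, matchCount]
  | succ k =>
    rw [halfStop, matchCount_succ, if_pos (Nat.nth_mem_of_infinite hi k), matchCount,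
      Nat.count_nth_of_infinite hi]

lemma halfStop_le_nth {x : ℕ → ℤ} (hi : (Set.ofPred (Matched x)).Infinite) (k : ℕ) :
    halfStop x k ≤ Nat.nth (Matched x) k := by
  cases k with
  | zero => simp [halfStop]
  | succ k => exact Nat.nth_strictMono hi (Nat.lt_succ_self k)

/-- Infinitely many matched pairs are required because the infimum of an empty set of times is 0,
which would be a wrong stopping time. -/
lemma IsSign.stopTime_eq {x : ℕ → ℤ} (hx : IsSign x) (hi : (Set.ofPred (Matched x)).Infinite) (k : ℕ) :
    stopTime (partialSum x) k = 2 * halfStop x k := by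
  induction k with
  | zero => rfl
  | succ k ih =>
    rw [stopTime, ih, hx.sInf_exit (halfStop_le_nth hi k) (Nat.nth_mem_of_infinite hi k)]
    · simp [halfStop, mul_add]
    · rw [matchCount_halfStop hi, matchCount, Nat.count_nth_of_infinite hi]

/-- Step n belongs to the pair number (n-1)/2, and the Galois connection between `Nat.count` and
`Nat.nth` turns n ≤ T(k+1) into a bound on the number of earlier matched pairs. -/
lemma IsSign.bridgeIndex_eq {x : ℕ → ℤ} (hx : IsSign x) (hi : (Set.ofPred (Matched x)).Infinite)
    {n : ℕ} (hn : 1 ≤ n) :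
    bridgeIndex (stopTime (partialSum x)) n = matchCount x ((n - 1) / 2) := by
  have : {k : ℕ | n ≤ stopTime (partialSum x) (k + 1)} = Ici (matchCount x ((n - 1) / 2)) := by
    ext k
    rw [mem_ofPred_eq, hx.stopTime_eq hi, halfStop, mem_Ici, matchCount,
      Nat.count_le_iff_le_nth hi]
    omega
  rw [bridgeIndex, this, csInf_Ici]

lemma IsSign.bridge_increment {x : ℕ → ℤ} (hx : IsSign x) (hi : (Set.ofPred (Matched x)).Infinite)
    (k : ℕ) : partialSum x (stopTime (partialSum x) (k + 1)) -
      partialSum x (stopTime (partialSum x) k) = 2 * bridgeSign x k := by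
  rw [hx.stopTime_eq hi, hx.stopTime_eq hi]
  have h1 := hx.partialSum_eq_of_matchCount_eq (halfStop_le_nth hi k)
    (by rw [matchCount_halfStop hi, matchCount, Nat.count_nth_of_infinite hi])
  have h2 := Nat.nth_mem_of_infinite hi k
  rw [halfStop, hx.partialSum_even_succ, if_pos h2, h1, add_sub_cancel_left, bridgeSign]
  have h3 : (∃ i, Matched x i ∧ matchCount x i = k ∧ x (2 * i + 1) = 1) ↔
      x (2 * Nat.nth (Matched x) k + 1) = 1 := by
    constructor
    · rintro ⟨i, h4, h5, h6⟩
      rw [← h5, matchCount, Nat.nth_count h4, h6]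
    · exact fun h => ⟨_, h2, by rw [matchCount, Nat.count_nth_of_infinite hi], h⟩
  simp only [h3]
  rcases hx (2 * Nat.nth (Matched x) k + 1) (by omega) with h | h <;> simp [h]

/-- Keeping a bridge if its sign agrees with the coarse step, and flipping it otherwise, is
multiplication by the product of the two signs, which is `flipSign`. -/
lemma twist_eq_mergeSign {x y : ℕ → ℤ} (hx : IsSign x) (hi : (Set.ofPred (Matched x)).Infinite)
    (hy : IsSign y) {n : ℕ} (hn : 1 ≤ n) : twist x y n = mergeSign x (flipSign x y) n := by
  rw [twist]
  simp only [hx.bridgeIndex_eq hi hn, hx.bridge_increment hi, mergeSign, flipSign,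
    Nat.add_sub_cancel]
  rcases hy (matchCount x ((n - 1) / 2) + 1) (by omega) with h | h <;>
  rcases bridgeSign_sign x (matchCount x ((n - 1) / 2)) with h' | h' <;> simp [h, h']

lemma IsSign.mergeSign {x s : ℕ → ℤ} (hx : IsSign x) (hs : ∀ k, s k = 1 ∨ s k = -1) :
    IsSign (mergeSign x s) := by
  intro k hk
  unfold TwistShrink.mergeSign
  rcases hx k hk with h | h <;> rcases hs (matchCount x ((k - 1) / 2) + 1) with h' | h' <;>
    simp [h, h']

/-- Both steps of a pair lie in the same bridge and receive the same sign. -/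
lemma matched_mergeSign {x s : ℕ → ℤ} (hs : ∀ k, s k = 1 ∨ s k = -1) (i : ℕ) :
    Matched (mergeSign x s) i ↔ Matched x i := by
  unfold Matched mergeSign
  rw [show (2 * i + 1 - 1) / 2 = i by omega, show (2 * i + 2 - 1) / 2 = i by omega]
  rcases hs (matchCount x i + 1) with h | h <;> simp [h]

lemma matchCount_mergeSign {x s : ℕ → ℤ} (hs : ∀ k, s k = 1 ∨ s k = -1) (n : ℕ) :
    matchCount (mergeSign x s) n = matchCount x n := by
  induction n with
  | zero => simp [matchCount]
  | succ n ih => rw [matchCount_succ, matchCount_succ, ih]; simp only [matched_mergeSign hs]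

/-- The walk with steps `x`, observed at its even times, is twice the walk with steps `y`, run
along the matched pairs. -/
def Refines (x y : ℕ → ℤ) : Prop :=
  ∀ p, partialSum x (2 * p) = 2 * partialSum y (matchCount x p)

/-- A matched pair ends its bridge and carries the sign of it. After multiplication by `flipSign`
this sign becomes the coarse step, so the pair contributes twice that step. Written with counts of
pairs, this holds also when there are only finitely many matched pairs. -/
lemma refines_mergeSign {x y : ℕ → ℤ} (hx : IsSign x) (hy : IsSign y) :
    Refines (mergeSign x (flipSign x y)) y := by
  intro p
  have hs := flipSign_sign x y
  induction p with
  | zero => simp [matchCount]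
  | succ p ih =>
    rw [(hx.mergeSign hs).partialSum_even_succ, ih, matchCount_succ]
    split_ifs with h
    · rw [partialSum_succ, mul_add]
      congr 2
      rw [matchCount_mergeSign hs]
      rw [matched_mergeSign hs] at h
      rw [mergeSign, show (2 * p + 1 - 1) / 2 = p by omega]
      have hb : bridgeSign x (matchCount x p) = x (2 * p + 1) := by
        have h3 : (∃ i, Matched x i ∧ matchCount x i = matchCount x p ∧ x (2 * i + 1) = 1) ↔
            x (2 * p + 1) = 1 := by
          constructor
          · rintro ⟨i, h4, h5, h6⟩
            have : i = p := by
              rw [matchCount, matchCount] at h5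
              rw [← Nat.nth_count h4, h5, Nat.nth_count h]
            rwa [← this]
          · exact fun h' => ⟨p, h, rfl, h'⟩
        unfold bridgeSign
        simp only [h3]
        rcases hx (2 * p + 1) (by omega) with h | h <;> simp [h]
      rw [flipSign, Nat.add_sub_cancel, hb]
      rcases hx (2 * p + 1) (by omega) with h1 | h1 <;>
      rcases hy (matchCount x p + 1) (by omega) with h2 | h2 <;> simp [h1, h2]
    · simp

end TwistShrink

/-! ### Fair signs adapted to a filtration -/

namespace TwistShrink

variable {Ω : Type*}

/-- The σ-algebra generated by the steps `Y 1, …, Y n`. -/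
@[reducible] def past (Y : ℕ → Ω → ℤ) (n : ℕ) : MeasurableSpace Ω :=
  ⨆ k : Fin n, MeasurableSpace.comap (Y (k + 1)) ⊤

lemma measurable_past {Y : ℕ → Ω → ℤ} {n k : ℕ} (hk : k < n) : Measurable[past Y n] (Y (k + 1)) :=
  Measurable.of_comap_le (le_iSup (fun k : Fin n => MeasurableSpace.comap (Y (k + 1)) ⊤) ⟨k, hk⟩)

lemma past_le {Y : ℕ → Ω → ℤ} {n : ℕ} {m : MeasurableSpace Ω}
    (h : ∀ k, k < n → Measurable[m] (Y (k + 1))) : past Y n ≤ m :=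
  iSup_le fun k => (h k k.2).comap_le

lemma past_mono (Y : ℕ → Ω → ℤ) : Monotone (past Y) := fun _ _ h =>
  past_le fun _ hk => measurable_past (hk.trans_le h)

lemma past_zero (Y : ℕ → Ω → ℤ) : past Y 0 = ⊥ := by simp [past]

/-- A functional that depends on the steps number `1, …, n` only. -/
def DependsOnPast {β : Type*} (n : ℕ) (g : (ℕ → ℤ) → β) : Prop :=
  ∀ x y : ℕ → ℤ, (∀ k, 1 ≤ k → k ≤ n → x k = y k) → g x = g y

/-- The functional factors through the countable space of n-tuples of integers, on which every
function is measurable. -/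
lemma DependsOnPast.measurable {β : Type*} [MeasurableSpace β] {n : ℕ} {g : (ℕ → ℤ) → β}
    (hg : DependsOnPast n g) {m : MeasurableSpace Ω} {Y : ℕ → Ω → ℤ}
    (hY : ∀ k, k < n → Measurable[m] (Y (k + 1))) : Measurable[m] (fun ω => g (fun k => Y k ω)) := by
  have h : (fun ω => g (fun k => Y k ω)) =
      (fun v : Fin n → ℤ => g (fun k => if h : k - 1 < n then v ⟨k - 1, h⟩ else 0)) ∘
        (fun ω (k : Fin n) => Y (k + 1) ω) := by
    funext ω
    apply hg
    intro k h1 h2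
    rw [dif_pos (by omega)]
    simp only [Nat.sub_add_cancel h1]
  rw [h]
  refine (measurable_of_countable _).comp ?_
  exact measurable_pi_lambda _ fun k => hY k k.2

variable {mΩ : MeasurableSpace Ω} {P : Measure Ω}

/-- Associativity of independence: on the π-system of intersections b ∩ c, P(a ∩ b ∩ c) = P(a ∩
b)P(c) = P(a)P(b)P(c) = P(a)P(b ∩ c). -/
lemma indep_sup_right_of_indep_sup_left [IsProbabilityMeasure P] {A B C : MeasurableSpace Ω}
    (hA : A ≤ mΩ) (hB : B ≤ mΩ) (hC : C ≤ mΩ) (h1 : Indep A B P) (h2 : Indep (A ⊔ B) C P) :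
    Indep A (B ⊔ C) P := by
  have hgen : B ⊔ C = MeasurableSpace.generateFrom
      {s | ∃ b c, MeasurableSet[B] b ∧ MeasurableSet[C] c ∧ b ∩ c = s} := by
    apply le_antisymm
    · refine sup_le (fun b hb => ?_) (fun c hc => ?_)
      · exact MeasurableSpace.measurableSet_generateFrom ⟨b, univ, hb, MeasurableSet.univ, by simp⟩
      · exact MeasurableSpace.measurableSet_generateFrom ⟨univ, c, MeasurableSet.univ, hc, by simp⟩
    · refine MeasurableSpace.generateFrom_le ?_
      rintro _ ⟨b, c, hb, hc, rfl⟩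
      exact MeasurableSet.inter (le_sup_left (a := B) _ hb) (le_sup_right (a := B) _ hc)
  refine IndepSets.indep hA (sup_le hB hC) (@MeasurableSpace.isPiSystem_measurableSet Ω A) ?_
    (@MeasurableSpace.generateFrom_measurableSet Ω A).symm hgen ?_
  · rintro _ ⟨b, c, hb, hc, rfl⟩ _ ⟨b', c', hb', hc', rfl⟩ -
    exact ⟨b ∩ b', c ∩ c', hb.inter hb', hc.inter hc', by
      rw [Set.inter_inter_inter_comm]⟩
  · rw [IndepSets_iff]
    rintro a _ ha ⟨b, c, hb, hc, rfl⟩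
    have hab : MeasurableSet[A ⊔ B] (a ∩ b) :=
      MeasurableSet.inter (le_sup_left (a := A) _ ha) (le_sup_right (a := A) _ hb)
    rw [← Set.inter_assoc, (Indep_iff _ _ _).1 h2 _ _ hab hc, (Indep_iff _ _ _).1 h1 _ _ ha hb,
      (Indep_iff _ _ _).1 h2 _ _ (le_sup_right (a := A) _ hb) hc, mul_assoc]

/-- The steps `Y 1, Y 2, …` are adapted to the filtration `F`, and each `Y (n + 1)` is a fair sign
independent of `F n`. -/
structure FairSigns (P : Measure Ω) (F : ℕ → MeasurableSpace Ω) (Y : ℕ → Ω → ℤ) : Prop where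
  le : ∀ n, F n ≤ mΩ
  mono : Monotone F
  adapted : ∀ n, Measurable[F (n + 1)] (Y (n + 1))
  indep : ∀ n, Indep (F n) (MeasurableSpace.comap (Y (n + 1)) ⊤) P
  prob_one : ∀ n, P {ω | Y (n + 1) ω = 1} = 1 / 2
  prob_neg_one : ∀ n, P {ω | Y (n + 1) ω = -1} = 1 / 2

namespace FairSigns

variable {F : ℕ → MeasurableSpace Ω} {Y : ℕ → Ω → ℤ}

lemma measurable_of_lt (h : FairSigns P F Y) {k n : ℕ} (hk : k < n) :
    Measurable[F n] (Y (k + 1)) := (h.adapted k).mono (h.mono hk) le_rfl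

lemma measurable (h : FairSigns P F Y) (k : ℕ) : Measurable (Y (k + 1)) :=
  (h.adapted k).mono (h.le _) le_rfl

lemma measurable_functional (h : FairSigns P F Y) {β : Type*} [MeasurableSpace β] {n : ℕ}
    {g : (ℕ → ℤ) → β} (hg : DependsOnPast n g) : Measurable[F n] (fun ω => g (fun k => Y k ω)) :=
  hg.measurable fun _ hk => h.measurable_of_lt hk

lemma of_le (h : FairSigns P F Y) {F' : ℕ → MeasurableSpace Ω} (hle : ∀ n, F' n ≤ F n)
    (hmono : Monotone F') (hF' : ∀ n, Measurable[F' (n + 1)] (Y (n + 1))) : FairSigns P F' Y where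
  le n := (hle n).trans (h.le n)
  mono := hmono
  adapted := hF'
  indep n := indep_of_indep_of_le_left (h.indep n) (hle n)
  prob_one := h.prob_one
  prob_neg_one := h.prob_neg_one

lemma ae_sign [IsProbabilityMeasure P] (h : FairSigns P F Y) (n : ℕ) :
    ∀ᵐ ω ∂P, Y (n + 1) ω = 1 ∨ Y (n + 1) ω = -1 := by
  have h1 : MeasurableSet {ω | Y (n + 1) ω = 1} := h.measurable n (measurableSet_singleton 1)
  have h2 : MeasurableSet {ω | Y (n + 1) ω = -1} := h.measurable n (measurableSet_singleton (-1))
  have hd : Disjoint {ω | Y (n + 1) ω = 1} {ω | Y (n + 1) ω = -1} := by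
    rw [Set.disjoint_left]; intro ω h h'; simp only [mem_ofPred_eq] at h h'; omega
  have h3 : P ({ω | Y (n + 1) ω = 1} ∪ {ω | Y (n + 1) ω = -1}) = 1 := by
    rw [measure_union hd h2, h.prob_one, h.prob_neg_one, ENNReal.add_halves]
  exact (mem_ae_iff_prob_eq_one (h1.union h2)).2 h3

lemma ae_isSign [IsProbabilityMeasure P] (h : FairSigns P F Y) :
    ∀ᵐ ω ∂P, IsSign (fun k => Y k ω) := by
  filter_upwards [ae_all_iff.2 h.ae_sign] with ω hω k hk
  obtain ⟨n, rfl⟩ : ∃ n, k = n + 1 := ⟨k - 1, by omega⟩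
  exact hω n

/-- Conditioning on the next sign. -/
lemma lintegral_eq [IsProbabilityMeasure P] (h : FairSigns P F Y) (n : ℕ) {f : Ω → ℤ → ℝ≥0∞}
    (h1 : Measurable[F n] (fun ω => f ω 1)) (h2 : Measurable[F n] (fun ω => f ω (-1))) :
    ∫⁻ ω, f ω (Y (n + 1) ω) ∂P = ∫⁻ ω, (f ω 1 + f ω (-1)) / 2 ∂P := by
  have hm : MeasurableSpace.comap (Y (n + 1)) ⊤ ≤ mΩ := (h.measurable n).comap_le
  have key : ∀ (a : ℤ) (g : Ω → ℝ≥0∞), Measurable[F n] g → P {ω | Y (n + 1) ω = a} = 1 / 2 →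
      ∫⁻ ω, g ω * {ω | Y (n + 1) ω = a}.indicator (fun _ => 1) ω ∂P = ∫⁻ ω, g ω / 2 ∂P := by
    intro a g hg ha
    have hs : MeasurableSet[MeasurableSpace.comap (Y (n + 1)) ⊤] {ω | Y (n + 1) ω = a} :=
      ⟨{a}, trivial, rfl⟩
    rw [lintegral_mul_eq_lintegral_mul_lintegral_of_independent_measurableSpace (h.le n) hm
      (h.indep n) hg (measurable_const.indicator hs), lintegral_indicator_const (hm _ hs), ha,
      one_mul]
    simp_rw [div_eq_mul_inv]
    rw [lintegral_mul_const _ (hg.mono (h.le n) le_rfl), one_mul]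
  have hm1 := h1.mono (h.le n) le_rfl
  have hm2 := h2.mono (h.le n) le_rfl
  have e : ∫⁻ ω, f ω (Y (n + 1) ω) ∂P =
      ∫⁻ ω, (f ω 1 * {ω | Y (n + 1) ω = 1}.indicator (fun _ => 1) ω +
        f ω (-1) * {ω | Y (n + 1) ω = -1}.indicator (fun _ => 1) ω) ∂P := by
    apply lintegral_congr_ae
    filter_upwards [h.ae_sign n] with ω hω
    rcases hω with hω | hω <;> simp [hω, Set.indicator]
  rw [e, lintegral_add_left, key _ _ h1 (h.prob_one n), key _ _ h2 (h.prob_neg_one n),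
    ← lintegral_add_left (hm1.div_const 2)]
  · simp_rw [ENNReal.add_div]
  · exact hm1.mul (measurable_const.indicator (h.measurable n (measurableSet_singleton 1)))

/-- Predictable changes of sign preserve fair signs. -/
lemma mul [IsProbabilityMeasure P] (h : FairSigns P F Y) {s : ℕ → Ω → ℤ}
    (hs : ∀ n, Measurable[F n] (s n)) (hsign : ∀ n ω, s n ω = 1 ∨ s n ω = -1) {Z : ℕ → Ω → ℤ}
    (had : ∀ n, Measurable[F (n + 1)] (Z (n + 1)))
    (hZ : ∀ n, ∀ᵐ ω ∂P, Z (n + 1) ω = s n ω * Y (n + 1) ω) : FairSigns P F Z := by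
  have key : ∀ n (E : Set Ω), MeasurableSet[F n] E → ∀ B : Set ℤ,
      P (E ∩ Z (n + 1) ⁻¹' B) = P E * P (Y (n + 1) ⁻¹' B) := by
    intro n E hE B
    have hB : ∀ a : ℤ, Measurable[F n] (fun _ : Ω => B.indicator (fun _ => (1 : ℝ≥0∞)) a) :=
      fun a => measurable_const
    have hY : P (Y (n + 1) ⁻¹' B) =
        (B.indicator (fun _ => 1) 1 + B.indicator (fun _ => 1) (-1)) / 2 := by
      have := h.lintegral_eq n (f := fun _ a => B.indicator (fun _ => 1) a) (hB 1) (hB (-1))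
      rw [lintegral_const, measure_univ, mul_one] at this
      rw [← this, ← lintegral_indicator_one (h.measurable n (MeasurableSet.of_discrete (s := B)))]
      rfl
    have hEm : Measurable[F n] (E.indicator (fun _ => (1 : ℝ≥0∞))) := measurable_const.indicator hE
    have hsB : ∀ a : ℤ,
        Measurable[F n] (fun ω => B.indicator (fun _ => (1 : ℝ≥0∞)) (s n ω * a)) := fun a =>
      (measurable_of_countable fun b : ℤ => B.indicator (fun _ => (1 : ℝ≥0∞)) (b * a)).comp (hs n)
    have hE' := h.le n _ hE
    have hZm : MeasurableSet (Z (n + 1) ⁻¹' B) :=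
      ((had n).mono (h.le _) le_rfl) (MeasurableSet.of_discrete (s := B))
    have := h.lintegral_eq n
      (f := fun ω a => E.indicator (fun _ => 1) ω * B.indicator (fun _ => 1) (s n ω * a))
      (hEm.mul (hsB 1)) (hEm.mul (hsB (-1)))
    rw [hY, ← lintegral_indicator_one (hE'.inter hZm)]
    calc ∫⁻ ω, (E ∩ Z (n + 1) ⁻¹' B).indicator 1 ω ∂P
        = ∫⁻ ω, E.indicator (fun _ => 1) ω *
            B.indicator (fun _ => 1) (s n ω * Y (n + 1) ω) ∂P := by
          refine lintegral_congr_ae ?_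
          filter_upwards [hZ n] with ω hω
          rw [← hω, Set.inter_indicator_one]
          rfl
      _ = ∫⁻ ω, E.indicator (fun _ => 1) ω *
            ((B.indicator (fun _ => 1) 1 + B.indicator (fun _ => 1) (-1)) / 2) ∂P := by
          rw [this]
          refine lintegral_congr fun ω => ?_
          rw [← mul_add, mul_div_assoc]
          -- A sign known beforehand at most exchanges the two equally likely values of the next
          -- step.
          rcases hsign n ω with h' | h' <;> simp [h', add_comm]
      _ = _ := by
          rw [lintegral_mul_const _ (measurable_const.indicator hE'),
            lintegral_indicator_const hE', one_mul]
  have keyu : ∀ n (B : Set ℤ), P (Z (n + 1) ⁻¹' B) = P (Y (n + 1) ⁻¹' B) := fun n B => by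
    have := key n univ MeasurableSet.univ B
    rwa [univ_inter, measure_univ, one_mul] at this
  refine ⟨h.le, h.mono, had, fun n => ?_, fun n => ?_, fun n => ?_⟩
  · rw [Indep_iff]
    rintro E _ hE ⟨B, -, rfl⟩
    rw [key n E hE, keyu]
  · exact (keyu n {1}).trans (h.prob_one n)
  · exact (keyu n {-1}).trans (h.prob_neg_one n)

/-- The signs are jointly independent of the initial σ-algebra. -/
lemma indep_zero [IsProbabilityMeasure P] (h : FairSigns P F Y) :
    Indep (F 0) (⨆ n, past Y n) P := by
  refine (indep_iSup_of_monotone (fun n => ?_)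
    (fun n => (past_le fun k _ => h.measurable k)) (h.le 0) (past_mono Y)).symm
  refine Indep.symm ?_
  induction n with
  | zero => rw [past_zero]; exact indep_bot_right _
  | succ n ih =>
    have h1 : past Y (n + 1) ≤ past Y n ⊔ MeasurableSpace.comap (Y (n + 1)) ⊤ := by
      refine past_le fun k hk => Measurable.of_comap_le ?_
      rcases Nat.lt_succ_iff_lt_or_eq.1 hk with hk | rfl
      · exact le_sup_of_le_left (measurable_past hk).comap_le
      · exact le_sup_right
    -- The next sign is independent of the initial σ-algebra and the earlier signs together;
    -- reassociating adds it to the block of signs.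
    have h2 : F 0 ⊔ past Y n ≤ F n :=
      sup_le (h.mono (Nat.zero_le n)) (past_le fun k hk => h.measurable_of_lt hk)
    exact indep_of_indep_of_le_right
      (indep_sup_right_of_indep_sup_left (h.le 0) (past_le fun k _ => h.measurable k)
        (h.measurable n).comap_le ih (indep_of_indep_of_le_left (h.indep n) h2)) h1

/-- An independent σ-algebra may be added to the filtration. -/
lemma sup_right [IsProbabilityMeasure P] (h : FairSigns P F Y) {G H : MeasurableSpace Ω}
    (hH : H ≤ mΩ) (hFG : ∀ n, F n ≤ G) (hGH : Indep G H P) :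
    FairSigns P (fun n => F n ⊔ H) Y where
  le n := sup_le (h.le n) hH
  mono _ _ hab := sup_le_sup_right (h.mono hab) H
  adapted n := (h.adapted n).mono le_sup_left le_rfl
  indep n := by
    rw [sup_comm]
    have h1 : MeasurableSpace.comap (Y (n + 1)) ⊤ ⊔ F n ≤ G :=
      sup_le ((h.adapted n).comap_le.trans (hFG _)) (hFG n)
    rw [sup_comm]
    exact (indep_sup_right_of_indep_sup_left (h.measurable n).comap_le (h.le n) hH
      (h.indep n).symm (indep_of_indep_of_le_left hGH h1)).symm
  prob_one := h.prob_one
  prob_neg_one := h.prob_neg_one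

end FairSigns

end TwistShrink

/-! ### The twisted steps are fair signs -/

namespace TwistShrink

/-- The steps of the twisted walks, by the description that is valid almost surely. -/
noncomputable def signedStep (X : ℕ → ℕ → ℤ) : ℕ → ℕ → ℤ
  | 0 => X 0
  | m + 1 => mergeSign (X (m + 1)) (flipSign (X (m + 1)) (signedStep X m))

lemma dependsOnPast_matchCount {n p : ℕ} (h : 2 * p ≤ n) :
    DependsOnPast n (fun x => matchCount x p) := by
  intro x y hxy
  induction p with
  | zero => simp [matchCount]
  | succ p ih =>
    simp only at ih ⊢
    have hM : Matched x p ↔ Matched y p := by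
      simp only [Matched, hxy (2 * p + 1) (by omega) (by omega),
        hxy (2 * p + 2) (by omega) (by omega)]
    rw [matchCount_succ, matchCount_succ, ih (by omega)]
    by_cases h' : Matched y p <;> simp [hM, h']

variable {Ω : Type*}

/-- The sign of a bridge depends on no fixed number of steps, since the bridge may end arbitrarily
late; it is read off a countable union over the position of its last pair. -/
lemma measurable_bridgeSign {m : MeasurableSpace Ω} {Y : ℕ → Ω → ℤ}
    (hY : ∀ k, Measurable[m] (Y (k + 1))) (j : ℕ) :
    Measurable[m] (fun ω => bridgeSign (fun k => Y k ω) j) := by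
  unfold bridgeSign
  refine Measurable.ite ?_ measurable_const measurable_const
  have : {ω | ∃ i, Matched (fun k => Y k ω) i ∧ matchCount (fun k => Y k ω) i = j ∧
      Y (2 * i + 1) ω = 1} = ⋃ i, {ω | Matched (fun k => Y k ω) i ∧
        matchCount (fun k => Y k ω) i = j ∧ Y (2 * i + 1) ω = 1} := by
    ext; simp
  rw [this]
  refine MeasurableSet.iUnion fun i => ?_
  have hd : DependsOnPast (2 * i + 2) (fun x : ℕ → ℤ => Matched x i ∧
      matchCount x i = j ∧ x (2 * i + 1) = 1) := by
    intro x y hxy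
    have := dependsOnPast_matchCount (n := 2 * i + 2) (p := i) (by omega) x y hxy
    simp only at this
    simp only [this, Matched, hxy (2 * i + 1) (by omega) (by omega),
      hxy (2 * i + 2) (by omega) (by omega)]
  exact measurableSet_setOfPred.2 (hd.measurable fun k _ => hY k)

lemma measurable_flipSign {m : MeasurableSpace Ω} {Y Z : ℕ → Ω → ℤ}
    (hY : ∀ k, Measurable[m] (Y (k + 1))) (k : ℕ) (hZ : Measurable[m] (Z (k + 1))) :
    Measurable[m] (fun ω => flipSign (fun k => Y k ω) (fun k => Z k ω) (k + 1)) := by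
  have h := measurable_bridgeSign hY k
  exact Measurable.ite (hZ (measurableSet_singleton 1)) h h.neg

lemma measurable_apply_index {m : MeasurableSpace Ω} {Z : ℕ → Ω → ℤ} {c : Ω → ℕ}
    (hc : Measurable[m] c) (hZ : ∀ k, Measurable[m] (Z (k + 1))) :
    Measurable[m] (fun ω => Z (c ω + 1) ω) := by
  refine measurable_to_countable' fun a => ?_
  have : (fun ω => Z (c ω + 1) ω) ⁻¹' {a} = ⋃ k, (c ⁻¹' {k} ∩ Z (k + 1) ⁻¹' {a}) := by
    ext ω; simp
  rw [this]
  exact MeasurableSet.iUnion fun k => (hc (measurableSet_singleton k)).inter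
    (hZ k (measurableSet_singleton a))

variable {mΩ : MeasurableSpace Ω} {P : Measure Ω} {X : ℕ → ℕ → Ω → ℤ}

/-- The σ-algebra of all steps at the levels above `m`. -/
@[reducible] def future (X : ℕ → ℕ → Ω → ℤ) (m : ℕ) : MeasurableSpace Ω :=
  ⨆ p : ℕ × ℕ, ⨆ _ : p ∈ {p : ℕ × ℕ | m < p.1}, MeasurableSpace.comap (X p.1 (p.2 + 1)) ⊤

lemma measurable_future {m i : ℕ} (hi : m < i) (k : ℕ) :
    Measurable[future X m] (X i (k + 1)) :=
  Measurable.of_comap_le (le_iSup₂ (f := fun (p : ℕ × ℕ) (_ : p ∈ {p : ℕ × ℕ | m < p.1}) =>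
    MeasurableSpace.comap (X p.1 (p.2 + 1)) ⊤) (i, k) hi)

lemma future_le {m : ℕ} {m' : MeasurableSpace Ω}
    (h : ∀ i k, m < i → Measurable[m'] (X i (k + 1))) : future X m ≤ m' :=
  iSup₂_le fun p hp => (h p.1 p.2 hp).comap_le

/-- All higher levels are put into the filtration from the start, so that quantities computed from
them count as predictable. -/
lemma fairSigns_coins (hmeas : ∀ m k, 1 ≤ k → Measurable (X m k))
    (hprob : ∀ m k, 1 ≤ k → P {ω | X m k ω = 1} = 1 / 2 ∧ P {ω | X m k ω = -1} = 1 / 2)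
    (hind : iIndepFun (fun (p : ℕ × ℕ) => X p.1 (p.2 + 1)) P) (m : ℕ) :
    FairSigns P (fun n => past (X m) n ⊔ future X m) (X m) where
  le n := sup_le (past_le fun k _ => hmeas m _ (by omega))
    (future_le fun i k _ => hmeas i _ (by omega))
  mono a b hab := sup_le_sup_right (past_mono _ hab) _
  adapted n := (measurable_past (Nat.lt_succ_self n)).mono le_sup_left le_rfl
  indep n := by
    have h1 : ∀ p : ℕ × ℕ, MeasurableSpace.comap (X p.1 (p.2 + 1)) ⊤ ≤ mΩ := fun p =>
      (hmeas p.1 (p.2 + 1) (by omega)).comap_le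
    have h2 := indep_iSup_of_disjoint h1 hind.iIndep
      (S := {p : ℕ × ℕ | (p.1 = m ∧ p.2 < n) ∨ m < p.1}) (T := {(m, n)}) (by
        rw [Set.disjoint_singleton_right]; simp)
    have h3 : ∀ q ∈ {p : ℕ × ℕ | (p.1 = m ∧ p.2 < n) ∨ m < p.1},
        Measurable[⨆ p ∈ {p : ℕ × ℕ | (p.1 = m ∧ p.2 < n) ∨ m < p.1},
          MeasurableSpace.comap (X p.1 (p.2 + 1)) ⊤] (X q.1 (q.2 + 1)) := fun q hq =>
      Measurable.of_comap_le (le_iSup₂ (f := fun (p : ℕ × ℕ)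
        (_ : p ∈ {p : ℕ × ℕ | (p.1 = m ∧ p.2 < n) ∨ m < p.1}) =>
          MeasurableSpace.comap (X p.1 (p.2 + 1)) ⊤) q hq)
    refine indep_of_indep_of_le h2 (sup_le (past_le fun k hk => ?_) (future_le fun i k hi => ?_)) ?_
    · exact h3 (m, k) (Or.inl ⟨rfl, hk⟩)
    · exact h3 (i, k) (Or.inr hi)
    · simp
  prob_one n := (hprob m (n + 1) (by omega)).1
  prob_neg_one n := (hprob m (n + 1) (by omega)).2

/-- The twisted steps are fair signs, independent of the levels above. -/
lemma fairSigns_signedStep [IsProbabilityMeasure P] (hmeas : ∀ m k, 1 ≤ k → Measurable (X m k))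
    (hprob : ∀ m k, 1 ≤ k → P {ω | X m k ω = 1} = 1 / 2 ∧ P {ω | X m k ω = -1} = 1 / 2)
    (hind : iIndepFun (fun (p : ℕ × ℕ) => X p.1 (p.2 + 1)) P) (m : ℕ) :
    FairSigns P
      (fun n => past (fun k ω => signedStep (fun i k => X i k ω) m k) n ⊔ future X m)
      (fun k ω => signedStep (fun i k => X i k ω) m k) := by
  induction m with
  | zero => exact fairSigns_coins hmeas hprob hind 0
  | succ m ih =>
    set Y : ℕ → Ω → ℤ := fun k ω => signedStep (fun i k => X i k ω) m k with hY
    have hξ := fairSigns_coins hmeas hprob hind (m + 1)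
    set Z : ℕ → Ω → ℤ := fun k ω => flipSign (fun k => X (m + 1) k ω) (fun k => Y k ω) k with hZ
    have hsign : ∀ k ω, Z k ω = 1 ∨ Z k ω = -1 := fun k ω => flipSign_sign _ _ k
    have hX : ∀ k, Measurable[future X m] (X (m + 1) (k + 1)) := measurable_future m.lt_succ_self
    -- The coins of level m+1, hence all their bridge signs, are known at time zero; multiplying the
    -- level m steps by them is a predictable change of sign.
    have hflip : FairSigns P (fun n => past Y n ⊔ future X m) Z := by
      refine ih.mul (s := fun n ω => bridgeSign (fun k => X (m + 1) k ω) n) (fun n => ?_)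
        (fun n ω => bridgeSign_sign _ n) (fun n => ?_) fun n => ?_
      · exact (measurable_bridgeSign hX n).mono le_sup_right le_rfl
      · exact measurable_flipSign (m := past Y (n + 1) ⊔ future X m) (Z := Y) (fun k => (hX k).mono le_sup_right le_rfl) n (ih.adapted n)
      · filter_upwards [ih.ae_sign n] with ω hω
        change flipSign (fun k => X (m + 1) k ω) (fun k => Y k ω) (n + 1) = _
        rcases hω with hω | hω <;> simp only [flipSign, Nat.add_sub_cancel, hω] <;> simp
    have hH : (⨆ n, past Z n) ≤ mΩ := iSup_le fun n => past_le fun k _ => hflip.measurable k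
    -- Although `Z` is built from the coins of level m+1, as a sequence it is independent of them.
    -- It may therefore be adjoined to their filtration in full.
    have hind' : Indep (future X m) (⨆ n, past Z n) P :=
      indep_of_indep_of_le_left hflip.indep_zero le_sup_right
    have hξ' := hξ.sup_right hH (fun n => sup_le (past_le fun k _ => hX k)
      (future_le fun i k hi => measurable_future (m.lt_succ_self.trans hi) k)) hind'
    have hZm : ∀ {n} k, Measurable[(past (X (m + 1)) n ⊔ future X (m + 1)) ⊔ ⨆ n, past Z n]
        (Z (k + 1)) := fun k =>
      (measurable_past (Nat.lt_succ_self k)).mono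
        (le_sup_of_le_right (le_iSup (past Z) (k + 1))) le_rfl
    -- Step n+1 lies in the pair number n/2. The matched pairs before it are determined by the first
    -- n coins, so its multiplier is predictable.
    have hs : ∀ n, Measurable[(past (X (m + 1)) n ⊔ future X (m + 1)) ⊔ ⨆ n, past Z n]
        (fun ω => Z (matchCount (fun k => X (m + 1) k ω) (n / 2) + 1) ω) := by
      intro n
      exact measurable_apply_index (hξ'.measurable_functional
        (dependsOnPast_matchCount (n := n) (p := n / 2) (by omega))) hZm
    have hW : ∀ n ω, signedStep (fun i k => X i k ω) (m + 1) (n + 1) =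
        Z (matchCount (fun k => X (m + 1) k ω) (n / 2) + 1) ω * X (m + 1) (n + 1) ω :=
      fun n ω => mul_comm _ _
    have hW' : ∀ n, Measurable[(past (X (m + 1)) (n + 1) ⊔ future X (m + 1)) ⊔ ⨆ n, past Z n]
        (fun ω => signedStep (fun i k => X i k ω) (m + 1) (n + 1)) := by
      intro n
      simp only [hW]
      exact ((hs n).mono (hξ'.mono n.le_succ) le_rfl).mul (hξ'.adapted n)
    have hfin := hξ'.mul (Z := fun k ω => signedStep (fun i k => X i k ω) (m + 1) k) hs
      (fun n ω => hsign _ ω) hW' fun n => Eventually.of_forall fun ω => hW n ω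
    refine hfin.of_le (fun n => sup_le (past_le fun k hk => hfin.measurable_of_lt hk)
      (le_sup_of_le_left le_sup_right)) (fun a b hab => sup_le_sup_right (past_mono _ hab) _)
      fun n => (measurable_past (Y := fun k ω => signedStep (fun i k => X i k ω) (m + 1) k)
        (Nat.lt_succ_self n)).mono le_sup_left le_rfl

end TwistShrink

/-! ### Exponential bounds for predictable sums of signs -/

namespace TwistShrink

/-- The sum of the first `b` steps, weighted with the coefficients `e x i`. -/
def signedSum (e : (ℕ → ℤ) → ℕ → ℤ) (x : ℕ → ℤ) (b : ℕ) : ℤ :=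
  ∑ i ∈ Finset.range b, e x i * x (i + 1)

/-- The quadratic variation of `signedSum`. -/
def quadVar (e : (ℕ → ℤ) → ℕ → ℤ) (x : ℕ → ℤ) (b : ℕ) : ℤ := ∑ i ∈ Finset.range b, e x i ^ 2

/-- Predictable coefficients in `{-1, 0, 1}`. -/
structure IsPredictable (e : (ℕ → ℤ) → ℕ → ℤ) : Prop where
  depends : ∀ i, DependsOnPast i (fun x => e x i)
  bound : ∀ x i, |e x i| ≤ 1

lemma dependsOnPast_partialSum {k n : ℕ} (h : k ≤ n) :
    DependsOnPast n (fun x => partialSum x k) := fun x y hxy =>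
  Finset.sum_congr rfl fun i hi => by
    rw [Finset.mem_Icc] at hi; exact hxy i hi.1 (hi.2.trans h)

lemma IsPredictable.depends_signedSum {e : (ℕ → ℤ) → ℕ → ℤ} (he : IsPredictable e) (b : ℕ) :
    DependsOnPast b (fun x => signedSum e x b) := fun x y hxy =>
  Finset.sum_congr rfl fun i hi => by
    rw [Finset.mem_range] at hi
    rw [hxy (i + 1) (by omega) (by omega)]
    congr 1
    exact he.depends i x y fun k h1 h2 => hxy k h1 (by omega)

lemma IsPredictable.depends_quadVar {e : (ℕ → ℤ) → ℕ → ℤ} (he : IsPredictable e) (b : ℕ) :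
    DependsOnPast b (fun x => quadVar e x b) := fun x y hxy =>
  Finset.sum_congr rfl fun i hi => by
    rw [Finset.mem_range] at hi
    congr 1
    exact he.depends i x y fun k h1 h2 => hxy k h1 (by omega)

lemma quadVar_nonneg (e : (ℕ → ℤ) → ℕ → ℤ) (x : ℕ → ℤ) (b : ℕ) : 0 ≤ quadVar e x b :=
  Finset.sum_nonneg fun _ _ => sq_nonneg _

lemma IsPredictable.quadVar_le {e : (ℕ → ℤ) → ℕ → ℤ} (he : IsPredictable e) (x : ℕ → ℤ) (b : ℕ) :
    quadVar e x b ≤ b := by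
  calc quadVar e x b ≤ ∑ i ∈ Finset.range b, (1 : ℤ) := Finset.sum_le_sum fun i _ => by
        have := he.bound x i
        rw [← sq_abs]
        nlinarith [abs_nonneg (e x i)]
    _ = b := by simp

lemma signedSum_eq_zero {e : (ℕ → ℤ) → ℕ → ℤ} {x : ℕ → ℤ} {b : ℕ} (h : quadVar e x b = 0) :
    signedSum e x b = 0 := by
  rw [quadVar, Finset.sum_eq_zero_iff_of_nonneg fun i _ => sq_nonneg _] at h
  exact Finset.sum_eq_zero fun i hi => by rw [pow_eq_zero_iff (by norm_num) |>.1 (h i hi), zero_mul]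

variable {Ω : Type*} {mΩ : MeasurableSpace Ω} {P : Measure Ω} {F : ℕ → MeasurableSpace Ω}
  {Y : ℕ → Ω → ℤ}

/-- The exponential supermartingale of a weighted sum of fair signs. -/
lemma FairSigns.lintegral_exp_le [IsProbabilityMeasure P] (h : FairSigns P F Y)
    {e : (ℕ → ℤ) → ℕ → ℤ} (he : IsPredictable e) (l : ℝ) (b : ℕ) :
    ∫⁻ ω, ENNReal.ofReal (Real.exp (l * signedSum e (fun k => Y k ω) b -
      l ^ 2 / 2 * quadVar e (fun k => Y k ω) b)) ∂P ≤ 1 := by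
  induction b with
  | zero => simp [signedSum, quadVar]
  | succ b ih =>
    refine le_trans ?_ ih
    set g : ℤ → ℤ → ℤ → ℤ → ℝ≥0∞ := fun M V c a => ENNReal.ofReal (Real.exp (l * (M + c * a : ℤ) -
      l ^ 2 / 2 * (V + c ^ 2 : ℤ))) with hg
    have hd : ∀ a, DependsOnPast b (fun x => g (signedSum e x b) (quadVar e x b) (e x b) a) := by
      intro a x y hxy
      have h1 := he.depends_signedSum b x y hxy
      have h2 := he.depends_quadVar b x y hxy
      have h3 := he.depends b x y hxy
      simp only at h1 h2 h3 ⊢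
      rw [h1, h2, h3]
    have := h.lintegral_eq b (f := fun ω a => g (signedSum e (fun k => Y k ω) b)
      (quadVar e (fun k => Y k ω) b) (e (fun k => Y k ω) b) a)
      (h.measurable_functional (hd 1)) (h.measurable_functional (hd (-1)))
    simp only [signedSum, quadVar, Finset.sum_range_succ] at this ⊢
    rw [this]
    refine lintegral_mono fun ω => ?_
    generalize (∑ i ∈ Finset.range b, e (fun k => Y k ω) i * Y (i + 1) ω) = M
    generalize (∑ i ∈ Finset.range b, e (fun k => Y k ω) i ^ 2) = V
    generalize e (fun k => Y k ω) b = c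
    simp only [hg]
    rw [← ENNReal.ofReal_add (by positivity) (by positivity),
      show (2 : ℝ≥0∞) = ENNReal.ofReal 2 by simp, ← ENNReal.ofReal_div_of_pos (by norm_num)]
    apply ENNReal.ofReal_le_ofReal
    -- Averaging over the next sign gives a hyperbolic cosine, which the added quadratic variation
    -- compensates.
    have h1 := Real.cosh_le_exp_half_sq (l * c)
    rw [Real.cosh_eq] at h1
    have h2 : ∀ a : ℝ, Real.exp (l * (M + c * a) - l ^ 2 / 2 * (V + c ^ 2)) =
        Real.exp (l * M - l ^ 2 / 2 * V) * Real.exp (-((l * c) ^ 2 / 2)) * Real.exp (l * c * a) := by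
      intro a; rw [← Real.exp_add, ← Real.exp_add]; congr 1; ring
    push_cast
    rw [h2, h2, mul_one, mul_neg_one, ← mul_add, mul_div_assoc]
    calc Real.exp (l * M - l ^ 2 / 2 * V) * Real.exp (-((l * c) ^ 2 / 2)) *
          ((Real.exp (l * c) + Real.exp (-(l * c))) / 2)
        ≤ Real.exp (l * M - l ^ 2 / 2 * V) * Real.exp (-((l * c) ^ 2 / 2)) *
          Real.exp ((l * c) ^ 2 / 2) := by gcongr
      _ = _ := by rw [mul_assoc, ← Real.exp_add]; simp

/-- Markov's inequality for the exponential supermartingale with the optimal parameter ±r/v, where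
r² = 2Λv: on the event the exponent is at least 2Λ - Λ for one of the two signs. -/
lemma FairSigns.prob_signedSum_le [IsProbabilityMeasure P] (h : FairSigns P F Y)
    {e : (ℕ → ℤ) → ℕ → ℤ} (he : IsPredictable e) {v Λ : ℝ} (hv : 0 < v) (hΛ : 0 ≤ Λ) (b : ℕ) :
    P {ω | 2 * Λ * v < (signedSum e (fun k => Y k ω) b : ℝ) ^ 2 ∧
      (quadVar e (fun k => Y k ω) b : ℝ) ≤ v} ≤ ENNReal.ofReal (2 * Real.exp (-Λ)) := by
  set r := √(2 * Λ * v) with hr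
  have hr2 : r ^ 2 = 2 * Λ * v := Real.sq_sqrt (by positivity)
  have hr0 : 0 ≤ r := Real.sqrt_nonneg _
  set E : ℝ → Ω → ℝ≥0∞ := fun l ω => ENNReal.ofReal
    (Real.exp (l * signedSum e (fun k => Y k ω) b - l ^ 2 / 2 * quadVar e (fun k => Y k ω) b))
    with hE
  have hmarkov : ∀ l, P {ω | ENNReal.ofReal (Real.exp Λ) ≤ E l ω} ≤
      ENNReal.ofReal (Real.exp (-Λ)) := by
    intro l
    have hm : Measurable (E l) := by
      refine ((h.measurable_functional (n := b) (g := fun x => ENNReal.ofReal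
        (Real.exp (l * signedSum e x b - l ^ 2 / 2 * quadVar e x b))) ?_).mono (h.le b) le_rfl)
      intro x y hxy
      have h1 := he.depends_signedSum b x y hxy
      have h2 := he.depends_quadVar b x y hxy
      simp only at h1 h2 ⊢
      rw [h1, h2]
    have := meas_ge_le_lintegral_div (μ := P) hm.aemeasurable (ε := ENNReal.ofReal (Real.exp Λ))
      (by simp [Real.exp_pos]) ENNReal.ofReal_ne_top
    refine this.trans ((ENNReal.div_le_div_right (h.lintegral_exp_le he l b) _).trans ?_)
    rw [Real.exp_neg, ENNReal.ofReal_inv_of_pos (Real.exp_pos _), one_div]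
  have hsub : {ω | 2 * Λ * v < (signedSum e (fun k => Y k ω) b : ℝ) ^ 2 ∧
      (quadVar e (fun k => Y k ω) b : ℝ) ≤ v} ⊆
      {ω | ENNReal.ofReal (Real.exp Λ) ≤ E (r / v) ω} ∪
        {ω | ENNReal.ofReal (Real.exp Λ) ≤ E (-(r / v)) ω} := by
    rintro ω ⟨h1, h2⟩
    rw [← hr2, sq_lt_sq, abs_of_nonneg hr0] at h1
    have hV : (r / v) ^ 2 / 2 * quadVar e (fun k => Y k ω) b ≤ Λ := by
      calc (r / v) ^ 2 / 2 * quadVar e (fun k => Y k ω) b ≤ (r / v) ^ 2 / 2 * v := by gcongr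
        _ = Λ := by rw [div_pow, hr2]; field_simp
    have hrv : r / v * r = 2 * Λ := by rw [div_mul_eq_mul_div, ← sq, hr2]; field_simp
    have hrv0 : 0 ≤ r / v := by positivity
    rcases lt_abs.1 h1 with h3 | h3
    · left
      refine ENNReal.ofReal_le_ofReal (Real.exp_le_exp.2 ?_)
      nlinarith [mul_le_mul_of_nonneg_left h3.le hrv0]
    · right
      refine ENNReal.ofReal_le_ofReal (Real.exp_le_exp.2 ?_)
      rw [neg_sq]
      nlinarith [mul_le_mul_of_nonneg_left h3.le hrv0]
  refine (measure_mono hsub).trans ((measure_union_le _ _).trans ?_)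
  rw [two_mul, ENNReal.ofReal_add (by positivity) (by positivity)]
  exact add_le_add (hmarkov _) (hmarkov _)

/-- The weighted sum up to `b` is controlled by its quadratic variation. -/
def Controlled (e : (ℕ → ℤ) → ℕ → ℤ) (x : ℕ → ℤ) (Λ : ℝ) (b : ℕ) : Prop :=
  (signedSum e x b : ℝ) ^ 2 ≤ 2 * Λ * quadVar e x b

/-- The quadratic variation is an integer between 0 and b, so a union over its b positive values
replaces a deterministic bound by the variation itself. If it is 0, the sum vanishes. -/
lemma FairSigns.prob_not_controlled_le [IsProbabilityMeasure P] (h : FairSigns P F Y)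
    {e : (ℕ → ℤ) → ℕ → ℤ} (he : IsPredictable e) {Λ : ℝ} (hΛ : 0 ≤ Λ) (b : ℕ) :
    P {ω | ¬ Controlled e (fun k => Y k ω) Λ b} ≤ ENNReal.ofReal (2 * b * Real.exp (-Λ)) := by
  have hsub : {ω | ¬ Controlled e (fun k => Y k ω) Λ b} ⊆ ⋃ v ∈ Finset.Icc 1 b,
      {ω | 2 * Λ * (v : ℕ) < (signedSum e (fun k => Y k ω) b : ℝ) ^ 2 ∧
        (quadVar e (fun k => Y k ω) b : ℝ) ≤ (v : ℕ)} := by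
    intro ω hω
    rw [mem_ofPred_eq, Controlled, not_le] at hω
    have h0 := quadVar_nonneg e (fun k => Y k ω) b
    have hb := he.quadVar_le (fun k => Y k ω) b
    obtain ⟨v, hv⟩ := Int.eq_ofNat_of_zero_le h0
    have hv' : (quadVar e (fun k => Y k ω) b : ℝ) = (v : ℕ) := by rw [hv]; simp
    simp only [mem_iUnion, Finset.mem_Icc]
    refine ⟨v, ⟨?_, by omega⟩, by rwa [mem_ofPred_eq, ← hv', and_iff_left le_rfl]⟩
    rcases Nat.eq_zero_or_pos v with rfl | h1
    · rw [signedSum_eq_zero (by simpa using hv)] at hω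
      rw [hv'] at hω
      simp at hω
    · exact h1
  refine (measure_mono hsub).trans ((measure_biUnion_finset_le _ _).trans ?_)
  calc _ ≤ ∑ v ∈ Finset.Icc 1 b, ENNReal.ofReal (2 * Real.exp (-Λ)) :=
        Finset.sum_le_sum fun v hv => h.prob_signedSum_le he
          (by rw [Finset.mem_Icc] at hv; exact_mod_cast hv.1) hΛ b
    _ = _ := by
      rw [Finset.sum_const, Nat.card_Icc, nsmul_eq_mul, ← ENNReal.ofReal_natCast,
        ← ENNReal.ofReal_mul (by positivity)]
      congr 1; push_cast; ring

/-- The coefficients of the five weighted sums, started at time `a`, that govern the local times: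
the increments of the walk, the Tanaka sums, the steps away from a site, the products of the two
steps of the pairs that start at a site, and the products of the two steps of all pairs. -/
def testCoeff : Fin 5 → ℕ → (ℕ → ℤ) → ℕ → ℤ
  | 0, a, _, i => if a ≤ i then 1 else 0
  | 1, a, x, i => if a ≤ i then -(partialSum x i - partialSum x a).sign else 0
  | 2, a, x, i => if a ≤ i ∧ partialSum x i = partialSum x a then 1 else 0
  | 3, a, x, i => if 2 * a ≤ i ∧ i % 2 = 1 ∧ partialSum x (i - 1) = partialSum x (2 * a)
      then (x i).sign else 0
  | 4, _, x, i => if i % 2 = 1 then (x i).sign else 0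

lemma abs_sign_le_one (z : ℤ) : |z.sign| ≤ 1 := by
  rcases lt_trichotomy z 0 with h | rfl | h
  · simp [Int.sign_eq_neg_one_of_neg h]
  · simp
  · simp [Int.sign_eq_one_of_pos h]

/-- The coefficient with index i multiplies step i+1 and reads only the steps up to i. The signs of
steps in the last two families keep the bound valid for arbitrary integer sequences. -/
lemma isPredictable_testCoeff (f : Fin 5) (a : ℕ) : IsPredictable (testCoeff f a) where
  depends i x y hxy := by
    have hS : ∀ k, k ≤ i → partialSum x k = partialSum y k :=
      fun k hk => dependsOnPast_partialSum hk x y hxy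
    fin_cases f <;> simp only [testCoeff]
    · by_cases h : a ≤ i
      · simp [h, hS i le_rfl, hS a h]
      · simp [h]
    · by_cases h : a ≤ i
      · simp [h, hS i le_rfl, hS a h]
      · simp [h]
    · by_cases h : 2 * a ≤ i ∧ i % 2 = 1
      · simp [h.1, h.2, hS _ h.1, hS (i - 1) (by omega), hxy i (by omega) le_rfl]
      · rw [if_neg (by tauto), if_neg (by tauto)]
    · by_cases h : i % 2 = 1
      · simp [h, hxy i (by omega) le_rfl]
      · simp [h]
  bound x i := by
    fin_cases f <;> simp only [testCoeff] <;> split_ifs <;> simp [abs_sign_le_one]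

/-- All test sums up to the horizon `H` are controlled. -/
def Good (x : ℕ → ℤ) (H : ℕ) (Λ : ℝ) : Prop :=
  ∀ f a b, a ≤ H → b ≤ H → Controlled (testCoeff f a) x Λ b

/-- A union over 5(H+1)² sums, each failing with probability at most 2(H+1)e^{-Λ}. -/
lemma FairSigns.prob_not_good_le [IsProbabilityMeasure P] (h : FairSigns P F Y) {Λ : ℝ}
    (hΛ : 0 ≤ Λ) (H : ℕ) :
    P {ω | ¬ Good (fun k => Y k ω) H Λ} ≤ ENNReal.ofReal (10 * (H + 1) ^ 3 * Real.exp (-Λ)) := by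
  have hsub : {ω | ¬ Good (fun k => Y k ω) H Λ} ⊆
      ⋃ p ∈ (Finset.univ : Finset (Fin 5)) ×ˢ Finset.range (H + 1) ×ˢ Finset.range (H + 1),
        {ω | ¬ Controlled (testCoeff p.1 p.2.1) (fun k => Y k ω) Λ p.2.2} := by
    intro ω hω
    simp only [mem_ofPred_eq, Good, not_forall] at hω
    obtain ⟨f, a, b, ha, hb, hc⟩ := hω
    simp only [mem_iUnion]
    exact ⟨(f, a, b), by simp; omega, hc⟩
  refine (measure_mono hsub).trans ((measure_biUnion_finset_le _ _).trans ?_)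
  calc _ ≤ ∑ p ∈ (Finset.univ : Finset (Fin 5)) ×ˢ Finset.range (H + 1) ×ˢ Finset.range (H + 1),
        ENNReal.ofReal (2 * (H + 1) * Real.exp (-Λ)) :=
        Finset.sum_le_sum fun p hp => (h.prob_not_controlled_le (isPredictable_testCoeff _ _) hΛ
          _).trans (ENNReal.ofReal_le_ofReal (by
            simp only [Finset.mem_product, Finset.mem_range] at hp
            have : (p.2.2 : ℝ) ≤ H + 1 := by exact_mod_cast hp.2.2.le
            gcongr))
    _ = _ := by
      rw [Finset.sum_const, nsmul_eq_mul, ← ENNReal.ofReal_natCast,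
        ← ENNReal.ofReal_mul (by positivity)]
      congr 1
      simp
      ring

end TwistShrink

/-! ### Recursions for the counts; infinitely many matched pairs -/

namespace TwistShrink

lemma signedSum_succ (e : (ℕ → ℤ) → ℕ → ℤ) (x : ℕ → ℤ) (b : ℕ) :
    signedSum e x (b + 1) = signedSum e x b + e x b * x (b + 1) := Finset.sum_range_succ _ _

lemma quadVar_succ (e : (ℕ → ℤ) → ℕ → ℤ) (x : ℕ → ℤ) (b : ℕ) :
    quadVar e x (b + 1) = quadVar e x b + e x b ^ 2 := Finset.sum_range_succ _ _

lemma walkLocalTime_zero (S : ℕ → ℤ) (x : ℤ) : walkLocalTime S 0 x = 0 := by simp [walkLocalTime]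

lemma walkLocalTime_succ (S : ℕ → ℤ) (k : ℕ) (x : ℤ) :
    walkLocalTime S (k + 1) x = walkLocalTime S k x + if S k = x then 1 else 0 := by
  unfold walkLocalTime
  rw [Finset.range_add_one, Finset.filter_insert]
  split_ifs <;> simp

lemma walkLocalTime_mono (S : ℕ → ℤ) (x : ℤ) : Monotone (fun k => walkLocalTime S k x) :=
  monotone_nat_of_le_succ fun k => by simp only [walkLocalTime_succ]; omega

lemma walkLocalTime_eq_of_forall_ne {S : ℕ → ℤ} {a b : ℕ} {x : ℤ} (hab : a ≤ b)
    (h : ∀ i, a ≤ i → i < b → S i ≠ x) : walkLocalTime S b x = walkLocalTime S a x := by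
  induction b, hab using Nat.le_induction with
  | base => rfl
  | succ b hb ih =>
    rw [walkLocalTime_succ, if_neg (h b hb b.lt_succ_self), add_zero]
    exact ih fun i h1 h2 => h i h1 (h2.trans b.lt_succ_self)

lemma IsSign.mul_self {x : ℕ → ℤ} (hx : IsSign x) {k : ℕ} (hk : 1 ≤ k) : x k * x k = 1 := by
  rcases hx k hk with h | h <;> rw [h] <;> norm_num

lemma IsSign.sign_eq {x : ℕ → ℤ} (hx : IsSign x) {k : ℕ} (hk : 1 ≤ k) : (x k).sign = x k := by
  rcases hx k hk with h | h <;> rw [h] <;> rfl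

/-! ### Pairs of steps -/

lemma IsSign.signedSum_pairs {x : ℕ → ℤ} (hx : IsSign x) (a p : ℕ) :
    signedSum (testCoeff 4 a) x (2 * p) = 2 * matchCount x p - p ∧
      quadVar (testCoeff 4 a) x (2 * p) = p := by
  induction p with
  | zero => simp [signedSum, quadVar, matchCount]
  | succ p ih =>
    have h1 : testCoeff 4 a x (2 * p) = 0 := by simp [testCoeff]
    have h2 : testCoeff 4 a x (2 * p + 1) = x (2 * p + 1) := by
      rw [testCoeff, if_pos (by omega), hx.sign_eq (by omega)]
    rw [show 2 * (p + 1) = 2 * p + 1 + 1 by ring, signedSum_succ, signedSum_succ, quadVar_succ,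
      quadVar_succ, h1, h2, ih.1, ih.2, matchCount_succ, sq (x _), hx.mul_self (by omega)]
    refine ⟨?_, by push_cast; ring⟩
    split_ifs with h
    · unfold Matched at h
      rw [show 2 * p + 1 + 1 = 2 * p + 2 by ring, ← h, hx.mul_self (by omega)]; push_cast; ring
    · have := hx.mul_self (k := 2 * p + 1) (by omega)
      rw [show 2 * p + 1 + 1 = 2 * p + 2 by ring, hx.not_matched h]; push_cast; linarith

variable {Ω : Type*} {mΩ : MeasurableSpace Ω} {P : Measure Ω} {F : ℕ → MeasurableSpace Ω}
  {Y : ℕ → Ω → ℤ}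

lemma FairSigns.ae_infinite_matched [IsProbabilityMeasure P] (h : FairSigns P F Y) :
    ∀ᵐ ω ∂P, (Set.ofPred (Matched (fun k => Y k ω))).Infinite := by
  have hz : ∀ a : ℕ, ∀ᵐ ω ∂P, ∃ p, a < matchCount (fun k => Y k ω) p := by
    intro a
    rw [ae_iff]
    push Not
    have hlim : Tendsto (fun L : ℕ => ENNReal.ofReal (2 * Real.exp (-(L : ℝ)))) atTop (𝓝 0) := by
      have : Tendsto (fun L : ℕ => 2 * Real.exp (-(L : ℝ))) atTop (𝓝 (2 * 0)) :=
        (Real.tendsto_exp_neg_atTop_nhds_zero.comp tendsto_natCast_atTop_atTop).const_mul 2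
      simpa using ENNReal.tendsto_ofReal this
    refine le_antisymm (ge_of_tendsto' hlim fun L => ?_) (zero_le)
    -- With at most a matches among p ≥ 4a pairs the pair sum is at most -p/2, and p²/4 > 2Lp
    -- because p > 8L.
    set p : ℕ := 4 * a + 8 * L + 1 with hp
    refine le_trans (measure_mono_ae ?_) (h.prob_signedSum_le (isPredictable_testCoeff 4 0)
      (v := p) (Λ := L) (by positivity) (by positivity) (2 * p))
    filter_upwards [h.ae_isSign] with ω hω hc
    obtain ⟨h1, h2⟩ := hω.signedSum_pairs 0 p
    refine ⟨?_, by rw [h2]; simp⟩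
    rw [h1]
    have h3 : (matchCount (fun k => Y k ω) p : ℝ) ≤ a := by exact_mod_cast hc p
    have h4 : (p : ℝ) = 4 * a + 8 * L + 1 := by rw [hp]; push_cast; ring
    have h5 : (0 : ℝ) ≤ a := by positivity
    have h6 : (0 : ℝ) ≤ L := by positivity
    push_cast
    have h7 : (p : ℝ) / 2 ≤ p - 2 * matchCount (fun k => Y k ω) p := by linarith
    nlinarith
  filter_upwards [ae_all_iff.2 hz] with ω hω hf
  obtain ⟨p, hp⟩ := hω hf.toFinset.card
  refine absurd hp (not_lt.2 ?_)
  rw [matchCount, Nat.count_eq_card_filter_range]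
  refine Finset.card_le_card fun i hi => ?_
  simp only [Finset.mem_filter] at hi
  simpa using hi.2

/-- Almost surely, the twisted steps have the explicit description of `signedStep`. -/
lemma ae_twistedStep_eq [IsProbabilityMeasure P] {X : ℕ → ℕ → Ω → ℤ}
    (hmeas : ∀ m k, 1 ≤ k → Measurable (X m k))
    (hprob : ∀ m k, 1 ≤ k → P {ω | X m k ω = 1} = 1 / 2 ∧ P {ω | X m k ω = -1} = 1 / 2)
    (hind : iIndepFun (fun (p : ℕ × ℕ) => X p.1 (p.2 + 1)) P) :
    ∀ᵐ ω ∂P, ∀ m, IsSign (signedStep (fun i k => X i k ω) m) ∧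
      Refines (signedStep (fun i k => X i k ω) (m + 1)) (signedStep (fun i k => X i k ω) m) ∧
      twistedWalk (fun i k => X i k ω) m = partialSum (signedStep (fun i k => X i k ω) m) := by
  have h1 := fun m => (fairSigns_coins hmeas hprob hind m).ae_isSign
  have h2 := fun m => (fairSigns_coins hmeas hprob hind m).ae_infinite_matched
  filter_upwards [ae_all_iff.2 h1, ae_all_iff.2 h2] with ω hs hi m
  have hsign : ∀ m, IsSign (signedStep (fun i k => X i k ω) m) := by
    intro m
    cases m with
    | zero => exact hs 0
    | succ m => exact (hs (m + 1)).mergeSign (flipSign_sign _ _)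
  refine ⟨hsign m, refines_mergeSign (hs (m + 1)) (hsign m), ?_⟩
  have heq : ∀ m k, 1 ≤ k →
      twistedStep (fun i k => X i k ω) m k = signedStep (fun i k => X i k ω) m k := by
    intro m
    induction m with
    | zero => intro k _; rfl
    | succ m ih =>
      intro k hk
      have hy : IsSign (twistedStep (fun i k => X i k ω) m) := fun j hj => by
        rw [ih j hj]; exact hsign m j hj
      rw [twistedStep, twist_eq_mergeSign (hs (m + 1)) (hi (m + 1)) hy hk, signedStep]
      simp only [mergeSign, flipSign, ih _ (Nat.le_add_left 1 _)]
  funext n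
  exact Finset.sum_congr rfl fun k hk => heq m k (Finset.mem_Icc.1 hk).1

end TwistShrink

/-! ### Pathwise estimates for walks and local times on the good event -/

namespace TwistShrink

lemma testCoeff_zero_of_lt {f : Fin 5} (hf : f = 0 ∨ f = 1) {a i : ℕ} (x : ℕ → ℤ) (h : i < a) :
    testCoeff f a x i = 0 := by
  rcases hf with rfl | rfl <;> simp [testCoeff, h]

lemma signedSum_start {f : Fin 5} (hf : f = 0 ∨ f = 1) (a : ℕ) (x : ℕ → ℤ) :
    signedSum (testCoeff f a) x a = 0 :=
  Finset.sum_eq_zero fun i hi => by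
    rw [testCoeff_zero_of_lt hf x (Finset.mem_range.1 hi), zero_mul]

lemma quadVar_window_le {f : Fin 5} (hf : f = 0 ∨ f = 1) {a b : ℕ} (hab : a ≤ b) (x : ℕ → ℤ) :
    quadVar (testCoeff f a) x b ≤ b - a := by
  induction b, hab using Nat.le_induction with
  | base =>
    rw [sub_self, quadVar]
    exact (Finset.sum_eq_zero fun i hi => by
      rw [testCoeff_zero_of_lt hf x (Finset.mem_range.1 hi)]; rfl).le
  | succ b hb ih =>
    rw [quadVar_succ]
    have := (isPredictable_testCoeff f a).bound x b
    have h2 : testCoeff f a x b ^ 2 ≤ 1 := by rw [← sq_abs]; nlinarith [abs_nonneg (testCoeff f a x b)]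
    push_cast; linarith

/-- A controlled sum over a window is small. -/
lemma Good.abs_signedSum_le {x : ℕ → ℤ} {H : ℕ} {Λ : ℝ} (hG : Good x H Λ) (hΛ : 0 ≤ Λ)
    {f : Fin 5} (hf : f = 0 ∨ f = 1) {a b : ℕ} (hab : a ≤ b) (hb : b ≤ H) {r : ℝ} (hr : 0 ≤ r)
    (h : 2 * Λ * (b - a) ≤ r ^ 2) : |(signedSum (testCoeff f a) x b : ℝ)| ≤ r := by
  refine abs_le_of_sq_le_sq ?_ hr
  refine (hG f a b (hab.trans hb) hb).trans (le_trans ?_ h)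
  have h1 : (quadVar (testCoeff f a) x b : ℝ) ≤ b - a := by exact_mod_cast quadVar_window_le hf hab x
  gcongr

lemma signedSum_increment (x : ℕ → ℤ) {a b : ℕ} (hab : a ≤ b) :
    signedSum (testCoeff 0 a) x b = partialSum x b - partialSum x a := by
  induction b, hab using Nat.le_induction with
  | base => rw [signedSum_start (Or.inl rfl)]; ring
  | succ b hb ih => rw [signedSum_succ, ih, partialSum_succ, testCoeff, if_pos hb]; ring

lemma Good.abs_increment_le {x : ℕ → ℤ} {H : ℕ} {Λ : ℝ} (hG : Good x H Λ) (hΛ : 0 ≤ Λ)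
    {a b : ℕ} (hab : a ≤ b) (hb : b ≤ H) {r : ℝ} (hr : 0 ≤ r) (h : 2 * Λ * (b - a) ≤ r ^ 2) :
    |(partialSum x b : ℝ) - partialSum x a| ≤ r := by
  have := hG.abs_signedSum_le hΛ (Or.inl rfl) hab hb hr h
  rwa [signedSum_increment x hab, Int.cast_sub] at this

/-- The discrete Tanaka formula. -/
lemma IsSign.tanaka {x : ℕ → ℤ} (hx : IsSign x) {a b : ℕ} (hab : a ≤ b) :
    |partialSum x b - partialSum x a| = -signedSum (testCoeff 1 a) x b +
      (walkLocalTime (partialSum x) b (partialSum x a) -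
        walkLocalTime (partialSum x) a (partialSum x a)) := by
  induction b, hab using Nat.le_induction with
  | base => rw [signedSum_start (Or.inr rfl)]; simp
  | succ b hb ih =>
    rw [signedSum_succ, walkLocalTime_succ, partialSum_succ, testCoeff, if_pos hb]
    rcases lt_trichotomy (partialSum x b - partialSum x a) 0 with h | h | h
    · rw [if_neg (by omega), Int.sign_eq_neg_one_of_neg h]
      rw [abs_of_neg h] at ih
      rcases hx (b + 1) (by omega) with h' | h' <;> rw [h', abs_of_nonpos (by omega)] <;>
        push_cast <;> linarith
    · rw [if_pos (by omega), h, Int.sign_zero]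
      rw [h, abs_zero] at ih
      rw [show partialSum x b + x (b + 1) - partialSum x a = x (b + 1) by omega]
      rcases hx (b + 1) (by omega) with h' | h' <;> rw [h'] <;> push_cast <;> simp <;> linarith
    · rw [if_neg (by omega), Int.sign_eq_one_of_pos h]
      rw [abs_of_pos h] at ih
      rcases hx (b + 1) (by omega) with h' | h' <;> rw [h', abs_of_nonneg (by omega)] <;>
        push_cast <;> linarith

/-- For a < b take j as the last return to the starting site before time b. There the left side of
Tanaka's formula vanishes, so the earlier visits are counted by the Tanaka sum, and the visit at j
adds one. -/
lemma IsSign.exists_localTime_le {x : ℕ → ℤ} (hx : IsSign x) {a b : ℕ} (hab : a ≤ b) :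
    ∃ j, a ≤ j ∧ j ≤ b ∧ (walkLocalTime (partialSum x) b (partialSum x a) : ℤ) -
      walkLocalTime (partialSum x) a (partialSum x a) ≤ 1 + signedSum (testCoeff 1 a) x j := by
  induction b, hab using Nat.le_induction with
  | base => exact ⟨a, le_rfl, le_rfl, by rw [signedSum_start (Or.inr rfl)]; simp⟩
  | succ b hb ih =>
    by_cases h : partialSum x b = partialSum x a
    · refine ⟨b, hb, b.le_succ, ?_⟩
      have := hx.tanaka hb
      rw [h, sub_self, abs_zero] at this
      rw [walkLocalTime_succ, if_pos h]
      push_cast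
      linarith
    · obtain ⟨j, h1, h2, h3⟩ := ih
      refine ⟨j, h1, h2.trans b.le_succ, ?_⟩
      rwa [walkLocalTime_succ, if_neg h, add_zero]

/-- The first visit of a site in a time window. -/
lemma exists_first_visit (S : ℕ → ℤ) (z : ℤ) (a b : ℕ) (hab : a ≤ b) :
    (∀ i, a ≤ i → i < b → S i ≠ z) ∨
      ∃ a', a ≤ a' ∧ a' < b ∧ S a' = z ∧ ∀ i, a ≤ i → i < a' → S i ≠ z := by
  induction b, hab using Nat.le_induction with
  | base => left; intro i h1 h2; omega
  | succ b hb ih =>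
    rcases ih with h | ⟨a', h1, h2, h3⟩
    · by_cases hz : S b = z
      · exact Or.inr ⟨b, hb, b.lt_succ_self, hz, h⟩
      · left
        intro i h1 h2
        rcases Nat.lt_succ_iff_lt_or_eq.1 h2 with h3 | rfl
        · exact h i h1 h3
        · exact hz
    · exact Or.inr ⟨a', h1, h2.trans b.lt_succ_self, h3⟩

/-- The window is restarted at the first visit of z, which turns the site into a starting point. The
good event thus needs a union over starting times only, and the bound is uniform in z. -/
lemma Good.localTime_window_le {x : ℕ → ℤ} (hx : IsSign x) {H : ℕ} {Λ : ℝ} (hG : Good x H Λ)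
    (hΛ : 0 ≤ Λ) {a b : ℕ} (hab : a ≤ b) (hb : b ≤ H) {r : ℝ} (hr : 0 ≤ r)
    (h : 2 * Λ * (b - a) ≤ r ^ 2) (z : ℤ) :
    (walkLocalTime (partialSum x) b z : ℝ) - walkLocalTime (partialSum x) a z ≤ 1 + r := by
  rcases exists_first_visit (partialSum x) z a b hab with h1 | ⟨a', h1, h2, rfl, h3⟩
  · rw [walkLocalTime_eq_of_forall_ne hab h1, sub_self]; positivity
  · rw [← walkLocalTime_eq_of_forall_ne h1 h3]
    obtain ⟨j, h4, h5, h6⟩ := hx.exists_localTime_le h2.le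
    have h7 := hG.abs_signedSum_le hΛ (Or.inr rfl) h4 (h5.trans hb) hr (le_trans (by
      have : (j : ℝ) ≤ b := by exact_mod_cast h5
      have : (a : ℝ) ≤ a' := by exact_mod_cast h1
      have : (j : ℝ) - a' ≤ b - a := by linarith
      gcongr) h)
    have h8 : (walkLocalTime (partialSum x) b (partialSum x a') : ℝ) -
        walkLocalTime (partialSum x) a' (partialSum x a') ≤
        1 + signedSum (testCoeff 1 a') x j := by exact_mod_cast h6
    linarith [le_abs_self (signedSum (testCoeff 1 a') x j : ℝ)]

/-- The sum of the steps away from the site `z`. -/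
def siteSum (x : ℕ → ℤ) (z : ℤ) (k : ℕ) : ℤ :=
  ∑ i ∈ Finset.range k, if partialSum x i = z then x (i + 1) else 0

/-- The upward crossings of the edge from z to z+1 number half of local time plus site sum at z, the
downward ones half of local time minus site sum at z+1. Their difference depends only on the sides
of the edge on which the walk starts and ends. -/
lemma IsSign.localTime_sub_succ {x : ℕ → ℤ} (hx : IsSign x) (z : ℤ) (k : ℕ) :
    (walkLocalTime (partialSum x) k z : ℤ) - walkLocalTime (partialSum x) k (z + 1) =
      -siteSum x z k - siteSum x (z + 1) k +
        2 * ((if z < partialSum x k then 1 else 0) - if z < 0 then 1 else 0) := by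
  induction k with
  | zero => simp [walkLocalTime_zero, siteSum]
  | succ k ih =>
    simp only [siteSum, Finset.sum_range_succ] at ih ⊢
    rw [walkLocalTime_succ, walkLocalTime_succ, partialSum_succ]
    rcases hx (k + 1) (by omega) with h' | h' <;> rw [h'] <;> push_cast <;> split_ifs at ih ⊢ <;>
      omega

lemma walkLocalTime_eq_sum (S : ℕ → ℤ) (k : ℕ) (z : ℤ) :
    (walkLocalTime S k z : ℤ) = ∑ i ∈ Finset.range k, if S i = z then 1 else 0 := by
  rw [walkLocalTime, Finset.sum_boole]

/-- Started at the first visit of z, the third test sum is the site sum, and its quadratic variation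
is exactly the local time. -/
lemma Good.siteSum_sq_le {x : ℕ → ℤ} {H : ℕ} {Λ : ℝ} (hG : Good x H Λ) {k : ℕ} (hk : k ≤ H)
    (z : ℤ) : (siteSum x z k : ℝ) ^ 2 ≤ 2 * Λ * walkLocalTime (partialSum x) k z := by
  rcases exists_first_visit (partialSum x) z 0 k (Nat.zero_le k) with h1 | ⟨a, -, h2, rfl, h3⟩
  · have : siteSum x z k = 0 := Finset.sum_eq_zero fun i hi =>
      if_neg (h1 i (Nat.zero_le i) (Finset.mem_range.1 hi))
    rw [this, walkLocalTime_eq_of_forall_ne (Nat.zero_le k) h1, walkLocalTime_zero]; simp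
  · have hc := hG 2 a k (h2.le.trans hk) hk
    have hiff : ∀ i, (a ≤ i ∧ partialSum x i = partialSum x a) ↔
        partialSum x i = partialSum x a := fun i =>
      and_iff_right_of_imp fun h => not_lt.1 fun h' => h3 i (Nat.zero_le i) h' h
    have e1 : signedSum (testCoeff 2 a) x k = siteSum x (partialSum x a) k :=
      Finset.sum_congr rfl fun i _ => by simp only [testCoeff, hiff, ite_mul, one_mul, zero_mul]
    have e2 : quadVar (testCoeff 2 a) x k = walkLocalTime (partialSum x) k (partialSum x a) := by
      rw [walkLocalTime_eq_sum]
      exact Finset.sum_congr rfl fun i _ => by simp only [testCoeff, hiff]; split_ifs <;> rfl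
    rw [Controlled, e1, e2] at hc
    simpa using hc

/-- The sum of the products of the two steps of the pairs that start at the site `z`. -/
def pairSum (x : ℕ → ℤ) (z : ℤ) (p : ℕ) : ℤ :=
  ∑ i ∈ Finset.range p, if partialSum x (2 * i) = z then x (2 * i + 1) * x (2 * i + 2) else 0

/-- Even sites are visited at even times only. A pair that starts at 2j adds one visit of `x`, and
one visit of `y` to j exactly if it is matched; 1 - 2·1{matched} is minus the product of its steps.
-/
lemma localTime_sub_eq_pairSum {x y : ℕ → ℤ} (hx : IsSign x) (h : Refines x y) (j : ℤ) (p : ℕ) :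
    (walkLocalTime (partialSum x) (2 * p) (2 * j) : ℤ) -
      2 * walkLocalTime (partialSum y) (matchCount x p) j = -pairSum x (2 * j) p := by
  induction p with
  | zero => simp [walkLocalTime_zero, pairSum, matchCount]
  | succ p ih =>
    have hodd : partialSum x (2 * p + 1) ≠ 2 * j := by
      rw [partialSum_succ, h p]
      rcases hx (2 * p + 1) (by omega) with h' | h' <;> rw [h'] <;> omega
    have hpair : pairSum x (2 * j) (p + 1) = pairSum x (2 * j) p +
        if partialSum x (2 * p) = 2 * j then x (2 * p + 1) * x (2 * p + 2) else 0 :=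
      Finset.sum_range_succ _ _
    have hiff : partialSum x (2 * p) = 2 * j ↔ partialSum y (matchCount x p) = j := by
      rw [h p]; omega
    rw [show 2 * (p + 1) = 2 * p + 1 + 1 by ring, walkLocalTime_succ, walkLocalTime_succ,
      if_neg hodd, add_zero, hpair, matchCount_succ]
    have h1 := hx.mul_self (k := 2 * p + 1) (by omega)
    by_cases hm : Matched x p
    · have hm' : x (2 * p + 2) = x (2 * p + 1) := hm.symm
      rw [if_pos hm, walkLocalTime_succ, hm', h1]
      simp only [hiff]
      split_ifs <;> push_cast <;> linarith
    · rw [if_neg hm, add_zero, hx.not_matched hm, mul_neg, h1]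
      split_ifs <;> push_cast <;> linarith

lemma Good.pairSum_sq_le {x : ℕ → ℤ} (hx : IsSign x) {H : ℕ} {Λ : ℝ} (hG : Good x H Λ)
    (hΛ : 0 ≤ Λ) {p : ℕ} (hp : 2 * p ≤ H) (z : ℤ) :
    (pairSum x z p : ℝ) ^ 2 ≤ 2 * Λ * walkLocalTime (partialSum x) (2 * p) z := by
  rcases exists_first_visit (fun i => partialSum x (2 * i)) z 0 p (Nat.zero_le p) with
    h1 | ⟨a, -, h2, rfl, h3⟩
  · have : pairSum x z p = 0 := Finset.sum_eq_zero fun i hi =>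
      if_neg (h1 i (Nat.zero_le i) (Finset.mem_range.1 hi))
    rw [this, Int.cast_zero, sq, zero_mul]; positivity
  · have hc := hG 3 a (2 * p) (by omega) hp
    have key : ∀ p, signedSum (testCoeff 3 a) x (2 * p) = pairSum x (partialSum x (2 * a)) p ∧
        quadVar (testCoeff 3 a) x (2 * p) ≤
          walkLocalTime (partialSum x) (2 * p) (partialSum x (2 * a)) := by
      intro p
      induction p with
      | zero => simp [signedSum, quadVar, pairSum]
      | succ p ih =>
        have e1 : testCoeff 3 a x (2 * p) = 0 := by simp [testCoeff]
        have e2 : testCoeff 3 a x (2 * p + 1) =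
            if partialSum x (2 * p) = partialSum x (2 * a) then x (2 * p + 1) else 0 := by
          rw [testCoeff, hx.sign_eq (by omega)]
          congr 1
          rw [Nat.add_sub_cancel, eq_iff_iff]
          refine ⟨fun h => h.2.2, fun h => ⟨?_, by omega, h⟩⟩
          by_contra hlt
          exact h3 p (Nat.zero_le p) (by omega) h
        have hpair : pairSum x (partialSum x (2 * a)) (p + 1) = pairSum x (partialSum x (2 * a)) p +
            if partialSum x (2 * p) = partialSum x (2 * a) then x (2 * p + 1) * x (2 * p + 2)
            else 0 := Finset.sum_range_succ _ _
        rw [show 2 * (p + 1) = 2 * p + 1 + 1 by ring, signedSum_succ, signedSum_succ, quadVar_succ,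
          quadVar_succ, walkLocalTime_succ, walkLocalTime_succ, e1, e2, ih.1, hpair]
        have h1 := hx.mul_self (k := 2 * p + 1) (by omega)
        have ih2 := ih.2
        constructor
        · split_ifs <;> simp
        · split_ifs <;> push_cast <;> simp [sq, h1] <;> linarith
    rw [Controlled, (key p).1] at hc
    refine hc.trans ?_
    have : (quadVar (testCoeff 3 a) x (2 * p) : ℝ) ≤
        walkLocalTime (partialSum x) (2 * p) (partialSum x (2 * a)) := by exact_mod_cast (key p).2
    gcongr

lemma Good.matchCount_sub_sq_le {x : ℕ → ℤ} (hx : IsSign x) {H : ℕ} {Λ : ℝ} (hG : Good x H Λ)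
    {p : ℕ} (hp : 2 * p ≤ H) : (2 * (matchCount x p : ℝ) - p) ^ 2 ≤ 2 * Λ * p := by
  have hc := hG 4 0 (2 * p) (Nat.zero_le H) hp
  obtain ⟨h1, h2⟩ := hx.signedSum_pairs 0 p
  rw [Controlled, h1, h2] at hc
  exact_mod_cast hc

/-- The comparison of a walk with its refinement. -/
lemma level_estimate {x y : ℕ → ℤ} (hx : IsSign x) (hy : IsSign y) (h : Refines x y) {H H' : ℕ}
    {Λ n q ρ : ℝ} (hΛ : 0 ≤ Λ) (hGx : Good x H Λ) (hGy : Good y H' Λ) (hq6 : 6 ≤ q)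
    (hq : q ^ 2 = n * Λ) (hρ0 : 0 ≤ ρ) (hρ : ρ ^ 2 = q * Λ) {k : ℕ} (hkn : k ≤ n) (hkH : 4 * k ≤ H)
    (hkH' : k + q ≤ H') :
    |(partialSum x (4 * k) : ℝ) - 2 * partialSum y k| ≤ 3 * ρ ∧
    (∀ j, |(walkLocalTime (partialSum x) (4 * k) (2 * j) : ℝ) -
      2 * walkLocalTime (partialSum y) k j| ≤ 7.75 * ρ + 3) ∧
    ∀ j, |(walkLocalTime (partialSum x) (4 * k) (2 * j + 1) : ℝ) -
      (walkLocalTime (partialSum y) k j + walkLocalTime (partialSum y) k (j + 1))| ≤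
        7.75 * ρ + 3 := by
  set c := matchCount x (2 * k) with hc
  have hq0 : 0 ≤ q := by linarith
  -- Control of the 2k pairs reads (2c - 2k)² ≤ 4Λk.
  have hcq : |(c : ℝ) - k| ≤ q := by
    have h1 := hGx.matchCount_sub_sq_le hx (p := 2 * k) (by omega)
    push_cast at h1
    refine abs_le_of_sq_le_sq ?_ hq0
    have : Λ * k ≤ n * Λ := by rw [mul_comm n]; gcongr
    nlinarith
  have hcH' : c ≤ H' := by
    have : (c : ℝ) ≤ H' := by linarith [(abs_le.1 hcq).2]
    exact_mod_cast this
  have hkH'' : k ≤ H' := by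
    have : (k : ℝ) ≤ H' := by linarith
    exact_mod_cast this
  -- Here 1.415 exceeds √2; below, 2.83 exceeds √8 and 2.45 exceeds √6, from 2Λ·4k ≤ 8q² and 2Λ·3q =
  -- 6ρ².
  have hwin : ∀ d : ℝ, d ≤ q → 2 * Λ * d ≤ (1.415 * ρ) ^ 2 := fun d hd => by
    have : Λ * d ≤ q * Λ := by rw [mul_comm q]; gcongr
    nlinarith
  have hS : |(partialSum y c : ℝ) - partialSum y k| ≤ 1.415 * ρ := by
    rcases le_total c k with hck | hck
    · rw [abs_sub_comm]
      exact hGy.abs_increment_le hΛ hck hkH'' (by positivity) (hwin _ (by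
        linarith [(abs_le.1 hcq).1]))
    · exact hGy.abs_increment_le hΛ hck hcH' (by positivity) (hwin _ (by
        linarith [(abs_le.1 hcq).2]))
  have hL : ∀ z, |(walkLocalTime (partialSum y) c z : ℝ) - walkLocalTime (partialSum y) k z| ≤
      1 + 1.415 * ρ := by
    intro z
    rcases le_total c k with hck | hck
    · rw [abs_sub_comm, abs_of_nonneg (sub_nonneg.2 (by
        exact_mod_cast walkLocalTime_mono (partialSum y) z hck))]
      exact hGy.localTime_window_le hy hΛ hck hkH'' (by positivity) (hwin _ (by
        linarith [(abs_le.1 hcq).1])) z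
    · rw [abs_of_nonneg (sub_nonneg.2 (by
        exact_mod_cast walkLocalTime_mono (partialSum y) z hck))]
      exact hGy.localTime_window_le hy hΛ hck hcH' (by positivity) (hwin _ (by
        linarith [(abs_le.1 hcq).2])) z
  have hA : ∀ z, (walkLocalTime (partialSum x) (4 * k) z : ℝ) ≤ 3 * q := by
    intro z
    have h1 := hGx.localTime_window_le hx hΛ (Nat.zero_le (4 * k)) hkH (r := 2.83 * q)
      (by positivity) (by
        push_cast
        have : Λ * k ≤ n * Λ := by rw [mul_comm n]; gcongr
        nlinarith) z
    rw [walkLocalTime_zero] at h1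
    push_cast at h1
    linarith
  have hA' : ∀ z, 2 * Λ * (walkLocalTime (partialSum x) (4 * k) z : ℝ) ≤ (2.45 * ρ) ^ 2 := by
    intro z
    have : Λ * (walkLocalTime (partialSum x) (4 * k) z : ℝ) ≤ Λ * (3 * q) := by
      gcongr; exact hA z
    nlinarith
  have hM : ∀ z, |(siteSum x z (4 * k) : ℝ)| ≤ 2.45 * ρ := fun z =>
    abs_le_of_sq_le_sq ((hGx.siteSum_sq_le hkH z).trans (hA' z)) (by positivity)
  have hpair : ∀ z, |(pairSum x z (2 * k) : ℝ)| ≤ 2.45 * ρ := fun z => by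
    have h1 := hGx.pairSum_sq_le hx hΛ (p := 2 * k) (by omega) z
    rw [show 2 * (2 * k) = 4 * k by ring] at h1
    exact abs_le_of_sq_le_sq (h1.trans (hA' z)) (by positivity)
  -- The constants add up as 2.45ρ + 2(1 + 1.415ρ).
  have heven : ∀ j, |(walkLocalTime (partialSum x) (4 * k) (2 * j) : ℝ) -
      2 * walkLocalTime (partialSum y) k j| ≤ 5.28 * ρ + 2 := by
    intro j
    have h1 := localTime_sub_eq_pairSum hx h j (2 * k)
    rw [show 2 * (2 * k) = 4 * k by ring, ← hc] at h1
    have h2 : (walkLocalTime (partialSum x) (4 * k) (2 * j) : ℝ) -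
      2 * walkLocalTime (partialSum y) c j = -pairSum x (2 * j) (2 * k) := by exact_mod_cast h1
    have h3 := abs_le.1 (hpair (2 * j))
    have h4 := abs_le.1 (hL j)
    rw [abs_le]
    constructor <;> linarith [h3.1, h3.2, h4.1, h4.2]
  refine ⟨?_, fun j => (heven j).trans (by linarith), fun j => ?_⟩
  · have h1 := h (2 * k)
    rw [show 2 * (2 * k) = 4 * k by ring, ← hc] at h1
    rw [h1]
    push_cast
    rw [← mul_sub, abs_mul, abs_two]
    linarith
  · have h1 := hx.localTime_sub_succ (2 * j) (4 * k)
    have h2 := hx.localTime_sub_succ (2 * j + 1) (4 * k)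
    rw [show 2 * j + 1 + 1 = 2 * (j + 1) by ring] at h2
    -- Subtracting the crossing identities of the two adjacent edges cancels the site sum at the odd
    -- site. Halving then leaves an error 2.45ρ + 1 besides the error at the even sites.
    have h3 : |2 * (walkLocalTime (partialSum x) (4 * k) (2 * j + 1) : ℝ) -
        walkLocalTime (partialSum x) (4 * k) (2 * j) -
        walkLocalTime (partialSum x) (4 * k) (2 * (j + 1)) -
        (siteSum x (2 * j) (4 * k) - siteSum x (2 * (j + 1)) (4 * k))| ≤ 2 := by
      have h4 : |2 * (walkLocalTime (partialSum x) (4 * k) (2 * j + 1) : ℤ) -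
        walkLocalTime (partialSum x) (4 * k) (2 * j) -
        walkLocalTime (partialSum x) (4 * k) (2 * (j + 1)) -
        (siteSum x (2 * j) (4 * k) - siteSum x (2 * (j + 1)) (4 * k))| ≤ 2 := by
        rw [abs_le]
        split_ifs at h1 h2 <;> constructor <;> omega
      exact_mod_cast h4
    have h5 := abs_le.1 h3
    have h6 := abs_le.1 (heven j)
    have h7 := abs_le.1 (heven (j + 1))
    have h8 := abs_le.1 (hM (2 * j))
    have h9 := abs_le.1 (hM (2 * (j + 1)))
    rw [abs_le]
    constructor <;> linarith [h5.1, h5.2, h6.1, h6.2, h7.1, h7.2, h8.1, h8.2, h9.1, h9.2]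

end TwistShrink

namespace TwistShrink

/-! ### Interpolation on the triangulated grid -/

/-- Interpolation of grid values, affine on the two triangles of each cell. -/
noncomputable def gridInterp (g : ℕ → ℤ → ℝ) (s y : ℝ) : ℝ :=
  if s - ⌊s⌋₊ ≤ y - ⌊y⌋ then
    g ⌊s⌋₊ ⌊y⌋ + (s - ⌊s⌋₊) * (g (⌊s⌋₊ + 1) (⌊y⌋ + 1) - g ⌊s⌋₊ (⌊y⌋ + 1)) +
      (y - ⌊y⌋) * (g ⌊s⌋₊ (⌊y⌋ + 1) - g ⌊s⌋₊ ⌊y⌋)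
  else
    g ⌊s⌋₊ ⌊y⌋ + (s - ⌊s⌋₊) * (g (⌊s⌋₊ + 1) ⌊y⌋ - g ⌊s⌋₊ ⌊y⌋) +
      (y - ⌊y⌋) * (g (⌊s⌋₊ + 1) (⌊y⌋ + 1) - g (⌊s⌋₊ + 1) ⌊y⌋)

lemma approxLocalTime_eq (X : ℕ → ℕ → ℤ) (m : ℕ) (t : ℝ≥0) (x : ℝ) :
    approxLocalTime X m t x =
      gridInterp (fun k j => (walkLocalTime (twistedWalk X m) k j : ℝ)) (t * 2 ^ (2 * m))
        (x * 2 ^ m) / 2 ^ m := by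
  simp only [approxLocalTime, gridInterp, gridLocalTime]
  split_ifs <;> ring

/-- The interpolation on one closed cell. -/
noncomputable def cellInterp (g : ℕ → ℤ → ℝ) (k : ℕ) (j : ℤ) (s y : ℝ) : ℝ :=
  g k j + min (s - k) (y - j) * (g (k + 1) (j + 1) - g k j) +
    max (y - j - (s - k)) 0 * (g k (j + 1) - g k j) +
    max (s - k - (y - j)) 0 * (g (k + 1) j - g k j)

lemma gridInterp_eq_cellInterp_floor (g : ℕ → ℤ → ℝ) (s y : ℝ) :
    gridInterp g s y = cellInterp g ⌊s⌋₊ ⌊y⌋ s y := by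
  unfold gridInterp cellInterp
  split_ifs with h
  · rw [min_eq_left h, max_eq_left (by linarith), max_eq_right (by linarith)]; ring
  · rw [not_le] at h
    rw [min_eq_right h.le, max_eq_right (by linarith), max_eq_left (by linarith)]; ring

lemma cellInterp_right (g : ℕ → ℤ → ℝ) (k : ℕ) (j : ℤ) {y : ℝ} (h0 : j ≤ y) (h1 : y ≤ j + 1) :
    cellInterp g k j (k + 1) y = cellInterp g (k + 1) j (k + 1) y := by
  unfold cellInterp
  push_cast
  rw [min_eq_right (by linarith), max_eq_right (by linarith), max_eq_left (by linarith),
    min_eq_left (by linarith), max_eq_left (by linarith), max_eq_right (by linarith)]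
  ring

lemma cellInterp_top (g : ℕ → ℤ → ℝ) (k : ℕ) (j : ℤ) {s : ℝ} (h0 : k ≤ s) (h1 : s ≤ k + 1) :
    cellInterp g k j s (j + 1) = cellInterp g k (j + 1) s (j + 1) := by
  unfold cellInterp
  push_cast
  rw [min_eq_left (by linarith), max_eq_left (by linarith), max_eq_right (by linarith),
    min_eq_right (by linarith), max_eq_right (by linarith), max_eq_left (by linarith)]
  ring

/-- The floors select half-open cells, but neighbouring cells agree on their common edge. So one
formula, continuous through its minimum and maxima, serves each closed cell. -/
lemma gridInterp_eq_cellInterp (g : ℕ → ℤ → ℝ) {k : ℕ} {j : ℤ} {s y : ℝ} (hs0 : k ≤ s)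
    (hs1 : s ≤ k + 1) (hy0 : j ≤ y) (hy1 : y ≤ j + 1) :
    gridInterp g s y = cellInterp g k j s y := by
  rw [gridInterp_eq_cellInterp_floor]
  have hy : cellInterp g k j s y = cellInterp g k ⌊y⌋ s y := by
    rcases hy1.lt_or_eq with h | rfl
    · rw [Int.floor_eq_iff.2 ⟨hy0, h⟩]
    · rw [show ⌊(j : ℝ) + 1⌋ = j + 1 by simp, cellInterp_top g k j hs0 hs1]
  rw [hy]
  rcases hs1.lt_or_eq with h | rfl
  · rw [(Nat.floor_eq_iff (k.cast_nonneg.trans hs0)).2 ⟨hs0, h⟩]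
  · rw [show ⌊(k : ℝ) + 1⌋₊ = k + 1 by exact_mod_cast Nat.floor_natCast (R := ℝ) (k + 1),
      cellInterp_right g k ⌊y⌋ (Int.floor_le y) (Int.lt_floor_add_one y).le]

/-- The closed cells form a locally finite cover, and the interpolation is continuous on each of
them. -/
lemma continuous_gridInterp (g : ℕ → ℤ → ℝ) :
    Continuous (fun p : ℝ≥0 × ℝ => gridInterp g p.1 p.2) := by
  set f : ℕ × ℤ → Set (ℝ≥0 × ℝ) := fun i =>
    {p | (i.1 : ℝ) ≤ p.1 ∧ (p.1 : ℝ) ≤ i.1 + 1 ∧ (i.2 : ℝ) ≤ p.2 ∧ p.2 ≤ i.2 + 1} with hf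
  have hlf : LocallyFinite f := by
    rintro ⟨t, x⟩
    refine ⟨{p | (p.1 : ℝ) < t + 1 ∧ x - 1 < p.2 ∧ p.2 < x + 1}, IsOpen.mem_nhds ?_ ?_, ?_⟩
    · have h1 : IsOpen {p : ℝ≥0 × ℝ | (p.1 : ℝ) < t + 1} := isOpen_lt (by fun_prop) (by fun_prop)
      have h2 : IsOpen {p : ℝ≥0 × ℝ | x - 1 < p.2} := isOpen_lt (by fun_prop) (by fun_prop)
      have h3 : IsOpen {p : ℝ≥0 × ℝ | p.2 < x + 1} := isOpen_lt (by fun_prop) (by fun_prop)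
      exact h1.inter (h2.inter h3)
    · simp
    · refine ((Set.finite_Iic ⌈(t : ℝ) + 1⌉₊).prod (Set.finite_Icc ⌊x - 2⌋ ⌈x + 1⌉)).subset ?_
      rintro ⟨k, j⟩ ⟨p, ⟨h1, h2, h3, h4⟩, h5, h6, h7⟩
      simp only at h1 h2 h3 h4
      refine ⟨?_, ?_, ?_⟩
      · exact_mod_cast (h1.trans h5.le).trans (Nat.le_ceil _)
      · have : ((⌊x - 2⌋ : ℤ) : ℝ) ≤ j := (Int.floor_le _).trans (by linarith)
        exact_mod_cast this
      · have : (j : ℝ) ≤ (⌈x + 1⌉ : ℤ) := le_trans (by linarith) (Int.le_ceil _)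
        exact_mod_cast this
  refine hlf.continuous ?_ (fun i => ?_) fun i => ?_
  · refine Set.eq_univ_of_forall fun p => Set.mem_iUnion.2 ⟨(⌊(p.1 : ℝ)⌋₊, ⌊p.2⌋), ?_⟩
    exact ⟨Nat.floor_le p.1.2, (Nat.lt_floor_add_one _).le, Int.floor_le _,
      (Int.lt_floor_add_one _).le⟩
  · have h1 : IsClosed {p : ℝ≥0 × ℝ | (i.1 : ℝ) ≤ p.1} := isClosed_le (by fun_prop) (by fun_prop)
    have h2 : IsClosed {p : ℝ≥0 × ℝ | (p.1 : ℝ) ≤ i.1 + 1} :=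
      isClosed_le (by fun_prop) (by fun_prop)
    have h3 : IsClosed {p : ℝ≥0 × ℝ | (i.2 : ℝ) ≤ p.2} := isClosed_le (by fun_prop) (by fun_prop)
    have h4 : IsClosed {p : ℝ≥0 × ℝ | p.2 ≤ (i.2 : ℝ) + 1} :=
      isClosed_le (by fun_prop) (by fun_prop)
    exact h1.inter (h2.inter (h3.inter h4))
  · refine ContinuousOn.congr (f := fun p : ℝ≥0 × ℝ => cellInterp g i.1 i.2 p.1 p.2) ?_
      fun p hp => gridInterp_eq_cellInterp g hp.1 hp.2.1 hp.2.2.1 hp.2.2.2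
    unfold cellInterp
    fun_prop

lemma continuous_approxLocalTime (X : ℕ → ℕ → ℤ) (m : ℕ) :
    Continuous (fun p : ℝ≥0 × ℝ => approxLocalTime X m p.1 p.2) := by
  have h1 : Continuous (fun p : ℝ≥0 × ℝ => (p.1 * 2 ^ (2 * m), p.2 * (2 : ℝ) ^ m)) := by fun_prop
  have h2 := (continuous_gridInterp
    (fun k j => (walkLocalTime (twistedWalk X m) k j : ℝ))).comp h1
  simp only [approxLocalTime_eq]
  exact (by simpa [Function.comp_def] using h2 : Continuous _).div_const _

lemma gridInterp_of_const (f : ℕ → ℝ) (s y : ℝ) :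
    gridInterp (fun k _ => f k) s y = linInterp f s := by
  unfold gridInterp linInterp
  split_ifs <;> ring

lemma continuous_approxWalk (X : ℕ → ℕ → ℤ) (m : ℕ) : Continuous (approxWalk X m) := by
  have h1 : Continuous (fun t : ℝ≥0 => (t * 2 ^ (2 * m), (0 : ℝ))) := by fun_prop
  have h2 := (continuous_gridInterp (fun k _ => (twistedWalk X m k : ℝ))).comp h1
  simp only [Function.comp_def, gridInterp_of_const] at h2
  unfold approxWalk
  exact (by simpa using h2 : Continuous _).div_const _

/-- Up to the growth of the grid values over one time step, the interpolation is the linear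
interpolation in space. -/
lemma gridInterp_bounds {g : ℕ → ℤ → ℝ} (h0 : ∀ k j, g k j ≤ g (k + 1) j)
    (h1 : ∀ k j, g (k + 1) j ≤ g k j + 1) {s : ℝ} (hs : 0 ≤ s) (y : ℝ) :
    (1 - (y - ⌊y⌋)) * g ⌊s⌋₊ ⌊y⌋ + (y - ⌊y⌋) * g ⌊s⌋₊ (⌊y⌋ + 1) ≤ gridInterp g s y ∧
      gridInterp g s y ≤
        (1 - (y - ⌊y⌋)) * g ⌊s⌋₊ ⌊y⌋ + (y - ⌊y⌋) * g ⌊s⌋₊ (⌊y⌋ + 1) + 1 := by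
  have hu0 : 0 ≤ s - ⌊s⌋₊ := sub_nonneg.2 (Nat.floor_le hs)
  have hu1 : s - ⌊s⌋₊ ≤ 1 := by linarith [Nat.lt_floor_add_one s]
  have hv0 : 0 ≤ y - ⌊y⌋ := sub_nonneg.2 (Int.floor_le y)
  have hv1 : y - ⌊y⌋ ≤ 1 := by linarith [Int.lt_floor_add_one y]
  unfold gridInterp
  generalize s - ⌊s⌋₊ = u at *
  generalize y - ⌊y⌋ = v at *
  have a0 := h0 ⌊s⌋₊ ⌊y⌋
  have a1 := h1 ⌊s⌋₊ ⌊y⌋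
  have b0 := h0 ⌊s⌋₊ (⌊y⌋ + 1)
  have b1 := h1 ⌊s⌋₊ (⌊y⌋ + 1)
  split_ifs with h
  · constructor <;> nlinarith
  · constructor <;> nlinarith

lemma walkLocalTime_le_succ (S : ℕ → ℤ) (k : ℕ) (z : ℤ) :
    (walkLocalTime S (k + 1) z : ℝ) ≤ walkLocalTime S k z + 1 := by
  rw [walkLocalTime_succ]; split_ifs <;> push_cast <;> linarith

/-- Comparison of the interpolated local times of two consecutive levels. -/
lemma gridInterp_level {S S' : ℕ → ℤ} {s : ℝ} (hs : 0 ≤ s) (y : ℝ) {B : ℝ}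
    (heven : ∀ j, |(walkLocalTime S (4 * ⌊s⌋₊) (2 * j) : ℝ) - 2 * walkLocalTime S' ⌊s⌋₊ j| ≤ B)
    (hodd : ∀ j, |(walkLocalTime S (4 * ⌊s⌋₊) (2 * j + 1) : ℝ) -
      (walkLocalTime S' ⌊s⌋₊ j + walkLocalTime S' ⌊s⌋₊ (j + 1))| ≤ B) :
    |gridInterp (fun k j => (walkLocalTime S k j : ℝ)) (4 * s) (2 * y) -
      2 * gridInterp (fun k j => (walkLocalTime S' k j : ℝ)) s y| ≤ B + 4 := by
  have hmono : ∀ S : ℕ → ℤ, ∀ k z, (walkLocalTime S k z : ℝ) ≤ walkLocalTime S (k + 1) z :=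
    fun S k z => by exact_mod_cast walkLocalTime_mono S z k.le_succ
  have hfine := gridInterp_bounds (hmono S) (walkLocalTime_le_succ S) (s := 4 * s) (by positivity)
    (2 * y)
  have hcoarse := gridInterp_bounds (hmono S') (walkLocalTime_le_succ S') hs y
  have hk : ∃ d : ℕ, d ≤ 3 ∧ ⌊4 * s⌋₊ = 4 * ⌊s⌋₊ + d := by
    have h1 : 4 * ⌊s⌋₊ ≤ ⌊4 * s⌋₊ := Nat.le_floor (by
      push_cast; linarith [Nat.floor_le hs])
    have h2 : ⌊4 * s⌋₊ < 4 * ⌊s⌋₊ + 4 := (Nat.floor_lt (by positivity)).2 (by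
      push_cast; linarith [Nat.lt_floor_add_one s])
    exact ⟨⌊4 * s⌋₊ - 4 * ⌊s⌋₊, by omega, by omega⟩
  obtain ⟨d, hd, hk⟩ := hk
  rw [hk] at hfine
  have hd0 : ∀ z, (walkLocalTime S (4 * ⌊s⌋₊) z : ℝ) ≤ walkLocalTime S (4 * ⌊s⌋₊ + d) z :=
    fun z => by exact_mod_cast walkLocalTime_mono S z (Nat.le_add_right _ d)
  -- At most three extra visits, and one from the interpolation in time, make up the 4 of the bound;
  -- the coarse level contributes at most 2 in the other direction.
  have hd1 : ∀ z, (walkLocalTime S (4 * ⌊s⌋₊ + d) z : ℝ) ≤ walkLocalTime S (4 * ⌊s⌋₊) z + 3 := by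
    intro z
    have h : ∀ d : ℕ, (walkLocalTime S (4 * ⌊s⌋₊ + d) z : ℝ) ≤ walkLocalTime S (4 * ⌊s⌋₊) z + d := by
      intro d
      induction d with
      | zero => simp
      | succ d ih =>
        have := walkLocalTime_le_succ S (4 * ⌊s⌋₊ + d) z
        push_cast; rw [← add_assoc]; linarith
    have : (d : ℝ) ≤ 3 := by exact_mod_cast hd
    linarith [h d]
  set j := ⌊y⌋ with hj
  have hv0 : 0 ≤ y - j := sub_nonneg.2 (Int.floor_le y)
  have hv1 : y - j < 1 := by linarith [Int.lt_floor_add_one y]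
  have e0 := abs_le.1 (heven j)
  have e1 := abs_le.1 (heven (j + 1))
  have o := abs_le.1 (hodd j)
  -- A coarse spatial cell splits into two fine cells. The value expected at the odd site is twice
  -- the coarse interpolation at the midpoint, so linear interpolation in space commutes with
  -- refinement.
  rcases lt_or_ge (y - j) (1 / 2) with hv | hv
  · have hfl : ⌊2 * y⌋ = 2 * j := Int.floor_eq_iff.2 ⟨by push_cast; linarith, by push_cast; linarith⟩
    rw [hfl] at hfine
    push_cast at hfine
    rw [show 2 * y - 2 * (j : ℝ) = 2 * (y - j) by ring] at hfine
    have a0 := hd0 (2 * j)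
    have a1 := hd1 (2 * j)
    have b0 := hd0 (2 * j + 1)
    have b1 := hd1 (2 * j + 1)
    generalize y - (j : ℝ) = v at *
    rw [abs_le]
    constructor <;> nlinarith
  · have hfl : ⌊2 * y⌋ = 2 * j + 1 :=
      Int.floor_eq_iff.2 ⟨by push_cast; linarith, by push_cast; linarith⟩
    rw [hfl, show 2 * j + 1 + 1 = 2 * (j + 1) by ring] at hfine
    push_cast at hfine
    rw [show 2 * y - (2 * (j : ℝ) + 1) = 2 * (y - j) - 1 by ring] at hfine
    have a0 := hd0 (2 * j + 1)
    have a1 := hd1 (2 * j + 1)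
    have b0 := hd0 (2 * (j + 1))
    have b1 := hd1 (2 * (j + 1))
    generalize y - (j : ℝ) = v at *
    rw [abs_le]
    constructor <;> nlinarith

lemma IsSign.abs_partialSum_add_sub_le {x : ℕ → ℤ} (hx : IsSign x) (a d : ℕ) :
    |(partialSum x (a + d) : ℝ) - partialSum x a| ≤ d := by
  induction d with
  | zero => simp
  | succ d ih =>
    rw [← add_assoc, partialSum_succ]
    have h := abs_le.1 ih
    rcases hx (a + d + 1) (by omega) with h' | h' <;> rw [h', abs_le] <;> push_cast <;>
      constructor <;> linarith [h.1, h.2]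

lemma IsSign.abs_linInterp_sub_le {x : ℕ → ℤ} (hx : IsSign x) {s : ℝ} (hs : 0 ≤ s) :
    |linInterp (fun n => (partialSum x n : ℝ)) s - partialSum x ⌊s⌋₊| ≤ 1 := by
  have hu0 : 0 ≤ s - ⌊s⌋₊ := sub_nonneg.2 (Nat.floor_le hs)
  have hu1 : s - ⌊s⌋₊ ≤ 1 := by linarith [Nat.lt_floor_add_one s]
  have h := hx.abs_partialSum_add_sub_le ⌊s⌋₊ 1
  rw [Nat.cast_one] at h
  rw [linInterp, add_sub_cancel_left, abs_mul, abs_of_nonneg hu0]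
  exact mul_le_one₀ hu1 (abs_nonneg _) h

/-- Comparison of the interpolated walks of two consecutive levels. -/
lemma linInterp_level {x y : ℕ → ℤ} (hx : IsSign x) (hy : IsSign y) {s : ℝ} (hs : 0 ≤ s) {B : ℝ}
    (h : |(partialSum x (4 * ⌊s⌋₊) : ℝ) - 2 * partialSum y ⌊s⌋₊| ≤ B) :
    |linInterp (fun n => (partialSum x n : ℝ)) (4 * s) -
      2 * linInterp (fun n => (partialSum y n : ℝ)) s| ≤ B + 6 := by
  obtain ⟨d, hd, hk⟩ : ∃ d : ℕ, d ≤ 3 ∧ ⌊4 * s⌋₊ = 4 * ⌊s⌋₊ + d := by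
    have h1 : 4 * ⌊s⌋₊ ≤ ⌊4 * s⌋₊ := Nat.le_floor (by
      push_cast; linarith [Nat.floor_le hs])
    have h2 : ⌊4 * s⌋₊ < 4 * ⌊s⌋₊ + 4 := (Nat.floor_lt (by positivity)).2 (by
      push_cast; linarith [Nat.lt_floor_add_one s])
    exact ⟨⌊4 * s⌋₊ - 4 * ⌊s⌋₊, by omega, by omega⟩
  have h1 := abs_le.1 (hx.abs_linInterp_sub_le (s := 4 * s) (by positivity))
  rw [hk] at h1
  have h2 := abs_le.1 (hx.abs_partialSum_add_sub_le (4 * ⌊s⌋₊) d)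
  have h3 := abs_le.1 (hy.abs_linInterp_sub_le hs)
  have h4 : (d : ℝ) ≤ 3 := by exact_mod_cast hd
  have h5 := abs_le.1 h
  rw [abs_le]
  constructor <;> linarith [h1.1, h1.2, h2.1, h2.2, h3.1, h3.2, h5.1, h5.2]

end TwistShrink

/-! ### Size of the errors, summation over the levels, probability of failure -/

namespace TwistShrink

lemma rpow_quarter_pow {a : ℝ} (ha : 0 ≤ a) : (a ^ (1 / 4 : ℝ)) ^ 4 = a := by
  rw [← Real.rpow_natCast, ← Real.rpow_mul ha]; norm_num

lemma rpow_three_quarters_pow {a : ℝ} (ha : 0 ≤ a) : (a ^ (3 / 4 : ℝ)) ^ 4 = a ^ 3 := by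
  rw [← Real.rpow_natCast, ← Real.rpow_mul ha]; norm_num

/-- The order of magnitude of the fluctuations after `n` steps. -/
noncomputable def fluct (n : ℝ) : ℝ := n ^ (1 / 4 : ℝ) * Real.log n ^ (3 / 4 : ℝ)

lemma fluct_nonneg {n : ℝ} (hn : 1 ≤ n) : 0 ≤ fluct n := by
  have := Real.log_nonneg hn
  unfold fluct; positivity

lemma fluct_pow {n : ℝ} (hn : 1 ≤ n) : fluct n ^ 4 = n * Real.log n ^ 3 := by
  rw [fluct, mul_pow, rpow_quarter_pow (by linarith), rpow_three_quarters_pow (Real.log_nonneg hn)]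

/-- The number of steps `n` is so large that the asymptotic estimates hold. -/
structure LargeSteps (C n : ℝ) : Prop where
  one_le : 1 ≤ n
  log_ge : 60 ≤ Real.log n
  log_le : 3 * C * Real.log (4 * n) ≤ n / 4
  tail : 270 * n ^ (2 - 2 * C) ≤ 1

lemma eventually_largeSteps {C : ℝ} (hC : 1 < C) : ∀ᶠ n in atTop, LargeSteps C n := by
  have h1 : ∀ᶠ n : ℝ in atTop, 60 ≤ Real.log n := Real.tendsto_log_atTop.eventually_ge_atTop 60
  have h2 : ∀ᶠ n : ℝ in atTop, 3 * C * Real.log (4 * n) ≤ n / 4 := by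
    have h := (Real.isLittleO_log_id_atTop.def (c := 1 / (48 * C)) (by positivity))
    have h4 : Tendsto (fun n : ℝ => 4 * n) atTop atTop := tendsto_id.const_mul_atTop (by norm_num)
    filter_upwards [h4.eventually h, eventually_ge_atTop 1] with n hn hn1
    rw [Real.norm_of_nonneg (Real.log_nonneg (by linarith)), id, Real.norm_of_nonneg (by linarith)]
      at hn
    calc 3 * C * Real.log (4 * n) ≤ 3 * C * (1 / (48 * C) * (4 * n)) := by gcongr
      _ = n / 4 := by field_simp; ring
  have h3 : ∀ᶠ n : ℝ in atTop, 270 * n ^ (2 - 2 * C) ≤ 1 := by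
    have h := (tendsto_rpow_neg_atTop (y := 2 * C - 2) (by linarith)).const_mul 270
    rw [mul_zero] at h
    filter_upwards [h.eventually_le_const one_pos] with n hn
    rwa [show 2 - 2 * C = -(2 * C - 2) by ring]
  filter_upwards [h1, h2, h3, eventually_ge_atTop 1] with n a b c d using ⟨d, a, b, c⟩

lemma log_four_mul_le {n : ℝ} (h1 : 1 ≤ n) (h : 60 ≤ Real.log n) :
    Real.log (4 * n) ≤ 1.024 * Real.log n := by
  rw [Real.log_mul (by norm_num) (by linarith), show (4 : ℝ) = 2 ^ 2 by norm_num, Real.log_pow]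
  have := Real.log_two_lt_d9
  push_cast; linarith

/-- One more level quadruples the steps and halves the spatial unit, so the factor 1.5 makes the
rescaled errors geometric with ratio 3/4. It suffices that 4·1.024³ ≤ 1.5⁴. -/
lemma fluct_four_mul_le {n : ℝ} (h1 : 1 ≤ n) (h : 60 ≤ Real.log n) :
    fluct (4 * n) ≤ 1.5 * fluct n := by
  have h0 := fluct_nonneg h1
  refine le_of_pow_le_pow_left₀ (n := 4) (by norm_num) (by positivity) ?_
  rw [mul_pow, fluct_pow h1, fluct_pow (by linarith)]
  have h2 : Real.log (4 * n) ^ 3 ≤ (1.024 * Real.log n) ^ 3 :=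
    pow_le_pow_left₀ (Real.log_nonneg (by linarith)) (log_four_mul_le h1 h) 3
  have h3 : 0 ≤ n * Real.log n ^ 3 := by positivity
  calc 4 * n * Real.log (4 * n) ^ 3 ≤ 4 * n * (1.024 * Real.log n) ^ 3 := by gcongr
    _ = 4 * 1.024 ^ 3 * (n * Real.log n ^ 3) := by ring
    _ ≤ 1.5 ^ 4 * (n * Real.log n ^ 3) := by gcongr; norm_num

lemma Good.mono {x : ℕ → ℤ} {H : ℕ} {Λ Λ' : ℝ} (h : Λ ≤ Λ') (hG : Good x H Λ) : Good x H Λ' := by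
  intro f a b ha hb
  have h0 : (0 : ℝ) ≤ quadVar (testCoeff f a) x b := by exact_mod_cast quadVar_nonneg _ _ _
  exact (hG f a b ha hb).trans (by gcongr)

/-- The comparison of two consecutive levels in terms of the number of steps. -/
lemma level_bound {x y : ℕ → ℤ} (hx : IsSign x) (hy : IsSign y) (h : Refines x y) {C n : ℝ}
    (hC : 1 < C) (hn : LargeSteps C n)
    (hGx : Good x ⌊2 * (4 * n)⌋₊ (3 * C * Real.log (4 * n)))
    (hGy : Good y ⌊2 * n⌋₊ (3 * C * Real.log n)) {s : ℝ} (hs : 0 ≤ s) (hsn : s ≤ n) :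
    |linInterp (fun n => (partialSum x n : ℝ)) (4 * s) -
      2 * linInterp (fun n => (partialSum y n : ℝ)) s| ≤ 18.72 * C * fluct n ∧
    ∀ z, |gridInterp (fun k j => (walkLocalTime (partialSum x) k j : ℝ)) (4 * s) (2 * z) -
      2 * gridInterp (fun k j => (walkLocalTime (partialSum y) k j : ℝ)) s z| ≤
        18.72 * C * fluct n := by
  obtain ⟨h1, hlog, hle, -⟩ := hn
  set Λ := 3 * C * Real.log (4 * n) with hΛ
  have hlog4 : Real.log n ≤ Real.log (4 * n) := Real.log_le_log (by linarith) (by linarith)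
  have hΛ180 : 180 ≤ Λ := by rw [hΛ]; nlinarith
  have hn720 : 720 ≤ n := by linarith
  set q := √(n * Λ) with hq
  have hq2 : q ^ 2 = n * Λ := Real.sq_sqrt (by positivity)
  have hq0 : 0 ≤ q := Real.sqrt_nonneg _
  have hq6 : 180 ≤ q := by
    refine le_of_pow_le_pow_left₀ (n := 2) (by norm_num) hq0 ?_
    rw [hq2]; nlinarith
  -- This is what the condition Λ ≤ n/4 is for: the matched pairs then stay within the horizon 2n.
  have hqn : q ≤ n / 2 := by
    refine le_of_pow_le_pow_left₀ (n := 2) (by norm_num) (by linarith) ?_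
    rw [hq2]; nlinarith
  set ρ := √(q * Λ) with hρ
  have hρ2 : ρ ^ 2 = q * Λ := Real.sq_sqrt (by positivity)
  have hρ0 : 0 ≤ ρ := Real.sqrt_nonneg _
  -- The additive constants total 7 ≤ ρ/4, so 7.75ρ + 7 ≤ 8ρ, and 8·2.34 = 18.72.
  have hρ28 : 28 ≤ ρ := by
    refine le_of_pow_le_pow_left₀ (n := 2) (by norm_num) hρ0 ?_
    rw [hρ2]; nlinarith
  have hfl := fluct_nonneg h1
  have hρf : ρ ≤ 2.34 * C * fluct n := by
    refine le_of_pow_le_pow_left₀ (n := 4) (by norm_num) (by positivity) ?_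
    -- Fourth powers reduce the bound on ρ to 3.1³ ≤ 2.34⁴ and C³ ≤ C⁴; the latter makes the error
    -- linear in C.
    have hΛle : Λ ≤ 3.1 * C * Real.log n := by
      have := log_four_mul_le h1 hlog
      calc Λ ≤ 3 * C * (1.024 * Real.log n) := by rw [hΛ]; gcongr
        _ ≤ 3.1 * C * Real.log n := by
          have : 0 ≤ C * Real.log n := by positivity
          nlinarith
    calc ρ ^ 4 = n * Λ ^ 3 := by
          rw [show ρ ^ 4 = (ρ ^ 2) ^ 2 by ring, hρ2, mul_pow, hq2]; ring
      _ ≤ n * (3.1 * C * Real.log n) ^ 3 := by gcongr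
      _ = 3.1 ^ 3 * C ^ 3 * (n * Real.log n ^ 3) := by ring
      _ ≤ 2.34 ^ 4 * C ^ 4 * (n * Real.log n ^ 3) := by
          gcongr ?_ * ?_ * _
          · norm_num
          · exact pow_le_pow_right₀ hC.le (by norm_num)
      _ = (2.34 * C * fluct n) ^ 4 := by rw [← fluct_pow h1]; ring
  have hk : (⌊s⌋₊ : ℝ) ≤ n := (Nat.floor_le hs).trans hsn
  have h2n : 2 * n - 1 ≤ ⌊2 * n⌋₊ := by linarith [Nat.lt_floor_add_one (2 * n)]
  obtain ⟨e1, e2, e3⟩ := level_estimate hx hy h (by linarith) hGx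
    (hGy.mono (Λ' := Λ) (by rw [hΛ]; gcongr)) (by linarith) hq2 hρ0 hρ2 hk
    (Nat.le_floor (by push_cast; linarith)) (by linarith)
  constructor
  · exact (linInterp_level hx hy hs e1).trans (by linarith)
  · exact fun z => (gridInterp_level hs z e2 e3).trans (by linarith)

/-- All levels from `m` on are good for the time horizon `K`. -/
def LevelsGood (x : ℕ → ℕ → ℤ) (C K : ℝ) (m : ℕ) : Prop :=
  ∀ j, m ≤ j → Good (x j) ⌊2 * (K * 2 ^ (2 * j))⌋₊ (3 * C * Real.log (K * 2 ^ (2 * j)))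

/-- All step numbers from `n` on are large. -/
def LargeFrom (C n : ℝ) : Prop := ∀ n', n ≤ n' → LargeSteps C n'

lemma LargeFrom.le_mul {C K : ℝ} {m j : ℕ} (hK : 0 ≤ K) (hmj : m ≤ j)
    (h : LargeFrom C (K * 2 ^ (2 * m))) : LargeFrom C (K * 2 ^ (2 * j)) := fun n' hn' =>
  h n' (le_trans (by gcongr; norm_num) hn')

lemma fluct_level_le {C K : ℝ} {m : ℕ} (hK : 0 ≤ K) (h : LargeFrom C (K * 2 ^ (2 * m))) (i : ℕ) :
    fluct (K * 2 ^ (2 * (m + i))) / 2 ^ (m + i) ≤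
      fluct (K * 2 ^ (2 * m)) / 2 ^ m * (3 / 4) ^ i := by
  induction i with
  | zero => simp
  | succ i ih =>
    have hl := (h.le_mul hK (Nat.le_add_right m i)) _ le_rfl
    have h1 := fluct_four_mul_le hl.one_le hl.log_ge
    rw [show K * 2 ^ (2 * (m + (i + 1))) = 4 * (K * 2 ^ (2 * (m + i))) by ring]
    calc fluct (4 * (K * 2 ^ (2 * (m + i)))) / 2 ^ (m + (i + 1))
        ≤ 1.5 * fluct (K * 2 ^ (2 * (m + i))) / 2 ^ (m + (i + 1)) := by gcongr
      _ = fluct (K * 2 ^ (2 * (m + i))) / 2 ^ (m + i) * (3 / 4) := by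
        rw [← add_assoc, pow_succ (2 : ℝ) (m + i)]; field_simp; norm_num; ring
      _ ≤ fluct (K * 2 ^ (2 * m)) / 2 ^ m * (3 / 4) ^ i * (3 / 4) := by gcongr
      _ = _ := by ring

/-- On the good event, consecutive levels differ by the terms of a geometric series. -/
lemma LevelsGood.step_le {X : ℕ → ℕ → ℤ} {x : ℕ → ℕ → ℤ} {C K : ℝ} {m : ℕ} (hC : 1 < C)
    (hK : 0 ≤ K) (hx : ∀ m, IsSign (x m) ∧ Refines (x (m + 1)) (x m) ∧
      twistedWalk X m = partialSum (x m))
    (hG : LevelsGood x C K m) (hL : LargeFrom C (K * 2 ^ (2 * m))) {t : ℝ≥0} (ht : (t : ℝ) ≤ K)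
    (i : ℕ) :
    |approxWalk X (m + i + 1) t - approxWalk X (m + i) t| ≤
      9.36 * C * (fluct (K * 2 ^ (2 * m)) / 2 ^ m) * (3 / 4) ^ i ∧
    ∀ z, |approxLocalTime X (m + i + 1) t z - approxLocalTime X (m + i) t z| ≤
      9.36 * C * (fluct (K * 2 ^ (2 * m)) / 2 ^ m) * (3 / 4) ^ i := by
  set j := m + i with hj
  have hlarge := hL.le_mul hK (Nat.le_add_right m i) _ le_rfl
  rw [← hj] at hlarge
  have hGy := hG j (Nat.le_add_right m i)
  have hGx := hG (j + 1) (by omega)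
  rw [show K * 2 ^ (2 * (j + 1)) = 4 * (K * 2 ^ (2 * j)) by ring] at hGx
  obtain ⟨b1, b2⟩ := level_bound (hx (j + 1)).1 (hx j).1 (hx j).2.1 hC hlarge hGx hGy
    (s := t * 2 ^ (2 * j)) (by positivity) (by gcongr)
  have hfl := fluct_level_le hK hL i
  rw [← hj] at hfl
  have hpow : (2 : ℝ) ^ (j + 1) = 2 * 2 ^ j := by ring
  have hfin : 18.72 * C * fluct (K * 2 ^ (2 * j)) / 2 ^ (j + 1) ≤
      9.36 * C * (fluct (K * 2 ^ (2 * m)) / 2 ^ m) * (3 / 4) ^ i := by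
    calc 18.72 * C * fluct (K * 2 ^ (2 * j)) / 2 ^ (j + 1)
        = 9.36 * C * (fluct (K * 2 ^ (2 * j)) / 2 ^ j) := by rw [hpow]; field_simp; norm_num; ring
      _ ≤ 9.36 * C * (fluct (K * 2 ^ (2 * m)) / 2 ^ m * (3 / 4) ^ i) := by gcongr
      _ = _ := by ring
  have hgen : ∀ a b : ℝ, |a - 2 * b| ≤ 18.72 * C * fluct (K * 2 ^ (2 * j)) →
      |a / 2 ^ (j + 1) - b / 2 ^ j| ≤
        9.36 * C * (fluct (K * 2 ^ (2 * m)) / 2 ^ m) * (3 / 4) ^ i := by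
    intro a b hab
    refine le_trans ?_ hfin
    rw [show a / 2 ^ (j + 1) - b / 2 ^ j = (a - 2 * b) / 2 ^ (j + 1) by rw [hpow]; field_simp,
      abs_div, abs_of_pos (by positivity : (0 : ℝ) < 2 ^ (j + 1))]
    gcongr
  constructor
  · unfold approxWalk
    rw [(hx (j + 1)).2.2, (hx j).2.2]
    rw [show (t : ℝ) * 2 ^ (2 * (j + 1)) = 4 * (t * 2 ^ (2 * j)) by ring]
    exact hgen _ _ b1
  · intro z
    rw [approxLocalTime_eq, approxLocalTime_eq, (hx (j + 1)).2.2, (hx j).2.2,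
      show (t : ℝ) * 2 ^ (2 * (j + 1)) = 4 * (t * 2 ^ (2 * j)) by ring,
      show z * 2 ^ (j + 1) = 2 * (z * 2 ^ j) by ring]
    exact hgen _ _ (b2 _)

/-- The error in terms of `K` and `m`. -/
lemma fluct_div_le {K : ℝ} (hK : 0 < K) {m : ℕ} (hm : 1 ≤ m) (h1 : 1 ≤ K * 2 ^ (2 * m)) :
    fluct (K * 2 ^ (2 * m)) / 2 ^ m ≤ 1.93 * ((max 1 K) ^ (1 / 4 : ℝ) *
      logStar K ^ (3 / 4 : ℝ) * (m : ℝ) ^ (3 / 4 : ℝ) * (2 : ℝ) ^ (-(m : ℝ) / 2)) := by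
  have hls : 1 ≤ logStar K := le_max_left _ _
  have hm1 : (1 : ℝ) ≤ m := by exact_mod_cast hm
  have hK1 : 0 ≤ max 1 K := by positivity
  refine le_of_pow_le_pow_left₀ (n := 4) (by norm_num) (by positivity) ?_
  have h2 : ((2 : ℝ) ^ (-(m : ℝ) / 2)) ^ 4 = 1 / 2 ^ (2 * m) := by
    rw [← Real.rpow_natCast, ← Real.rpow_mul (by norm_num),
      show -(m : ℝ) / 2 * (4 : ℕ) = -((2 * m : ℕ) : ℝ) by push_cast; ring,
      Real.rpow_neg (by norm_num), Real.rpow_natCast, one_div]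
  rw [div_pow, fluct_pow h1]
  simp only [mul_pow]
  rw [rpow_quarter_pow hK1, rpow_three_quarters_pow (by linarith),
    rpow_three_quarters_pow (by linarith), h2]
  -- The constant exceeds 1 + 2 log 2, and 2.39³ ≤ 1.93⁴.
  have hlog : Real.log (K * 2 ^ (2 * m)) ≤ 2.39 * (logStar K * m) := by
    rw [Real.log_mul hK.ne' (by positivity), Real.log_pow]
    have h3 := Real.log_two_lt_d9
    have h4 : Real.log K ≤ logStar K := le_max_right _ _
    have h5 : logStar K ≤ logStar K * m := le_mul_of_one_le_right (by linarith) hm1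
    have h6 : (m : ℝ) ≤ logStar K * m := le_mul_of_one_le_left (by linarith) hls
    push_cast
    nlinarith
  have h0 := Real.log_nonneg h1
  calc K * 2 ^ (2 * m) * Real.log (K * 2 ^ (2 * m)) ^ 3 / (2 ^ m) ^ 4
      = K * Real.log (K * 2 ^ (2 * m)) ^ 3 * (1 / 2 ^ (2 * m)) := by
        field_simp; ring
    _ ≤ max 1 K * (2.39 * (logStar K * m)) ^ 3 * (1 / 2 ^ (2 * m)) := by
        gcongr; exact le_max_right _ _
    _ = 2.39 ^ 3 * (max 1 K * logStar K ^ 3 * m ^ 3 * (1 / 2 ^ (2 * m))) := by ring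
    _ ≤ 1.93 ^ 4 * (max 1 K * logStar K ^ 3 * m ^ 3 * (1 / 2 ^ (2 * m))) := by
        gcongr; norm_num
    _ = _ := by ring

variable {Ω : Type*} {mΩ : MeasurableSpace Ω} {P : Measure Ω}

/-- The union bound is at most 10(3n)³n^{-3C} = 270 n^{2-2C}·n^{1-C}, and for large n the first
factor is at most 1. -/
lemma prob_level_not_good_le [IsProbabilityMeasure P] {F : ℕ → MeasurableSpace Ω}
    {Y : ℕ → Ω → ℤ} (h : FairSigns P F Y) {C n : ℝ} (hC : 1 < C) (hn : LargeSteps C n) :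
    P {ω | ¬ Good (fun k => Y k ω) ⌊2 * n⌋₊ (3 * C * Real.log n)} ≤
      ENNReal.ofReal (n ^ (1 - C)) := by
  obtain ⟨h1, hlog, -, htail⟩ := hn
  have hn0 : 0 < n := by linarith
  refine (h.prob_not_good_le (by positivity) _).trans (ENNReal.ofReal_le_ofReal ?_)
  have h2 : (⌊2 * n⌋₊ : ℝ) + 1 ≤ 3 * n := by linarith [Nat.floor_le (by linarith : 0 ≤ 2 * n)]
  have h3 : Real.exp (-(3 * C * Real.log n)) = n ^ (-(3 * C)) := by
    rw [Real.rpow_def_of_pos hn0]; congr 1; ring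
  calc 10 * ((⌊2 * n⌋₊ : ℝ) + 1) ^ 3 * Real.exp (-(3 * C * Real.log n))
      ≤ 10 * (3 * n) ^ 3 * n ^ (-(3 * C)) := by rw [h3]; gcongr
    _ = 270 * (n ^ (3 : ℝ) * n ^ (-(3 * C))) := by norm_cast; ring
    _ = 270 * n ^ (2 - 2 * C) * n ^ (1 - C) := by
        rw [← Real.rpow_add hn0, mul_assoc, ← Real.rpow_add hn0]; congr 2; ring
    _ ≤ 1 * n ^ (1 - C) := by gcongr
    _ = _ := one_mul _

lemma prob_not_levelsGood_le [IsProbabilityMeasure P] {F : ℕ → ℕ → MeasurableSpace Ω}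
    {Y : ℕ → ℕ → Ω → ℤ} (h : ∀ m, FairSigns P (F m) (Y m)) {C K : ℝ} {m : ℕ} (hC : 1 < C)
    (hK : 0 < K) (hL : LargeFrom C (K * 2 ^ (2 * m))) :
    P {ω | ¬ LevelsGood (fun j k => Y j k ω) C K m} ≤
      ENNReal.ofReal (1 / (1 - (4 : ℝ) ^ (1 - C)) * (K * 2 ^ (2 * m)) ^ (1 - C)) := by
  have hsub : {ω | ¬ LevelsGood (fun j k => Y j k ω) C K m} ⊆ ⋃ i : ℕ,
      {ω | ¬ Good (fun k => Y (m + i) k ω) ⌊2 * (K * 2 ^ (2 * (m + i)))⌋₊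
        (3 * C * Real.log (K * 2 ^ (2 * (m + i))))} := by
    intro ω hω
    simp only [LevelsGood, mem_ofPred_eq, not_forall] at hω
    obtain ⟨j, hj, hω⟩ := hω
    obtain ⟨i, rfl⟩ := Nat.exists_eq_add_of_le hj
    exact Set.mem_iUnion.2 ⟨i, hω⟩
  have hr0 : 0 ≤ (4 : ℝ) ^ (1 - C) := by positivity
  have hr1 : (4 : ℝ) ^ (1 - C) < 1 := Real.rpow_lt_one_of_one_lt_of_neg (by norm_num) (by linarith)
  have hterm : ∀ i : ℕ, (K * 2 ^ (2 * (m + i))) ^ (1 - C) =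
      (K * 2 ^ (2 * m)) ^ (1 - C) * ((4 : ℝ) ^ (1 - C)) ^ i := by
    intro i
    rw [show K * 2 ^ (2 * (m + i)) = K * 2 ^ (2 * m) * 4 ^ i by
      rw [mul_add, pow_add, pow_mul _ 2 i]; norm_num [mul_assoc], Real.mul_rpow (by positivity)
      (by positivity), Real.rpow_pow_comm (by norm_num)]
  refine (measure_mono hsub).trans ((measure_iUnion_le _).trans ?_)
  calc _ ≤ ∑' i : ℕ, ENNReal.ofReal ((K * 2 ^ (2 * m)) ^ (1 - C) * ((4 : ℝ) ^ (1 - C)) ^ i) :=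
        ENNReal.tsum_le_tsum fun i => by
          rw [← hterm]
          exact prob_level_not_good_le (h (m + i)) hC
            (hL.le_mul hK.le (Nat.le_add_right m i) _ le_rfl)
    _ = ENNReal.ofReal (∑' i : ℕ, (K * 2 ^ (2 * m)) ^ (1 - C) * ((4 : ℝ) ^ (1 - C)) ^ i) := by
        rw [ENNReal.ofReal_tsum_of_nonneg (fun i => by positivity)
          ((summable_geometric_of_lt_one hr0 hr1).mul_left _)]
    _ = _ := by
        rw [tsum_mul_left, tsum_geometric_of_lt_one hr0 hr1]
        congr 1; rw [one_div, mul_comm]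

end TwistShrink

/-! ### Uniform limits of the walks and of the local times -/

namespace TwistShrink

/-- The limit of the approximating walks. -/
noncomputable def limitWalk (X : ℕ → ℕ → ℤ) (t : ℝ≥0) : ℝ :=
  limUnder atTop (fun m => approxWalk X m t)

/-- The limit of the approximating local times. -/
noncomputable def limitLocalTime (X : ℕ → ℕ → ℤ) (t : ℝ≥0) (x : ℝ) : ℝ :=
  limUnder atTop (fun m => approxLocalTime X m t x)

lemma tendsto_of_geometric {f : ℕ → ℝ} {R : ℝ} {m : ℕ}
    (h : ∀ i, |f (m + i + 1) - f (m + i)| ≤ R * (3 / 4) ^ i) :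
    Tendsto f atTop (𝓝 (limUnder atTop f)) ∧
      ∀ i, |limUnder atTop f - f (m + i)| ≤ 4 * R * (3 / 4) ^ i := by
  have hd : ∀ i, dist (f (m + i)) (f (m + (i + 1))) ≤ R * (3 / 4) ^ i := fun i => by
    rw [dist_comm, Real.dist_eq, ← add_assoc]; exact h i
  have hc : CauchySeq (fun i => f (m + i)) := cauchySeq_of_le_geometric _ _ (by norm_num) hd
  obtain ⟨a, ha⟩ := cauchySeq_tendsto_of_complete hc
  have ha' : Tendsto f atTop (𝓝 a) := (tendsto_add_atTop_iff_nat m).1 (by simpa [add_comm] using ha)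
  rw [ha'.limUnder_eq]
  refine ⟨ha', fun i => ?_⟩
  have := dist_le_of_le_geometric_of_tendsto (3 / 4) R (by norm_num) hd ha i
  rw [dist_comm, Real.dist_eq] at this
  refine this.trans (le_of_eq (by ring))

/-- The steps `x` describe all twisted walks of `X`. -/
def Describes (x X : ℕ → ℕ → ℤ) : Prop :=
  ∀ m, IsSign (x m) ∧ Refines (x (m + 1)) (x m) ∧ twistedWalk X m = partialSum (x m)

lemma LevelsGood.tendsto {X x : ℕ → ℕ → ℤ} {C K : ℝ} {m : ℕ} (hC : 1 < C)
    (hK : 0 ≤ K) (hx : Describes x X)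
    (hG : LevelsGood x C K m) (hL : LargeFrom C (K * 2 ^ (2 * m))) {t : ℝ≥0} (ht : (t : ℝ) ≤ K) :
    (Tendsto (fun m => approxWalk X m t) atTop (𝓝 (limitWalk X t)) ∧
      ∀ i, |limitWalk X t - approxWalk X (m + i) t| ≤
        4 * (9.36 * C * (fluct (K * 2 ^ (2 * m)) / 2 ^ m)) * (3 / 4) ^ i) ∧
    ∀ z, Tendsto (fun m => approxLocalTime X m t z) atTop (𝓝 (limitLocalTime X t z)) ∧
      ∀ i, |limitLocalTime X t z - approxLocalTime X (m + i) t z| ≤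
        4 * (9.36 * C * (fluct (K * 2 ^ (2 * m)) / 2 ^ m)) * (3 / 4) ^ i :=
  ⟨tendsto_of_geometric (f := fun m => approxWalk X m t)
      fun i => (hG.step_le hC hK hx hL ht i).1,
    fun z => tendsto_of_geometric (f := fun m => approxLocalTime X m t z)
      fun i => (hG.step_le hC hK hx hL ht i).2 z⟩

/-- Some level is good from its number on, for every time horizon. -/
def EventuallyGood (x : ℕ → ℕ → ℤ) : Prop :=
  ∀ K : ℕ, ∃ m, LevelsGood x 2 (K + 1) m ∧ LargeFrom 2 ((K + 1) * 2 ^ (2 * m))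

section Limits

variable {X x : ℕ → ℕ → ℤ}

lemma exists_uniform_bound (hx : Describes x X) (hE : EventuallyGood x) (K : ℝ) :
    ∃ (m : ℕ) (R : ℝ), ∀ t : ℝ≥0, (t : ℝ) ≤ K →
      (∀ i, |limitWalk X t - approxWalk X (m + i) t| ≤ R * (3 / 4) ^ i) ∧
      ∀ z i, |limitLocalTime X t z - approxLocalTime X (m + i) t z| ≤ R * (3 / 4) ^ i := by
  obtain ⟨m, h1, h2⟩ := hE ⌈K⌉₊
  refine ⟨m, 4 * (9.36 * 2 * (fluct ((⌈K⌉₊ + 1) * 2 ^ (2 * m)) / 2 ^ m)), fun t ht => ?_⟩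
  have := h1.tendsto (by norm_num) (by positivity) hx h2
    (ht.trans ((Nat.le_ceil K).trans (by linarith)))
  exact ⟨this.1.2, fun z => (this.2 z).2⟩

lemma tendstoUniformlyOn_of_geometric {α : Type*} {s : Set α} {f : ℕ → α → ℝ} {g : α → ℝ} {m : ℕ}
    {R : ℝ} (h : ∀ a ∈ s, ∀ i, |g a - f (m + i) a| ≤ R * (3 / 4) ^ i) :
    TendstoUniformlyOn f g atTop s := by
  rw [Metric.tendstoUniformlyOn_iff]
  intro ε hε
  have hlim : Tendsto (fun i : ℕ => R * (3 / 4 : ℝ) ^ i) atTop (𝓝 (R * 0)) :=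
    (tendsto_pow_atTop_nhds_zero_of_lt_one (by norm_num) (by norm_num)).const_mul R
  rw [mul_zero] at hlim
  obtain ⟨i₀, hi₀⟩ := eventually_atTop.1 (hlim.eventually_lt_const hε)
  refine eventually_atTop.2 ⟨m + i₀, fun n hn a ha => ?_⟩
  obtain ⟨i, rfl⟩ := Nat.exists_eq_add_of_le ((Nat.le_add_right m i₀).trans hn)
  exact (h a ha i).trans_lt (hi₀ i (by omega))

lemma tendstoUniformlyOn_walk (hx : Describes x X) (hE : EventuallyGood x) (K : ℝ) :
    TendstoUniformlyOn (approxWalk X) (limitWalk X) atTop {t : ℝ≥0 | (t : ℝ) ≤ K} := by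
  obtain ⟨m, R, h⟩ := exists_uniform_bound hx hE K
  exact tendstoUniformlyOn_of_geometric fun t ht => (h t ht).1

lemma tendstoUniformlyOn_localTime (hx : Describes x X) (hE : EventuallyGood x) (K : ℝ) :
    TendstoUniformlyOn (fun m (p : ℝ≥0 × ℝ) => approxLocalTime X m p.1 p.2)
      (fun p => limitLocalTime X p.1 p.2) atTop ({t : ℝ≥0 | (t : ℝ) ≤ K} ×ˢ univ) := by
  obtain ⟨m, R, h⟩ := exists_uniform_bound hx hE K
  exact tendstoUniformlyOn_of_geometric fun p hp => (h p.1 hp.1).2 p.2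

lemma tendsto_approxWalk (hx : Describes x X) (hE : EventuallyGood x) (t : ℝ≥0) :
    Tendsto (fun m => approxWalk X m t) atTop (𝓝 (limitWalk X t)) :=
  (tendstoUniformlyOn_walk hx hE t).tendsto_at (x := t) (le_refl (t : ℝ))

lemma tendsto_approxLocalTime (hx : Describes x X) (hE : EventuallyGood x) (t : ℝ≥0) (z : ℝ) :
    Tendsto (fun m => approxLocalTime X m t z) atTop (𝓝 (limitLocalTime X t z)) :=
  (tendstoUniformlyOn_localTime hx hE t).tendsto_at (x := (t, z)) ⟨le_refl (t : ℝ), mem_univ z⟩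

lemma continuous_limitWalk (hx : Describes x X) (hE : EventuallyGood x) :
    Continuous (limitWalk X) := by
  rw [continuous_iff_continuousAt]
  intro t
  have h1 : ContinuousOn (limitWalk X) {s : ℝ≥0 | (s : ℝ) ≤ t + 1} :=
    (tendstoUniformlyOn_walk hx hE (t + 1)).continuousOn
      (Frequently.of_forall fun m => (continuous_approxWalk X m).continuousOn)
  refine h1.continuousAt ?_
  have h2 : IsOpen {s : ℝ≥0 | (s : ℝ) < t + 1} := isOpen_lt (by fun_prop) (by fun_prop)
  exact mem_of_superset (h2.mem_nhds (by simp)) fun s (hs : (s : ℝ) < t + 1) => hs.le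

lemma continuous_limitLocalTime (hx : Describes x X) (hE : EventuallyGood x) :
    Continuous (fun p : ℝ≥0 × ℝ => limitLocalTime X p.1 p.2) := by
  rw [continuous_iff_continuousAt]
  rintro ⟨t, z⟩
  have h1 : ContinuousOn (fun p : ℝ≥0 × ℝ => limitLocalTime X p.1 p.2)
      ({s : ℝ≥0 | (s : ℝ) ≤ t + 1} ×ˢ univ) :=
    (tendstoUniformlyOn_localTime hx hE (t + 1)).continuousOn
      (Frequently.of_forall fun m => (continuous_approxLocalTime X m).continuousOn)
  refine h1.continuousAt (prod_mem_nhds ?_ univ_mem)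
  have h2 : IsOpen {s : ℝ≥0 | (s : ℝ) < t + 1} := isOpen_lt (by fun_prop) (by fun_prop)
  exact mem_of_superset (h2.mem_nhds (by simp)) fun s (hs : (s : ℝ) < t + 1) => hs.le

end Limits

variable {Ω : Type*} {mΩ : MeasurableSpace Ω} {P : Measure Ω}

/-- For a fixed horizon, failure at every starting level is at most as likely as failure from a
single large level m on, and this probability tends to 0. -/
lemma ae_eventuallyGood [IsProbabilityMeasure P] {F : ℕ → ℕ → MeasurableSpace Ω}
    {Y : ℕ → ℕ → Ω → ℤ} (h : ∀ m, FairSigns P (F m) (Y m)) :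
    ∀ᵐ ω ∂P, EventuallyGood (fun j k => Y j k ω) := by
  unfold EventuallyGood
  rw [ae_all_iff]
  intro K
  obtain ⟨N, hN⟩ := eventually_atTop.1 (eventually_largeSteps (C := 2) (by norm_num))
  have hgrow : Tendsto (fun m : ℕ => ((K : ℝ) + 1) * 2 ^ (2 * m)) atTop atTop := by
    refine Tendsto.const_mul_atTop (by positivity) ?_
    simp_rw [pow_mul]
    exact tendsto_pow_atTop_atTop_of_one_lt (by norm_num)
  have hlarge : ∀ᶠ m : ℕ in atTop, LargeFrom 2 (((K : ℝ) + 1) * 2 ^ (2 * m)) := by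
    filter_upwards [hgrow.eventually_ge_atTop N] with m hm n hn using hN n (hm.trans hn)
  have hlim : Tendsto (fun m : ℕ => ENNReal.ofReal
      (1 / (1 - (4 : ℝ) ^ (1 - (2 : ℝ))) * (((K : ℝ) + 1) * 2 ^ (2 * m)) ^ (1 - (2 : ℝ))))
      atTop (𝓝 0) := by
    have h1 := ((tendsto_rpow_neg_atTop (y := 1) one_pos).comp hgrow).const_mul
      (1 / (1 - (4 : ℝ) ^ (1 - (2 : ℝ))))
    rw [mul_zero] at h1
    have h2 := ENNReal.tendsto_ofReal h1
    rw [ENNReal.ofReal_zero] at h2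
    convert h2 using 5
    norm_num
  rw [ae_iff]
  refine le_antisymm (ge_of_tendsto hlim ?_) (zero_le)
  filter_upwards [hlarge] with m hm
  refine le_trans (measure_mono fun ω hω hG => hω ⟨m, hG, hm⟩)
    (prob_not_levelsGood_le h (by norm_num) (by positivity) hm)

end TwistShrink

/-! ### Occupation times and Lévy's local time -/

namespace TwistShrink

/-- The occupation time of a finite set of sites by a walk with `c` steps per unit of time. -/
lemma occupation_bounds (S : ℕ → ℤ) {c : ℝ} (hc : 0 < c) (t : ℝ≥0) (J : Finset ℤ) :
    (∑ j ∈ J, (walkLocalTime S ⌊t * c⌋₊ j : ℝ)) / c ≤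
      volume.real {s : ℝ | s ∈ Icc 0 (t : ℝ) ∧ S ⌊s * c⌋₊ ∈ J} ∧
    volume.real {s : ℝ | s ∈ Icc 0 (t : ℝ) ∧ S ⌊s * c⌋₊ ∈ J} ≤
      ((∑ j ∈ J, (walkLocalTime S ⌊t * c⌋₊ j : ℝ)) + 1) / c := by
  set k := ⌊t * c⌋₊ with hk
  set Fs := (Finset.range k).filter (fun i => S i ∈ J) with hF
  have hN : ∑ j ∈ J, (walkLocalTime S k j : ℝ) = Fs.card := by
    rw [Finset.card_eq_sum_card_fiberwise (f := S) (t := J) (fun i hi => by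
      simpa using (Finset.mem_filter.1 hi).2)]
    push_cast
    refine Finset.sum_congr rfl fun j hj => ?_
    rw [walkLocalTime, hF, Finset.filter_filter]
    congr 2
    ext i
    simp only [Finset.mem_filter]
    constructor
    · rintro ⟨h1, rfl⟩; exact ⟨h1, hj, rfl⟩
    · rintro ⟨h1, -, h2⟩; exact ⟨h1, h2⟩
  set I : ℕ → Set ℝ := fun i => Ico (i / c) ((i + 1) / c) with hI
  have hvol : ∀ i, volume.real (I i) = 1 / c := fun i => by
    rw [hI, Real.volume_real_Ico_of_le (by gcongr; linarith)]; ring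
  have hmem : ∀ {s : ℝ}, 0 ≤ s → ∀ {i : ℕ}, s ∈ I i ↔ ⌊s * c⌋₊ = i := by
    intro s hs i
    rw [hI, mem_Ico, div_le_iff₀ hc, lt_div_iff₀ hc, Nat.floor_eq_iff (by positivity)]
  have hI0 : ∀ {i : ℕ} {s : ℝ}, s ∈ I i → 0 ≤ s := fun {i s} hs => le_trans (by positivity) hs.1
  have htfin : volume {s : ℝ | s ∈ Icc 0 (t : ℝ) ∧ S ⌊s * c⌋₊ ∈ J} ≠ ⊤ :=
    measure_ne_top_of_subset (fun s hs => hs.1) (by simp : volume (Icc 0 (t : ℝ)) ≠ ⊤)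
  rw [hN]
  constructor
  · have hdisj : (Fs : Set ℕ).PairwiseDisjoint I := by
      intro i _ j _ hij
      refine Set.disjoint_left.2 fun s h1 h2 => hij ?_
      rw [← (hmem (hI0 h1)).1 h1, (hmem (hI0 h1)).1 h2]
    have h1 : volume.real (⋃ i ∈ Fs, I i) = Fs.card / c := by
      rw [measureReal_biUnion_finset hdisj (fun i _ => measurableSet_Ico)
        (fun i _ => by simp [hI])]
      simp only [hvol, Finset.sum_const, nsmul_eq_mul]; ring
    rw [← h1]
    refine measureReal_mono ?_ htfin
    intro s hs
    simp only [mem_iUnion] at hs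
    obtain ⟨i, hi, hs⟩ := hs
    rw [hF, Finset.mem_filter, Finset.mem_range] at hi
    have hs' := (hmem (hI0 hs)).1 hs
    refine ⟨⟨hI0 hs, ?_⟩, by rw [hs']; exact hi.2⟩
    have h2 : ((i + 1 : ℕ) : ℝ) ≤ t * c :=
      (Nat.cast_le.2 (Nat.succ_le_of_lt hi.1)).trans (Nat.floor_le (by positivity))
    have h3 : ((i : ℝ) + 1) / c ≤ t := by rw [div_le_iff₀ hc]; exact_mod_cast h2
    exact hs.2.le.trans h3
  -- The time cell number k contains t and is not counted by the local time; it accounts for the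
  -- extra 1.
  · have hsub : {s : ℝ | s ∈ Icc 0 (t : ℝ) ∧ S ⌊s * c⌋₊ ∈ J} ⊆ ⋃ i ∈ insert k Fs, I i := by
      rintro s ⟨⟨h0, h1⟩, h2⟩
      simp only [mem_iUnion]
      refine ⟨⌊s * c⌋₊, ?_, (hmem h0).2 rfl⟩
      rw [Finset.mem_insert, hF, Finset.mem_filter, Finset.mem_range]
      have h3 : ⌊s * c⌋₊ ≤ k := Nat.floor_mono (by gcongr)
      rcases h3.lt_or_eq with h4 | h4
      · exact Or.inr ⟨h4, h2⟩
      · exact Or.inl h4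
    calc _ ≤ volume.real (⋃ i ∈ insert k Fs, I i) := by
          refine measureReal_mono hsub ?_
          exact ((measure_biUnion_lt_top (Finset.finite_toSet _)
            (fun i _ => by simp [hI])).ne)
      _ ≤ ∑ i ∈ insert k Fs, volume.real (I i) := measureReal_biUnion_finset_le _ _
      _ = ((insert k Fs).card : ℝ) / c := by
          simp only [hvol, Finset.sum_const, nsmul_eq_mul]; ring
      _ ≤ _ := by
          gcongr
          exact_mod_cast Finset.card_insert_le _ _

/-- The sites in an open interval. -/
lemma card_sites_bounds {a b : ℝ} (hab : a < b) :
    b - a - 1 ≤ ((Finset.Ioo ⌊a⌋ ⌈b⌉).card : ℝ) ∧ ((Finset.Ioo ⌊a⌋ ⌈b⌉).card : ℝ) ≤ b - a + 1 := by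
  have h : ⌊a⌋ < ⌈b⌉ := by
    have := (Int.floor_le a).trans_lt (hab.trans_le (Int.le_ceil b))
    exact_mod_cast this
  have h1 : ((Finset.Ioo ⌊a⌋ ⌈b⌉).card : ℝ) = ⌈b⌉ - ⌊a⌋ - 1 := by
    rw [Int.card_Ioo, ← Int.cast_natCast, Int.toNat_of_nonneg (by omega)]; push_cast; ring
  rw [h1]
  constructor <;> linarith [Int.floor_le a, Int.lt_floor_add_one a, Int.le_ceil b,
    Int.ceil_lt_add_one b]

lemma mem_sites {a b : ℝ} {j : ℤ} : j ∈ Finset.Ioo ⌊a⌋ ⌈b⌉ ↔ a < j ∧ (j : ℝ) < b := by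
  rw [Finset.mem_Ioo, Int.floor_lt, Int.lt_ceil]

section Levy

variable {X x : ℕ → ℕ → ℤ}

lemma abs_approxWalk_sub_le (hx : Describes x X) (m : ℕ) (t : ℝ≥0) :
    |approxWalk X m t - (twistedWalk X m ⌊(t : ℝ) * 2 ^ (2 * m)⌋₊ : ℝ) / 2 ^ m| ≤ 1 / 2 ^ m := by
  rw [approxWalk, (hx m).2.2, ← sub_div, abs_div, abs_of_pos (by positivity : (0 : ℝ) < 2 ^ m)]
  gcongr
  exact (hx m).1.abs_linInterp_sub_le (by positivity)

lemma abs_approxLocalTime_sub_le (X : ℕ → ℕ → ℤ) (m : ℕ) (t : ℝ≥0) (j : ℤ) :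
    |approxLocalTime X m t (j / 2 ^ m) -
      (walkLocalTime (twistedWalk X m) ⌊(t : ℝ) * 2 ^ (2 * m)⌋₊ j : ℝ) / 2 ^ m| ≤ 1 / 2 ^ m := by
  have hp : (0 : ℝ) < 2 ^ m := by positivity
  rw [approxLocalTime_eq, ← sub_div, abs_div, abs_of_pos hp, div_mul_cancel₀ _ hp.ne']
  have := gridInterp_bounds (g := fun k j => (walkLocalTime (twistedWalk X m) k j : ℝ))
    (fun k z => by exact_mod_cast walkLocalTime_mono _ z k.le_succ) (walkLocalTime_le_succ _)
    (s := t * 2 ^ (2 * m)) (by positivity) j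
  simp only [Int.floor_intCast, sub_self, sub_zero, one_mul, zero_mul, add_zero] at this
  gcongr
  rw [abs_le]
  constructor <;> linarith [this.1, this.2]

/-- Occupation times of small intervals, when the local time is nearly constant there. -/
lemma occupation_estimate (hx : Describes x X) (hE : EventuallyGood x) {t : ℝ≥0} {z δ r ε κ : ℝ}
    (hδ : 0 < δ) (hr : ∀ y, |y - z| < r → |limitLocalTime X t y - limitLocalTime X t z| ≤ δ)
    (hε : 0 < ε) (hεr : 2 * ε < r) (hκ : 0 < κ) (hκ1 : κ < 1)
    (hκδ : κ * (2 * (|limitLocalTime X t z| + 3 * δ) + 1) ≤ δ) :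
    |1 / (2 * ε) * volume.real {s : ℝ | s ∈ Icc 0 (t : ℝ) ∧
      limitWalk X s.toNNReal ∈ Ioo (z - ε) (z + ε)} - limitLocalTime X t z| ≤ 4 * δ := by
  set l := limitLocalTime X t z with hl
  have hpow : Tendsto (fun m : ℕ => (1 : ℝ) / 2 ^ m) atTop (𝓝 0) := by
    have : Tendsto (fun m : ℕ => ((1 : ℝ) / 2) ^ m) atTop (𝓝 0) :=
      tendsto_pow_atTop_nhds_zero_of_lt_one (by norm_num) (by norm_num)
    simpa [one_div_pow] using this
  obtain ⟨m, h1, h2, h3, h4, h5⟩ := (((Metric.tendstoUniformlyOn_iff.1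
    (tendstoUniformlyOn_walk hx hE t) (ε * κ / 2) (by positivity)).and
    ((Metric.tendstoUniformlyOn_iff.1 (tendstoUniformlyOn_localTime hx hE t) δ hδ).and
    ((hpow.eventually_le_const (show 0 < ε * κ / 2 by positivity)).and
    ((hpow.eventually_le_const hδ).and (hpow.eventually_le_const one_pos))))).exists)
  set S := twistedWalk X m with hS
  set M : ℝ := 2 ^ m with hM
  have hM0 : 0 < M := by positivity
  have hMM : (2 : ℝ) ^ (2 * m) = M * M := by rw [hM, two_mul, pow_add]
  set A := {s : ℝ | s ∈ Icc 0 (t : ℝ) ∧ limitWalk X s.toNNReal ∈ Ioo (z - ε) (z + ε)} with hA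
  -- the walk is close to the limit
  have hW : ∀ s ∈ Icc 0 (t : ℝ),
      |limitWalk X s.toNNReal - (S ⌊s * 2 ^ (2 * m)⌋₊ : ℝ) / M| < ε * κ := by
    intro s hs
    have hs' : ((s.toNNReal : ℝ≥0) : ℝ) = s := Real.coe_toNNReal s hs.1
    have h6 := h1 s.toNNReal (by rw [mem_ofPred_eq, hs']; exact hs.2)
    rw [Real.dist_eq] at h6
    have h7 := abs_approxWalk_sub_le hx m s.toNNReal
    rw [hs'] at h7
    calc _ = |(limitWalk X s.toNNReal - approxWalk X m s.toNNReal) +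
          (approxWalk X m s.toNNReal - (S ⌊s * 2 ^ (2 * m)⌋₊ : ℝ) / M)| := by ring_nf
      _ ≤ _ := abs_add_le _ _
      _ < ε * κ / 2 + ε * κ / 2 := add_lt_add_of_lt_of_le h6 (h7.trans h3)
      _ = ε * κ := by ring
  -- the local time at the sites
  have hL : ∀ j : ℤ, |j / M - z| < r →
      |(walkLocalTime S ⌊(t : ℝ) * 2 ^ (2 * m)⌋₊ j : ℝ) / M - l| ≤ 3 * δ := by
    intro j hj
    have h6 := h2 (t, j / M) ⟨le_refl (t : ℝ), mem_univ _⟩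
    rw [Real.dist_eq] at h6
    have h7 := abs_lt.1 h6
    have h8 := abs_le.1 ((abs_approxLocalTime_sub_le X m t j).trans h4)
    have h9 := abs_le.1 (hr _ hj)
    rw [abs_le]
    simp only [← hM, ← hS] at h7 h8
    constructor <;> linarith [h7.1, h7.2, h8.1, h8.2, h9.1, h9.2]
  -- The approximating local times are nonnegative; positivity is needed to multiply the upper bound
  -- by the number of sites.
  have hl0 : 0 < l + 3 * δ := by
    have h6 := h2 (t, z) ⟨le_refl (t : ℝ), mem_univ _⟩
    rw [Real.dist_eq] at h6
    have h7 : 0 ≤ approxLocalTime X m t z := by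
      rw [approxLocalTime_eq]
      refine div_nonneg (le_trans ?_ (gridInterp_bounds (fun k z => by
        exact_mod_cast walkLocalTime_mono _ z k.le_succ) (walkLocalTime_le_succ _)
        (by positivity) _).1) hM0.le
      have := Int.floor_le (z * 2 ^ m)
      have := Int.lt_floor_add_one (z * 2 ^ m)
      exact add_nonneg (mul_nonneg (by linarith) (Nat.cast_nonneg _))
        (mul_nonneg (by linarith) (Nat.cast_nonneg _))
    have := (abs_lt.1 h6).1
    simp only at this
    linarith
  have hlabs : l ≤ |l| := le_abs_self l
  -- the sums over sites
  set J : ℝ → Finset ℤ := fun ε' => Finset.Ioo ⌊(z - ε') * M⌋ ⌈(z + ε') * M⌉ with hJ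
  have hJmem : ∀ (ε' : ℝ) (j : ℤ), j ∈ J ε' ↔ |j / M - z| < ε' := by
    intro ε' j
    rw [hJ, mem_sites, ← lt_div_iff₀ hM0, ← div_lt_iff₀ hM0, abs_lt]
    constructor <;> rintro ⟨h6, h7⟩ <;> constructor <;> linarith
  have hcard : ∀ ε' : ℝ, 0 < ε' → 2 * ε' * M - 1 ≤ (J ε').card ∧
      ((J ε').card : ℝ) ≤ 2 * ε' * M + 1 := by
    intro ε' hε'
    have := card_sites_bounds (a := (z - ε') * M) (b := (z + ε') * M) (by gcongr; linarith)
    constructor <;> linarith [this.1, this.2]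
  set N : ℝ → ℝ := fun ε' =>
    ∑ j ∈ J ε', (walkLocalTime S ⌊(t : ℝ) * 2 ^ (2 * m)⌋₊ j : ℝ) with hN
  have hup : ∀ ε' : ℝ, 0 < ε' → ε' < r → N ε' ≤ (2 * ε' * M + 1) * (M * (l + 3 * δ)) := by
    intro ε' h0 h6
    calc N ε' ≤ (J ε').card • (M * (l + 3 * δ)) := Finset.sum_le_card_nsmul _ _ _ fun j hj => by
          have := (abs_le.1 (hL j (((hJmem ε' j).1 hj).trans h6))).2
          rw [← div_le_iff₀' hM0]; linarith
      _ ≤ _ := by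
          rw [nsmul_eq_mul]
          gcongr
          exact (hcard ε' h0).2
  have hlow : ∀ ε' : ℝ, 0 < ε' → ε' < r → 0 ≤ l - 3 * δ →
      (2 * ε' * M - 1) * (M * (l - 3 * δ)) ≤ N ε' := by
    intro ε' h0 h6 h7
    calc (2 * ε' * M - 1) * (M * (l - 3 * δ)) ≤ (J ε').card • (M * (l - 3 * δ)) := by
          rw [nsmul_eq_mul]
          gcongr
          exact (hcard ε' h0).1
      _ ≤ _ := Finset.card_nsmul_le_sum _ _ _ fun j hj => by
          have := (abs_le.1 (hL j (((hJmem ε' j).1 hj).trans h6))).1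
          rw [← le_div_iff₀' hM0]; linarith
  have hεκ : 0 < ε * κ := by positivity
  have hεκ' : ε * κ < ε := by nlinarith
  -- Since walk and limit differ by less than εκ, the occupation set lies between those of the walk
  -- for the half-widths ε - εκ and ε + εκ.
  have hup' : volume.real A ≤
      (2 * (ε + ε * κ) + ε * κ / 2) * (l + 3 * δ) + ε * κ / 2 := by
    calc volume.real A ≤ volume.real {s : ℝ | s ∈ Icc 0 (t : ℝ) ∧
          S ⌊s * 2 ^ (2 * m)⌋₊ ∈ J (ε + ε * κ)} := by
          refine measureReal_mono ?_ (measure_ne_top_of_subset (fun s hs => hs.1)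
            (by simp : volume (Icc 0 (t : ℝ)) ≠ ⊤))
          rintro s ⟨hs, h6⟩
          refine ⟨hs, (hJmem _ _).2 ?_⟩
          have h7 := abs_lt.1 (hW s hs)
          rw [abs_lt]
          constructor <;> linarith [h6.1, h6.2, h7.1, h7.2]
      _ ≤ (N (ε + ε * κ) + 1) / 2 ^ (2 * m) := (occupation_bounds S (by positivity) t _).2
      _ ≤ ((2 * (ε + ε * κ) * M + 1) * (M * (l + 3 * δ)) + 1) / (M * M) := by
          rw [hMM]; gcongr; exact hup _ (by positivity) (by linarith)
      _ = (2 * (ε + ε * κ) + 1 / M) * (l + 3 * δ) + 1 / M * (1 / M) := by field_simp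
      _ ≤ (2 * (ε + ε * κ) + ε * κ / 2) * (l + 3 * δ) + ε * κ / 2 * 1 := by gcongr
      _ = _ := by ring
  have hlow' : 0 ≤ l - 3 * δ → (2 * (ε - ε * κ) - ε * κ / 2) * (l - 3 * δ) ≤ volume.real A := by
    intro h6
    calc (2 * (ε - ε * κ) - ε * κ / 2) * (l - 3 * δ)
        ≤ (2 * (ε - ε * κ) - 1 / M) * (l - 3 * δ) := by gcongr
      _ = ((2 * (ε - ε * κ) * M - 1) * (M * (l - 3 * δ))) / (M * M) := by field_simp
      _ ≤ N (ε - ε * κ) / 2 ^ (2 * m) := by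
          rw [hMM]; gcongr; exact hlow _ (by linarith) (by linarith) h6
      _ ≤ volume.real {s : ℝ | s ∈ Icc 0 (t : ℝ) ∧ S ⌊s * 2 ^ (2 * m)⌋₊ ∈ J (ε - ε * κ)} :=
          (occupation_bounds S (by positivity) t _).1
      _ ≤ volume.real A := by
          refine measureReal_mono ?_ (measure_ne_top_of_subset (fun s hs => hs.1)
            (by simp : volume (Icc 0 (t : ℝ)) ≠ ⊤))
          rintro s ⟨hs, h6⟩
          refine ⟨hs, ?_⟩
          have h7 := abs_lt.1 (hW s hs)
          have h8 := abs_lt.1 ((hJmem _ _).1 h6)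
          constructor <;> linarith [h8.1, h8.2, h7.1, h7.2]
  have hA0 : 0 ≤ volume.real A := measureReal_nonneg
  rw [abs_le]
  have hdiv : 1 / (2 * ε) * volume.real A = volume.real A / (2 * ε) := by ring
  rw [hdiv]
  constructor
  -- If l < 3δ, the lower bound is trivial because occupation times are nonnegative.
  · rcases le_or_gt 0 (l - 3 * δ) with h6 | h6
    · have h7 : l - 4 * δ ≤ volume.real A / (2 * ε) := by
        rw [le_div_iff₀ (by positivity)]
        have h9 := mul_le_mul_of_nonneg_left hlabs hκ.le
        have h10 := mul_nonneg hκ.le hδ.le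
        have h8 : 2 * κ * (l - 3 * δ) ≤ δ := by linarith
        have h11 := mul_le_mul_of_nonneg_left h8 hε.le
        have h12 := mul_nonneg hεκ.le h6
        linarith [hlow' h6]
      linarith
    · have : 0 ≤ volume.real A / (2 * ε) := by positivity
      linarith
  · have h7 : volume.real A / (2 * ε) ≤ l + 4 * δ := by
      rw [div_le_iff₀ (by positivity)]
      have h9 := mul_le_mul_of_nonneg_left hlabs hκ.le
      have h8 : 2 * κ * (l + 3 * δ) + κ ≤ δ := by linarith
      have h11 := mul_le_mul_of_nonneg_left h8 hε.le
      have h12 := mul_pos hεκ hl0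
      linarith
    linarith

lemma isLevyLocalTime_limit (hx : Describes x X) (hE : EventuallyGood x) :
    IsLevyLocalTime (limitWalk X) (limitLocalTime X) := by
  intro t z
  rw [Metric.tendsto_nhds]
  intro e he
  have hcont : Continuous (limitLocalTime X t) :=
    (continuous_limitLocalTime hx hE).uncurry_left t
  obtain ⟨r, hr0, hr⟩ := Metric.continuous_iff.1 hcont z (e / 5) (by positivity)
  have hden : 0 < 2 * (|limitLocalTime X t z| + 3 * (e / 5)) + 1 := by positivity
  obtain ⟨κ, hκ0, hκ1, hκ2⟩ : ∃ κ : ℝ, 0 < κ ∧ κ < 1 ∧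
      κ * (2 * (|limitLocalTime X t z| + 3 * (e / 5)) + 1) ≤ e / 5 := by
    refine ⟨min (1 / 2) (e / 5 / (2 * (|limitLocalTime X t z| + 3 * (e / 5)) + 1)),
      lt_min (by norm_num) (by positivity), (min_le_left _ _).trans_lt (by norm_num), ?_⟩
    rw [← le_div_iff₀ hden]
    exact min_le_right _ _
  have hr' : ∀ y, |y - z| < r → |limitLocalTime X t y - limitLocalTime X t z| ≤ e / 5 := by
    intro y hy
    have h1 := hr y (by rwa [Real.dist_eq])
    rw [Real.dist_eq] at h1
    exact h1.le
  filter_upwards [Ioo_mem_nhdsGT (show 0 < r / 2 by positivity)] with ε hε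
  have := occupation_estimate hx hE (by positivity) hr' hε.1 (by linarith [hε.2]) hκ0 hκ1 hκ2
  rw [Real.dist_eq]
  exact this.trans_lt (by linarith)

end Levy

end TwistShrink

/-! ### The scaling limit is Brownian motion -/

namespace TwistShrink

lemma partialSum_eq_sum_range (x : ℕ → ℤ) (n : ℕ) :
    partialSum x n = ∑ k ∈ Finset.range n, x (k + 1) := by
  induction n with
  | zero => simp [partialSum]
  | succ n ih => rw [partialSum_succ, ih, Finset.sum_range_succ]

lemma partialSum_sub_eq_sum (x : ℕ → ℤ) {a b M : ℕ} (hab : a ≤ b) (hb : b ≤ M) :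
    ((partialSum x b : ℝ) - partialSum x a) =
      ∑ k ∈ Finset.range M, if a ≤ k ∧ k < b then (x (k + 1) : ℝ) else 0 := by
  rw [partialSum_eq_sum_range, partialSum_eq_sum_range, ← Finset.sum_filter]
  push_cast
  rw [← Finset.sum_Ico_eq_sub _ hab]
  refine Finset.sum_congr ?_ fun _ _ => rfl
  ext k
  simp only [Finset.mem_Ico, Finset.mem_filter, Finset.mem_range]
  omega

/-- At most one summand is nonzero. This applies to a single step, which lies in at most one of the
disjoint time windows of the increments. -/
lemma prod_cos_eq_cos_sum {ι : Type*} (s : Finset ι) (f : ι → ℝ)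
    (h : ∀ i ∈ s, ∀ j ∈ s, f i ≠ 0 → f j ≠ 0 → i = j) :
    Real.cos (∑ i ∈ s, f i) = ∏ i ∈ s, Real.cos (f i) := by
  by_cases h0 : ∃ i ∈ s, f i ≠ 0
  · obtain ⟨i, hi, hfi⟩ := h0
    have h1 : ∀ j ∈ s, j ≠ i → f j = 0 := fun j hj hji => by
      by_contra hfj
      exact hji (h j hj i hi hfj hfi)
    rw [Finset.sum_eq_single_of_mem i hi h1, Finset.prod_eq_single_of_mem i hi]
    intro j hj hji
    rw [h1 j hj hji, Real.cos_zero]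
  · push Not at h0
    rw [Finset.sum_eq_zero h0, Real.cos_zero, Finset.prod_eq_one]
    intro i hi
    rw [h0 i hi, Real.cos_zero]

lemma tendsto_cos_pow {a Δ : ℝ} {n : ℕ → ℕ}
    (hn : Tendsto (fun m => (n m : ℝ) / 2 ^ (2 * m)) atTop (𝓝 Δ)) :
    Tendsto (fun m => Real.cos (a / 2 ^ m) ^ n m) atTop (𝓝 (Real.exp (-(Δ * a ^ 2 / 2)))) := by
  -- With x = 4^m the power becomes exp((n/x)·x log cos(a/√x)), and the logarithm is linearised at
  -- 1.
  have hs : Tendsto (fun x : ℝ => x * (Real.cos (a / √x) - 1)) atTop (𝓝 (-(a ^ 2 / 2))) := by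
    have h1 : Tendsto (fun x : ℝ => a ^ 4 * x⁻¹) atTop (𝓝 0) := by
      simpa using tendsto_inv_atTop_zero.const_mul (a ^ 4)
    rw [tendsto_iff_dist_tendsto_zero]
    refine squeeze_zero' (Eventually.of_forall fun _ => dist_nonneg) ?_ h1
    filter_upwards [eventually_ge_atTop (a ^ 2), eventually_gt_atTop 0] with x hx hx0
    have hsq : (a / √x) ^ 2 = a ^ 2 / x := by rw [div_pow, Real.sq_sqrt hx0.le]
    have hle : |a / √x| ≤ 1 := by
      rw [← sq_le_one_iff_abs_le_one, hsq, div_le_one hx0]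
      exact hx
    have h2 := Real.cos_bound hle
    have h4 : |a / √x| ^ 4 = a ^ 4 / x ^ 2 := by
      rw [show |a / √x| ^ 4 = (|a / √x| ^ 2) ^ 2 by ring, sq_abs, hsq]
      ring
    rw [h4, hsq] at h2
    rw [Real.dist_eq]
    have e : x * (Real.cos (a / √x) - 1) - -(a ^ 2 / 2) =
        x * (Real.cos (a / √x) - (1 - a ^ 2 / x / 2)) := by field_simp; ring
    rw [e, abs_mul, abs_of_pos hx0]
    calc x * |Real.cos (a / √x) - (1 - a ^ 2 / x / 2)| ≤ x * (a ^ 4 / x ^ 2 * (5 / 96)) := by gcongr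
      _ = a ^ 4 * x⁻¹ * (5 / 96) := by field_simp
      _ ≤ a ^ 4 * x⁻¹ := by
        have : 0 ≤ a ^ 4 * x⁻¹ := by positivity
        linarith
  have hpow : Tendsto (fun m : ℕ => (2 : ℝ) ^ (2 * m)) atTop atTop := by
    simp_rw [pow_mul]
    exact tendsto_pow_atTop_atTop_of_one_lt (by norm_num)
  have hsqrt : ∀ m : ℕ, √((2 : ℝ) ^ (2 * m)) = 2 ^ m := fun m => by
    rw [mul_comm, pow_mul, Real.sqrt_sq (by positivity)]
  have hlog := (Real.tendsto_mul_log_one_add_of_tendsto hs).comp hpow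
  have h3 := (Real.continuous_exp.tendsto _).comp (hn.mul hlog)
  have hz : Tendsto (fun m : ℕ => a / (2 : ℝ) ^ m) atTop (𝓝 0) :=
    tendsto_const_nhds.div_atTop (tendsto_pow_atTop_atTop_of_one_lt (by norm_num))
  have hpos : ∀ᶠ m : ℕ in atTop, 0 < Real.cos (a / 2 ^ m) := by
    refine ((Real.continuous_cos.tendsto 0).comp hz).eventually_const_lt ?_
    simp
  rw [show -(Δ * a ^ 2 / 2) = Δ * -(a ^ 2 / 2) by ring]
  refine h3.congr' ?_
  filter_upwards [hpos] with m hm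
  simp only [Function.comp_apply, hsqrt, add_sub_cancel]
  rw [← mul_assoc, div_mul_cancel₀ _ (by positivity), mul_comm, Real.exp_mul, Real.exp_log hm,
    Real.rpow_natCast]

variable {Ω : Type*} {mΩ : MeasurableSpace Ω} {P : Measure Ω}

namespace FairSigns

variable {F : ℕ → MeasurableSpace Ω} {Y : ℕ → Ω → ℤ}

lemma integral_cexp [IsProbabilityMeasure P] (h : FairSigns P F Y) (n : ℕ) (c : ℝ) :
    ∫ ω, Complex.exp ((c * Y (n + 1) ω : ℝ) * Complex.I) ∂P = Real.cos c := by
  have hm : ∀ a : ℤ, MeasurableSet {ω | Y (n + 1) ω = a} := fun a =>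
    h.measurable n (measurableSet_singleton a)
  have e : (fun ω => Complex.exp ((c * Y (n + 1) ω : ℝ) * Complex.I)) =ᵐ[P] fun ω =>
      {ω | Y (n + 1) ω = 1}.indicator (fun _ => Complex.exp (c * Complex.I)) ω +
      {ω | Y (n + 1) ω = -1}.indicator (fun _ => Complex.exp (-c * Complex.I)) ω := by
    filter_upwards [h.ae_sign n] with ω hω
    rcases hω with hω | hω <;> simp [hω, Set.indicator]
  rw [integral_congr_ae e, integral_add, integral_indicator_const _ (hm 1),
    integral_indicator_const _ (hm (-1)), measureReal_def, measureReal_def, h.prob_one,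
    h.prob_neg_one, Complex.ofReal_cos, Complex.cos]
  · simp
    ring
  · exact (integrable_const _).indicator (hm 1)
  · exact (integrable_const _).indicator (hm (-1))

lemma integral_cexp_sum [IsProbabilityMeasure P] (h : FairSigns P F Y) (c : ℕ → ℝ) (n : ℕ) :
    ∫ ω, Complex.exp ((∑ k ∈ Finset.range n, c k * Y (k + 1) ω : ℝ) * Complex.I) ∂P =
      ∏ k ∈ Finset.range n, (Real.cos (c k) : ℂ) := by
  induction n with
  | zero => simp
  | succ n ih =>
    have hA : Measurable[F n] (fun ω =>
        Complex.exp ((∑ k ∈ Finset.range n, c k * Y (k + 1) ω : ℝ) * Complex.I)) := by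
      refine h.measurable_functional (g := fun x : ℕ → ℤ =>
        Complex.exp ((∑ k ∈ Finset.range n, c k * x (k + 1) : ℝ) * Complex.I)) fun x y hxy => ?_
      have : ∑ k ∈ Finset.range n, c k * (x (k + 1) : ℝ) =
          ∑ k ∈ Finset.range n, c k * (y (k + 1) : ℝ) :=
        Finset.sum_congr rfl fun k hk => by
          rw [hxy (k + 1) (by omega) (Finset.mem_range.1 hk)]
      simp only [this]
    have hB : Measurable[MeasurableSpace.comap (Y (n + 1)) ⊤] (fun ω =>
        Complex.exp ((c n * Y (n + 1) ω : ℝ) * Complex.I)) :=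
      (measurable_of_countable (fun z : ℤ => Complex.exp ((c n * z : ℝ) * Complex.I))).comp
        (comap_measurable (Y (n + 1)))
    have hind := indep_of_indep_of_le_left (indep_of_indep_of_le_right (h.indep n) hB.comap_le)
      hA.comap_le
    have key := IndepFun.integral_fun_mul_eq_mul_integral ((IndepFun_iff_Indep _ _ _).2 hind)
      (hA.mono (h.le n) le_rfl).aestronglyMeasurable
      (hB.mono (h.measurable n).comap_le le_rfl).aestronglyMeasurable
    rw [Finset.prod_range_succ, ← ih, ← h.integral_cexp n (c n), ← key]
    refine integral_congr_ae (Eventually.of_forall fun ω => ?_)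
    simp only [Finset.sum_range_succ]
    rw [← Complex.exp_add]
    push_cast
    ring_nf

/-- The joint characteristic function of the increments of a fair walk. -/
lemma integral_cexp_increments [IsProbabilityMeasure P] (h : FairSigns P F Y) {d : ℕ}
    {N : Fin (d + 1) → ℕ} (hN : Monotone N) (a : Fin d → ℝ) :
    ∫ ω, Complex.exp ((∑ l, a l * ((partialSum (fun k => Y k ω) (N l.succ) : ℝ) -
      partialSum (fun k => Y k ω) (N l.castSucc)) : ℝ) * Complex.I) ∂P =
      ∏ l, ((Real.cos (a l) ^ (N l.succ - N l.castSucc) : ℝ) : ℂ) := by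
  have hlast : ∀ l : Fin d, N l.succ ≤ N (Fin.last d) := fun l => hN (Fin.le_last _)
  have hstep : ∀ l : Fin d, N l.castSucc ≤ N l.succ := fun l => hN (Fin.castSucc_le_succ l)
  have h1 := h.integral_cexp_sum
    (fun k => ∑ l, if N l.castSucc ≤ k ∧ k < N l.succ then a l else 0) (N (Fin.last d))
  have h2 : ∀ ω, ∑ l, a l * ((partialSum (fun k => Y k ω) (N l.succ) : ℝ) -
      partialSum (fun k => Y k ω) (N l.castSucc)) = ∑ k ∈ Finset.range (N (Fin.last d)),
      (∑ l, if N l.castSucc ≤ k ∧ k < N l.succ then a l else 0) * Y (k + 1) ω := by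
    intro ω
    simp_rw [partialSum_sub_eq_sum _ (hstep _) (hlast _), Finset.mul_sum, Finset.sum_mul]
    rw [Finset.sum_comm]
    refine Finset.sum_congr rfl fun k _ => Finset.sum_congr rfl fun l _ => ?_
    split_ifs <;> simp
  simp_rw [h2]
  rw [h1]
  have hlt : ∀ (k : ℕ) (i j : Fin d), k < N i.succ → N j.castSucc ≤ k → j ≤ i := by
    intro k i j hi hj
    by_contra hij
    have : i.succ ≤ j.castSucc := Fin.succ_le_castSucc_iff.2 (not_le.1 hij)
    have := hN this
    omega
  have h3 : ∀ k, Real.cos (∑ l, if N l.castSucc ≤ k ∧ k < N l.succ then a l else 0) =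
      ∏ l, if N l.castSucc ≤ k ∧ k < N l.succ then Real.cos (a l) else 1 := by
    intro k
    rw [prod_cos_eq_cos_sum]
    · refine Finset.prod_congr rfl fun l _ => ?_
      split_ifs <;> simp
    · intro i _ j _ hi hj
      have hi' := (ite_ne_right_iff.1 hi).1
      have hj' := (ite_ne_right_iff.1 hj).1
      exact le_antisymm (hlt k j i hj'.2 hi'.1) (hlt k i j hi'.2 hj'.1)
  simp_rw [h3]
  norm_cast
  rw [Finset.prod_comm]
  refine Finset.prod_congr rfl fun l _ => ?_
  rw [← Finset.prod_filter, Finset.prod_const]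
  congr 1
  rw [← Nat.card_Ico]
  congr 1
  ext k
  have := hlast l
  simp only [Finset.mem_filter, Finset.mem_range, Finset.mem_Ico]
  omega

end FairSigns

/-- The scaling limit of fair walks is a Brownian motion. -/
theorem isPreBrownianReal_of_tendsto [IsProbabilityMeasure P] {F : ℕ → ℕ → MeasurableSpace Ω}
    {Y : ℕ → ℕ → Ω → ℤ} (h : ∀ m, FairSigns P (F m) (Y m)) {W : ℝ≥0 → Ω → ℝ}
    (hW : ∀ t : ℝ≥0, ∀ᵐ ω ∂P, Tendsto
      (fun m => (partialSum (fun k => Y m k ω) ⌊(t : ℝ) * 2 ^ (2 * m)⌋₊ : ℝ) / 2 ^ m) atTop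
      (𝓝 (W t ω))) :
    IsPreBrownianReal W P := by
  have hmeas : ∀ m n, Measurable (fun ω => (partialSum (fun k => Y m k ω) n : ℝ)) := fun m n =>
    ((h m).measurable_functional (g := fun x => (partialSum x n : ℝ)) (fun x y hxy =>
      congrArg Int.cast (dependsOnPast_partialSum le_rfl x y hxy))).mono ((h m).le n) le_rfl
  have hWm : ∀ t, AEMeasurable (W t) P := fun t =>
    aemeasurable_of_tendsto_metrizable_ae atTop
      (fun m => ((hmeas m _).div_const _).aemeasurable) (hW t)
  have hfloor : ∀ t : ℝ≥0, Tendsto (fun m : ℕ => (⌊(t : ℝ) * 2 ^ (2 * m)⌋₊ : ℝ) / 2 ^ (2 * m))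
      atTop (𝓝 t) := by
    intro t
    refine (tendsto_nat_floor_mul_div_atTop (R := ℝ) t.2).comp ?_
    simp_rw [pow_mul]
    exact tendsto_pow_atTop_atTop_of_one_lt (by norm_num)
  -- The joint characteristic function of the increments passes to the limit by dominated
  -- convergence. The product form gives independence, and d = 1 gives the Gaussian laws.
  have key : ∀ (d : ℕ) (t : Fin (d + 1) → ℝ≥0), Monotone t → ∀ a : Fin d → ℝ,
      ∫ ω, Complex.exp ((∑ l, a l * (W (t l.succ) ω - W (t l.castSucc) ω) : ℝ) * Complex.I) ∂P =
        ∏ l, ((Real.exp (-((t l.succ - t l.castSucc : ℝ) * a l ^ 2 / 2)) : ℝ) : ℂ) := by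
    intro d t ht a
    have hmono : ∀ m : ℕ, Monotone fun l => ⌊(t l : ℝ) * 2 ^ (2 * m)⌋₊ := fun m i j hij => by
      have : (t i : ℝ) ≤ t j := ht hij
      dsimp only
      gcongr
    have hR : Tendsto (fun m : ℕ => ∏ l : Fin d, ((Real.cos (a l / 2 ^ m) ^
        (⌊(t l.succ : ℝ) * 2 ^ (2 * m)⌋₊ - ⌊(t l.castSucc : ℝ) * 2 ^ (2 * m)⌋₊) : ℝ) : ℂ)) atTop
        (𝓝 (∏ l, ((Real.exp (-((t l.succ - t l.castSucc : ℝ) * a l ^ 2 / 2)) : ℝ) : ℂ))) := by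
      refine tendsto_finsetProd _ fun l _ => ?_
      refine (Complex.continuous_ofReal.tendsto _).comp (tendsto_cos_pow ?_)
      refine ((hfloor (t l.succ)).sub (hfloor (t l.castSucc))).congr fun m => ?_
      rw [Nat.cast_sub (hmono m (Fin.castSucc_le_succ l)), sub_div]
    have hL : Tendsto (fun m : ℕ => ∫ ω, Complex.exp ((∑ l, a l / 2 ^ m *
        ((partialSum (fun k => Y m k ω) ⌊(t (Fin.succ l) : ℝ) * 2 ^ (2 * m)⌋₊ : ℝ) -
        partialSum (fun k => Y m k ω) ⌊(t (Fin.castSucc l) : ℝ) * 2 ^ (2 * m)⌋₊) : ℝ) *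
          Complex.I) ∂P) atTop
        (𝓝 (∫ ω, Complex.exp ((∑ l, a l * (W (t l.succ) ω - W (t l.castSucc) ω) : ℝ) *
          Complex.I) ∂P)) := by
      refine tendsto_integral_of_dominated_convergence (fun _ => (1 : ℝ)) (fun m => ?_)
        (integrable_const _) (fun m => Eventually.of_forall fun ω => ?_) ?_
      · refine Measurable.aestronglyMeasurable ?_
        refine Complex.measurable_exp.comp (Measurable.mul_const (Complex.measurable_ofReal.comp ?_) _)
        exact Finset.measurable_sum _ fun l _ => ((hmeas m _).sub (hmeas m _)).const_mul _
      · rw [Complex.norm_exp_ofReal_mul_I]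
      · have := ae_all_iff.2 fun i => hW (t i)
        filter_upwards [this] with ω hω
        refine (Complex.continuous_exp.tendsto _).comp (Tendsto.mul_const _
          ((Complex.continuous_ofReal.tendsto _).comp (tendsto_finsetSum _ fun l _ => ?_)))
        refine (((hω l.succ).sub (hω l.castSucc)).const_mul (a l)).congr fun m => ?_
        ring
    refine tendsto_nhds_unique hL (hR.congr fun m => ?_)
    rw [(h m).integral_cexp_increments (hmono m) (fun l => a l / 2 ^ m)]
  have hone : ∀ s t : ℝ≥0, s ≤ t → ∀ a : ℝ, charFun (P.map (W t - W s)) a =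
      ((Real.exp (-((t - s : ℝ) * a ^ 2 / 2)) : ℝ) : ℂ) := by
    intro s t hst a
    have hk := key 1 ![s, t] (by
      intro i j hij
      fin_cases i <;> fin_cases j <;> simp_all) (fun _ => a)
    simp only [Finset.univ_unique, Finset.sum_singleton, Finset.prod_singleton] at hk
    rw [charFun_apply_real, integral_map ((hWm t).sub (hWm s)) (by fun_prop)]
    refine Eq.trans ?_ hk
    refine integral_congr_ae (Eventually.of_forall fun ω => ?_)
    simp
  have hzero : ∀ᵐ ω ∂P, W 0 ω = 0 := by
    filter_upwards [hW 0] with ω hω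
    refine tendsto_nhds_unique hω ?_
    simp [partialSum]
  refine HasIndepIncrements.isPreBrownianReal_of_hasLaw (fun t => ⟨hWm t, ?_⟩) fun d t ht => ?_
  · have : IsProbabilityMeasure (P.map (W t)) := Measure.isProbabilityMeasure_map (hWm t)
    refine Measure.ext_of_charFun (funext fun a => ?_)
    have e : W t =ᵐ[P] W t - W 0 := by
      filter_upwards [hzero] with ω hω
      simp [hω]
    rw [Measure.map_congr e, hone 0 t zero_le a, charFun_gaussianReal]
    push_cast
    congr 1
    simp
  · change iIndepFun (fun i : Fin d => W (t i.succ) - W (t i.castSucc)) P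
    rw [iIndepFun_iff_charFun_pi fun i => (hWm _).sub (hWm _)]
    intro a
    simp_rw [hone _ _ (ht (Fin.castSucc_le_succ _))]
    rw [← key d t ht fun l => a l, charFun_apply, integral_map]
    · refine integral_congr_ae (Eventually.of_forall fun ω => ?_)
      simp [PiLp.inner_apply]
    · have : AEMeasurable (fun ω (i : Fin d) => (W (t i.succ) - W (t i.castSucc)) ω) P :=
        aemeasurable_pi_lambda _ fun i => (hWm _).sub (hWm _)
      exact (MeasurableEquiv.toLp 2 (Fin d → ℝ)).measurable.comp_aemeasurable this
    · fun_prop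

end TwistShrink

/-! ### Error rates, Borel–Cantelli, and a measurable version of the limit -/

namespace TwistShrink

/-- The order of the error on the strip of height `K` at level `m`. -/
noncomputable def errorRate (K : ℝ) (m : ℕ) : ℝ :=
  (max 1 K) ^ (1 / 4 : ℝ) * logStar K ^ (3 / 4 : ℝ) * (m : ℝ) ^ (3 / 4 : ℝ) *
    (2 : ℝ) ^ (-(m : ℝ) / 2)

lemma logStar_pos (K : ℝ) : 0 < logStar K := lt_max_of_lt_left one_pos

lemma errorRate_pos (K : ℝ) {m : ℕ} (hm : 1 ≤ m) : 0 < errorRate K m := by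
  have h1 : 0 < max 1 K := lt_max_of_lt_left one_pos
  have h2 := logStar_pos K
  have h3 : (0 : ℝ) < m := by exact_mod_cast hm
  unfold errorRate
  positivity

lemma stripDist_mono {K K' : ℝ} (h : K ≤ K') (f g : ℝ≥0 → ℝ → ℝ) :
    stripDist K f g ≤ stripDist K' f g :=
  iSup_mono fun _ => iSup_mono' fun ht => ⟨ht.trans h, le_rfl⟩

lemma LevelsGood.stripDist_le {X x : ℕ → ℕ → ℤ} {C K : ℝ} {m : ℕ} (hC : 1 < C) (hK : 0 < K)
    (hm : 1 ≤ m) (hx : Describes x X) (hG : LevelsGood x C K m)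
    (hL : LargeFrom C (K * 2 ^ (2 * m))) :
    stripDist K (limitLocalTime X) (approxLocalTime X m) ≤
      ENNReal.ofReal (73 * C * errorRate K m) := by
  refine iSup_le fun t => iSup_le fun ht => iSup_le fun z => ENNReal.ofReal_le_ofReal ?_
  have h1 := ((hG.tendsto hC hK.le hx hL ht).2 z).2 0
  have h2 := fluct_div_le hK hm (hL _ le_rfl).one_le
  have h3 := errorRate_pos K hm
  rw [← errorRate] at h2
  rw [add_zero, pow_zero, mul_one] at h1
  calc _ ≤ _ := h1
    _ ≤ 4 * (9.36 * C * (1.93 * errorRate K m)) := by gcongr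
    _ = 72.2592 * (C * errorRate K m) := by ring
    _ ≤ 73 * (C * errorRate K m) := by gcongr; norm_num
    _ = _ := by ring

lemma rate_mul_errorRate (K : ℝ) {m : ℕ} (hm : 1 ≤ m) :
    ((m : ℝ) ^ (-(3 / 4) : ℝ) * (2 : ℝ) ^ ((m : ℝ) / 2)) * errorRate K m =
      (max 1 K) ^ (1 / 4 : ℝ) * logStar K ^ (3 / 4 : ℝ) := by
  have h3 : (0 : ℝ) < m := by exact_mod_cast hm
  have e1 : (m : ℝ) ^ (-(3 / 4) : ℝ) * (m : ℝ) ^ (3 / 4 : ℝ) = 1 := by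
    rw [← Real.rpow_add h3]; norm_num
  have e2 : (2 : ℝ) ^ ((m : ℝ) / 2) * (2 : ℝ) ^ (-(m : ℝ) / 2) = 1 := by
    rw [← Real.rpow_add two_pos, neg_div, add_neg_cancel, Real.rpow_zero]
  unfold errorRate
  linear_combination (max 1 K) ^ (1 / 4 : ℝ) * logStar K ^ (3 / 4 : ℝ) *
    ((2 : ℝ) ^ ((m : ℝ) / 2) * (2 : ℝ) ^ (-(m : ℝ) / 2) * e1 + e2)

/-- This is the price of replacing K by the next power of two: 2^{1/4} from the power and 2^{3/4}
from the logarithm. From K ≥ 3 on, log K exceeds 1. -/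
lemma rate_mul_errorRate_le {K K' : ℝ} (hK : 3 ≤ K) (h1 : K ≤ K') (h2 : K' ≤ 2 * K) (m : ℕ) :
    (K ^ (-(1 / 4) : ℝ) * Real.log K ^ (-(3 / 4) : ℝ)) * errorRate K' m ≤
      2 * ((m : ℝ) ^ (3 / 4 : ℝ) * (2 : ℝ) ^ (-(m : ℝ) / 2)) := by
  have hK0 : 0 < K := by linarith
  have hl : 1 < Real.log K := by
    rw [Real.lt_log_iff_exp_lt hK0]
    linarith [Real.exp_one_lt_d9]
  have hl0 : 0 < Real.log K := by linarith
  have e1 : (max 1 K') ^ (1 / 4 : ℝ) ≤ 2 ^ (1 / 4 : ℝ) * K ^ (1 / 4 : ℝ) := by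
    rw [← Real.mul_rpow two_pos.le hK0.le, max_eq_right (by linarith)]
    have : 0 ≤ K' := by linarith
    gcongr
  have hls : logStar K' ≤ 2 * Real.log K := by
    refine max_le (by linarith) ?_
    calc Real.log K' ≤ Real.log (2 * K) := Real.log_le_log (by linarith) h2
      _ = Real.log 2 + Real.log K := Real.log_mul two_ne_zero hK0.ne'
      _ ≤ 2 * Real.log K := by linarith [Real.log_two_lt_d9]
  have e2 : logStar K' ^ (3 / 4 : ℝ) ≤ 2 ^ (3 / 4 : ℝ) * Real.log K ^ (3 / 4 : ℝ) := by
    rw [← Real.mul_rpow two_pos.le hl0.le]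
    have := logStar_pos K'
    gcongr
  have e3 : K ^ (-(1 / 4) : ℝ) * K ^ (1 / 4 : ℝ) = 1 := by
    rw [← Real.rpow_add hK0]; norm_num
  have e4 : Real.log K ^ (-(3 / 4) : ℝ) * Real.log K ^ (3 / 4 : ℝ) = 1 := by
    rw [← Real.rpow_add hl0]; norm_num
  have e5 : (2 : ℝ) ^ (1 / 4 : ℝ) * 2 ^ (3 / 4 : ℝ) = 2 := by
    rw [← Real.rpow_add two_pos]; norm_num
  have hls0 := logStar_pos K'
  calc (K ^ (-(1 / 4) : ℝ) * Real.log K ^ (-(3 / 4) : ℝ)) * errorRate K' m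
      = (K ^ (-(1 / 4) : ℝ) * Real.log K ^ (-(3 / 4) : ℝ)) *
        ((max 1 K') ^ (1 / 4 : ℝ) * logStar K' ^ (3 / 4 : ℝ)) *
        ((m : ℝ) ^ (3 / 4 : ℝ) * (2 : ℝ) ^ (-(m : ℝ) / 2)) := by unfold errorRate; ring
    _ ≤ (K ^ (-(1 / 4) : ℝ) * Real.log K ^ (-(3 / 4) : ℝ)) *
        ((2 ^ (1 / 4 : ℝ) * K ^ (1 / 4 : ℝ)) * (2 ^ (3 / 4 : ℝ) * Real.log K ^ (3 / 4 : ℝ))) *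
        ((m : ℝ) ^ (3 / 4 : ℝ) * (2 : ℝ) ^ (-(m : ℝ) / 2)) := by gcongr
    _ = (K ^ (-(1 / 4) : ℝ) * K ^ (1 / 4 : ℝ)) *
        (Real.log K ^ (-(3 / 4) : ℝ) * Real.log K ^ (3 / 4 : ℝ)) *
        ((2 : ℝ) ^ (1 / 4 : ℝ) * 2 ^ (3 / 4 : ℝ)) *
        ((m : ℝ) ^ (3 / 4 : ℝ) * (2 : ℝ) ^ (-(m : ℝ) / 2)) := by ring
    _ = _ := by rw [e3, e4, e5]; ring

lemma dependsOnPast_walkLocalTime {k n : ℕ} (h : k ≤ n) (z : ℤ) :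
    DependsOnPast n (fun x => walkLocalTime (partialSum x) k z) := by
  intro x y hxy
  refine congrArg Finset.card (Finset.filter_congr fun j hj => ?_)
  have hj' := Finset.mem_range.1 hj
  rw [show partialSum x j = partialSum y j from dependsOnPast_partialSum (by omega) x y hxy]

lemma dependsOnPast_gridInterp (s y : ℝ) :
    DependsOnPast (⌊s⌋₊ + 1)
      (fun x => gridInterp (fun k j => (walkLocalTime (partialSum x) k j : ℝ)) s y) := by
  intro x x' hxx
  have h : ∀ k ≤ ⌊s⌋₊ + 1, ∀ z, walkLocalTime (partialSum x) k z = walkLocalTime (partialSum x') k z :=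
    fun k hk z => dependsOnPast_walkLocalTime hk z x x' hxx
  simp only [gridInterp, h ⌊s⌋₊ (by omega), h (⌊s⌋₊ + 1) le_rfl]

section Probability

variable {Ω : Type*} {mΩ : MeasurableSpace Ω} {P : Measure Ω}

/-- Borel–Cantelli: geometric growth of the step numbers makes the failure probabilities summable.
One lemma serves both rates, with K fixed and m = i, and with m fixed and K = 2^i. -/
lemma ae_eventually_levelsGood [IsProbabilityMeasure P] {F : ℕ → ℕ → MeasurableSpace Ω}
    {Y : ℕ → ℕ → Ω → ℤ} (h : ∀ m, FairSigns P (F m) (Y m)) {C c q : ℝ} (hC : 1 < C) (hc : 0 < c)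
    (hq : 1 < q) {K : ℕ → ℝ} {m : ℕ → ℕ} (hK : ∀ i, 0 < K i)
    (hKm : ∀ i, K i * 2 ^ (2 * m i) = c * q ^ i) :
    ∀ᵐ ω ∂P, ∀ᶠ i in atTop, LevelsGood (fun j k => Y j k ω) C (K i) (m i) ∧
      LargeFrom C (K i * 2 ^ (2 * m i)) := by
  have hlarge : ∀ᶠ i in atTop, LargeFrom C (K i * 2 ^ (2 * m i)) := by
    obtain ⟨N, hN⟩ := eventually_atTop.1 (eventually_largeSteps hC)
    have hgrow : Tendsto (fun i => c * q ^ i) atTop atTop :=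
      (tendsto_pow_atTop_atTop_of_one_lt hq).const_mul_atTop hc
    filter_upwards [hgrow.eventually_ge_atTop N] with i hi n hn
    rw [hKm] at hn
    exact hN n (hi.trans hn)
  set r : ℝ := 1 / (1 - (4 : ℝ) ^ (1 - C)) with hr
  have hr0 : 0 ≤ r := by
    have := Real.rpow_lt_one_of_one_lt_of_neg (x := 4) (z := 1 - C) (by norm_num) (by linarith)
    rw [hr]
    exact div_nonneg zero_le_one (by linarith)
  have hsum : Summable fun i : ℕ => r * (c ^ (1 - C) * (q ^ (1 - C)) ^ i) :=
    ((summable_geometric_of_lt_one (by positivity)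
      (Real.rpow_lt_one_of_one_lt_of_neg hq (by linarith))).mul_left _).mul_left _
  have hE : ∀ i, P {ω | LargeFrom C (K i * 2 ^ (2 * m i)) ∧
      ¬ LevelsGood (fun j k => Y j k ω) C (K i) (m i)} ≤
      ENNReal.ofReal (r * (c ^ (1 - C) * (q ^ (1 - C)) ^ i)) := by
    intro i
    by_cases hL : LargeFrom C (K i * 2 ^ (2 * m i))
    · refine (measure_mono fun ω hω => hω.2).trans ((prob_not_levelsGood_le h hC (hK i) hL).trans
        (le_of_eq ?_))
      rw [hKm, Real.mul_rpow hc.le (by positivity), Real.rpow_pow_comm (by linarith)]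
    · simp [hL]
  have hfin := ne_top_of_le_ne_top hsum.tsum_ofReal_ne_top (ENNReal.tsum_le_tsum hE)
  filter_upwards [ae_eventually_notMem hfin] with ω hω
  filter_upwards [hω, hlarge] with i hi hL
  exact ⟨by_contra fun hG => hi ⟨hL, hG⟩, hL⟩

/-- A measurable version of the limit of the local times. -/
lemma exists_measurable_localTime [IsProbabilityMeasure P] {X x : ℕ → ℕ → Ω → ℤ}
    {F : ℕ → ℕ → MeasurableSpace Ω} (h : ∀ m, FairSigns P (F m) (x m))
    (hx : ∀ᵐ ω ∂P, Describes (fun i k => x i k ω) (fun i k => X i k ω)) :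
    ∃ L : ℝ≥0 → ℝ → Ω → ℝ, (∀ t z, Measurable (L t z)) ∧
      ∀ᵐ ω ∂P, (fun t z => L t z ω) = limitLocalTime (fun i k => X i k ω) := by
  classical
  have hgood := hx.and (ae_eventuallyGood h)
  -- Off this null set the limit is a pointwise limit of measurable functions of the fair walks; on
  -- it convergence may fail, and the value is set to 0.
  obtain ⟨s, hs, hsm, hs0⟩ := exists_measurable_superset_of_null (ae_iff.1 hgood)
  refine ⟨fun t z => sᶜ.indicator fun ω => limitLocalTime (fun i k => X i k ω) t z, ?_, ?_⟩
  · intro t z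
    refine measurable_of_tendsto_metrizable (f := fun m => sᶜ.indicator fun ω =>
      gridInterp (fun k j => (walkLocalTime (partialSum (fun k => x m k ω)) k j : ℝ))
        (t * 2 ^ (2 * m)) (z * 2 ^ m) / 2 ^ m) (fun m => ?_) ?_
    · exact ((((h m).measurable_functional (dependsOnPast_gridInterp _ _)).mono ((h m).le _)
        le_rfl).div_const _).indicator hsm.compl
    · rw [tendsto_pi_nhds]
      intro ω
      by_cases hω : ω ∈ s
      · simp [hω]
      · obtain ⟨h1, h2⟩ := not_not.1 fun hn => hω (hs hn)
        simp only [indicator_of_mem (mem_compl hω)]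
        refine (tendsto_approxLocalTime h1 h2 t z).congr fun m => ?_
        rw [approxLocalTime_eq, (h1 m).2.2]
  · filter_upwards [compl_mem_ae_iff.2 hs0] with ω hω
    funext t z
    exact indicator_of_mem hω _

end Probability

end TwistShrink

/-! ### The theorem -/

theorem theorem3 :
    ∃ N : ℝ → ℝ, ∀ {Ω : Type*} [MeasurableSpace Ω] (P : Measure Ω) [IsProbabilityMeasure P]
      (X : ℕ → ℕ → Ω → ℤ),
      (∀ m k, 1 ≤ k → Measurable (X m k)) →
      (∀ m k, 1 ≤ k → P {ω | X m k ω = 1} = 1 / 2 ∧ P {ω | X m k ω = -1} = 1 / 2) →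
      iIndepFun (fun (p : ℕ × ℕ) => X p.1 (p.2 + 1)) P →
      ∃ (W : ℝ≥0 → Ω → ℝ) (L : ℝ≥0 → ℝ → Ω → ℝ),
        -- the Brownian motion `W` is the almost sure limit of the approximating walks
        IsBrownianReal W P ∧
        (∀ᵐ ω ∂P, ∀ K : ℝ,
          TendstoUniformlyOn (fun m t => TwistShrink.approxWalk (fun i k => X i k ω) m t)
            (fun t => W t ω) atTop {t : ℝ≥0 | (t : ℝ) ≤ K}) ∧
        -- uniform convergence of the local times on strips
        (∀ t x, Measurable (L t x)) ∧
        (∀ᵐ ω ∂P, ∀ K : ℝ,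
          TendstoUniformlyOn
            (fun m (p : ℝ≥0 × ℝ) =>
              TwistShrink.approxLocalTime (fun i k => X i k ω) m p.1 p.2)
            (fun p => L p.1 p.2 ω) atTop ({t : ℝ≥0 | (t : ℝ) ≤ K} ×ˢ univ)) ∧
        -- the limit is jointly continuous and is the local time of `W`
        (∀ᵐ ω ∂P, Continuous (fun p : ℝ≥0 × ℝ => L p.1 p.2 ω)) ∧
        (∀ᵐ ω ∂P, TwistShrink.IsLevyLocalTime (fun t => W t ω) (fun t x => L t x ω)) ∧
        -- the probability bound
        (∀ (C K : ℝ) (m : ℕ), 1 < C → 0 < K → 1 ≤ m → N C ≤ K * 2 ^ (2 * m) →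
          P {ω | ENNReal.ofReal (79 * C * (max 1 K) ^ (1 / 4 : ℝ) *
                  TwistShrink.logStar K ^ (3 / 4 : ℝ) * (m : ℝ) ^ (3 / 4 : ℝ) *
                  (2 : ℝ) ^ (-(m : ℝ) / 2))
                ≤ TwistShrink.stripDist K (fun t x => L t x ω)
                    (TwistShrink.approxLocalTime (fun i k => X i k ω) m)}
            ≤ ENNReal.ofReal
                (15 / (1 - (4 : ℝ) ^ (1 - C)) * (K * 2 ^ (2 * m)) ^ (1 - C))) ∧
        -- the almost sure rate as `m → ∞`
        (∀ K : ℝ, 0 < K → ∀ᵐ ω ∂P,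
          limsup (fun m : ℕ =>
              ENNReal.ofReal ((m : ℝ) ^ (-(3 / 4) : ℝ) * (2 : ℝ) ^ ((m : ℝ) / 2)) *
                TwistShrink.stripDist K (fun t x => L t x ω)
                  (TwistShrink.approxLocalTime (fun i k => X i k ω) m)) atTop
            < ENNReal.ofReal
                (80 * (max 1 K) ^ (1 / 4 : ℝ) * TwistShrink.logStar K ^ (3 / 4 : ℝ))) ∧
        -- the almost sure rate as `K → ∞`
        (∀ m : ℕ, 1 ≤ m → ∀ᵐ ω ∂P,
          limsup (fun K : ℝ =>
              ENNReal.ofReal (K ^ (-(1 / 4) : ℝ) * Real.log K ^ (-(3 / 4) : ℝ)) *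
                TwistShrink.stripDist K (fun t x => L t x ω)
                  (TwistShrink.approxLocalTime (fun i k => X i k ω) m)) atTop
            < ENNReal.ofReal
                (159 * (m : ℝ) ^ (3 / 4 : ℝ) * (2 : ℝ) ^ (-(m : ℝ) / 2))) := by
  have hN : ∀ C : ℝ, ∃ N : ℝ, 1 < C → ∀ n, N ≤ n → TwistShrink.LargeSteps C n := by
    intro C
    by_cases hC : 1 < C
    · obtain ⟨N, hN⟩ := eventually_atTop.1 (TwistShrink.eventually_largeSteps hC)
      exact ⟨N, fun _ => hN⟩
    · exact ⟨0, fun h => absurd h hC⟩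
  choose N hN using hN
  refine ⟨N, fun {Ω} _ P _ X hmeas hprob hind => ?_⟩
  have hfair := TwistShrink.fairSigns_signedStep hmeas hprob hind
  have hdesc : ∀ᵐ ω ∂P, TwistShrink.Describes
      (fun m k => TwistShrink.signedStep (fun i k => X i k ω) m k) (fun i k => X i k ω) :=
    TwistShrink.ae_twistedStep_eq hmeas hprob hind
  have hgood := TwistShrink.ae_eventuallyGood hfair
  obtain ⟨L, hLm, hL⟩ := TwistShrink.exists_measurable_localTime hfair hdesc
  refine ⟨fun t ω => TwistShrink.limitWalk (fun i k => X i k ω) t, L, ⟨?_, ?_⟩, ?_, hLm, ?_, ?_, ?_,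
    ?_, ?_, ?_⟩
  · refine TwistShrink.isPreBrownianReal_of_tendsto hfair fun t => ?_
    filter_upwards [hdesc, hgood] with ω hx hE
    refine (TwistShrink.tendsto_approxWalk hx hE t).congr_dist ?_
    refine squeeze_zero (fun _ => dist_nonneg) (fun m => ?_)
      (tendsto_inv_atTop_zero.comp (tendsto_pow_atTop_atTop_of_one_lt (r := (2 : ℝ)) one_lt_two))
    rw [← (hx m).2.2, Function.comp_apply, ← one_div]
    exact TwistShrink.abs_approxWalk_sub_le hx m t
  · filter_upwards [hdesc, hgood] with ω hx hE
    exact TwistShrink.continuous_limitWalk hx hE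
  · filter_upwards [hdesc, hgood] with ω hx hE
    exact TwistShrink.tendstoUniformlyOn_walk hx hE
  · filter_upwards [hdesc, hgood, hL] with ω hx hE hLω K
    have := TwistShrink.tendstoUniformlyOn_localTime hx hE K
    rwa [← hLω] at this
  · filter_upwards [hdesc, hgood, hL] with ω hx hE hLω
    have := TwistShrink.continuous_limitLocalTime hx hE
    rwa [← hLω] at this
  · filter_upwards [hdesc, hgood, hL] with ω hx hE hLω
    rw [hLω]
    exact TwistShrink.isLevyLocalTime_limit hx hE
  · intro C K m hC hK hm hNK
    have hlarge : TwistShrink.LargeFrom C (K * 2 ^ (2 * m)) := fun n hn => hN C hC n (hNK.trans hn)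
    have hr := Real.rpow_lt_one_of_one_lt_of_neg (x := 4) (z := 1 - C) (by norm_num) (by linarith)
    -- On the good event the error is at most 73C times the rate, strictly below the threshold 79C;
    -- hence the event forces failure of some level.
    refine le_trans (measure_mono_ae ?_) ((TwistShrink.prob_not_levelsGood_le hfair hC hK
      hlarge).trans (ENNReal.ofReal_le_ofReal ?_))
    · filter_upwards [hdesc, hL] with ω hx hLω hω hG
      have h1 := hG.stripDist_le hC hK hm hx hlarge
      rw [← hLω] at h1
      have h2 := TwistShrink.errorRate_pos K hm
      refine absurd (le_trans hω h1) (not_le.2 ?_)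
      rw [ENNReal.ofReal_lt_ofReal_iff_of_nonneg (by positivity)]
      calc 73 * C * TwistShrink.errorRate K m < 79 * C * TwistShrink.errorRate K m := by
            gcongr; norm_num
        _ = _ := by unfold TwistShrink.errorRate; ring
    · have : 0 < 1 - (4 : ℝ) ^ (1 - C) := by linarith
      gcongr
      norm_num
  · intro K hK
    -- Any C > 1 with 73C < 80 would do; here 73·21/20 = 76.65 ≤ 77.
    have hE := TwistShrink.ae_eventually_levelsGood hfair (C := 21 / 20) (c := K) (q := 4)
      (K := fun _ => K) (m := fun i => i) (by norm_num) hK (by norm_num) (fun _ => hK)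
      (fun i => by rw [pow_mul]; norm_num)
    filter_upwards [hdesc, hL, hE] with ω hx hLω hω
    have hpos : 0 < (max 1 K) ^ (1 / 4 : ℝ) * TwistShrink.logStar K ^ (3 / 4 : ℝ) := by
      have h1 : 0 < max 1 K := lt_max_of_lt_left one_pos
      have h2 := TwistShrink.logStar_pos K
      positivity
    refine lt_of_le_of_lt (b := ENNReal.ofReal
      (77 * ((max 1 K) ^ (1 / 4 : ℝ) * TwistShrink.logStar K ^ (3 / 4 : ℝ)))) ?_ ?_
    · refine limsup_le_of_le (by isBoundedDefault) ?_
      filter_upwards [hω, eventually_ge_atTop 1] with m hm hm1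
      have h1 := hm.1.stripDist_le (by norm_num) hK hm1 hx hm.2
      rw [← hLω] at h1
      refine (mul_le_mul_right h1 _).trans ?_
      rw [← ENNReal.ofReal_mul (by positivity)]
      refine ENNReal.ofReal_le_ofReal ?_
      have h2 := TwistShrink.rate_mul_errorRate K hm1
      calc _ = 73 * (21 / 20) * (((m : ℝ) ^ (-(3 / 4) : ℝ) * (2 : ℝ) ^ ((m : ℝ) / 2)) *
            TwistShrink.errorRate K m) := by ring
        _ ≤ _ := by rw [h2]; gcongr; norm_num
    · rw [mul_assoc, ENNReal.ofReal_lt_ofReal_iff (by positivity)]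
      gcongr
      norm_num
  · intro m hm
    have hE := TwistShrink.ae_eventually_levelsGood hfair (C := 21 / 20) (c := 2 ^ (2 * m)) (q := 2)
      (K := fun i => 2 ^ i) (m := fun _ => m) (by norm_num) (by positivity) (by norm_num)
      (fun i => by positivity) (fun i => mul_comm _ _)
    filter_upwards [hdesc, hL, hE] with ω hx hLω hω
    have hpos : 0 < (m : ℝ) ^ (3 / 4 : ℝ) * (2 : ℝ) ^ (-(m : ℝ) / 2) := by
      have h3 : (0 : ℝ) < m := by exact_mod_cast hm
      positivity
    refine lt_of_le_of_lt (b := ENNReal.ofReal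
      (158 * ((m : ℝ) ^ (3 / 4 : ℝ) * (2 : ℝ) ^ (-(m : ℝ) / 2)))) ?_ ?_
    · refine limsup_le_of_le (by isBoundedDefault) ?_
      obtain ⟨i₀, hi₀⟩ := eventually_atTop.1 hω
      filter_upwards [eventually_ge_atTop 3, eventually_ge_atTop ((2 : ℝ) ^ i₀)] with K hK3 hKi
      -- The strip of height K lies in that of height 2^{i+1} ≤ 2K, where the good event is
      -- available; the factor 2 lost leads to 153.3 ≤ 158.
      obtain ⟨i, hi1, hi2⟩ := exists_nat_pow_near (x := K) (y := 2) (by linarith) one_lt_two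
      have hi : i₀ ≤ i + 1 := by
        by_contra hcon
        have : (2 : ℝ) ^ (i + 1) ≤ 2 ^ i₀ := pow_le_pow_right₀ one_le_two (by omega)
        linarith
      obtain ⟨hG, hlarge⟩ := hi₀ (i + 1) hi
      have h1 := (TwistShrink.stripDist_mono hi2.le _ _).trans
        (hG.stripDist_le (by norm_num) (by positivity) hm hx hlarge)
      rw [← hLω] at h1
      refine (mul_le_mul_right h1 _).trans ?_
      have hK0 : 0 < K := by linarith
      have hl : 0 ≤ Real.log K := Real.log_nonneg (by linarith)
      rw [← ENNReal.ofReal_mul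
        (mul_nonneg (Real.rpow_nonneg hK0.le _) (Real.rpow_nonneg hl _))]
      refine ENNReal.ofReal_le_ofReal ?_
      have h2 := TwistShrink.rate_mul_errorRate_le hK3 hi2.le
        (by rw [pow_succ]; linarith) m
      calc _ = 73 * (21 / 20) * ((K ^ (-(1 / 4) : ℝ) * Real.log K ^ (-(3 / 4) : ℝ)) *
            TwistShrink.errorRate (2 ^ (i + 1)) m) := by ring
        _ ≤ 73 * (21 / 20) * (2 * ((m : ℝ) ^ (3 / 4 : ℝ) * (2 : ℝ) ^ (-(m : ℝ) / 2))) := by gcongr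
        _ = 153.3 * ((m : ℝ) ^ (3 / 4 : ℝ) * (2 : ℝ) ^ (-(m : ℝ) / 2)) := by ring
        _ ≤ _ := by gcongr; norm_num
    · rw [mul_assoc, ENNReal.ofReal_lt_ofReal_iff (by positivity)]
      gcongr
      norm_num
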